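/- Let $G=(V,E,c)$ be a directed graph with $n$ vertices, $m$ edges and real edge costs, $s$ a source vertex from which all vertices are reachable, and $E'\subseteq E$ a set of parameterized edges. For real $\lambda$ let $G_\lambda$ be $G$ with edge costs $c-\lambda\delta_{E'}$, where $\delta_{E'}$ is the indicator function of $E'$. In $G_{-\infty}$ (in $G_{\infty}$) shortest paths are those of least cost in $G$ among the paths with the minimum (maximum) number of parameterized edges. Let $\lambda^*\in[-\infty,\infty]$ be the supremum of the real $\lambda$ for which $G_\lambda$ has no negative-cost cycle (so $\lambda^*=\infty$ if there is never one, and $\lambda^*=-\infty$ if there always is one). For a tree $T$ that is a shortest path tree in $G_{\lambda'}$, with path $t_v$ from $s$ to $v$, a pivot path at the pivot point $\lambda'$ is a path $p$ from $s$ to some $v$ that is shortest in $G_{\lambda'}$ and has more parameterized edges than $t_v$; it is nondegenerate if no proper prefix of it has fewer parameterized edges than the corresponding path in $T$ and it contains no zero-cost cycle without parameterized edges. Let $T'$ be obtained from $T$ by deleting all edges that lead into vertices of $p$ and adding the edges of $p$. The Karp–Orlin inductive pivoting method starts with a shortest path tree $T_0$ for $G_{-\infty}$ (found by the Bellman–Ford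 algorithm in $G_\alpha$ with $\alpha=-1-\sum_{e}|c(e)|$, which also detects $\lambda^*=-\infty$) and repeatedly replaces the current tree $T$ by $T'$ for a nondegenerate pivot path, recording the pivot point, until there is no pivot path or $T'$ is not a tree. Consider the following implementation on a unit-cost random access machine with integer and real arithmetic. For each vertex $w$ the cost $c(t_w)$ and the number $\delta_{E'}(t_w)$ of parameterized edges of the current path are stored. The key of an edge $e=(u,v)$ is $\frac{c(t_u)+c(e)-c(t_v)}{\delta_{E'}(t_u)+\delta_{E'}(e)-\delta_{E'}(t_v)}$ if the denominator is positive, and $\infty$ otherwise; the key of a vertex is the minimum of the keys of the edges entering it. The vertices with finite key are stored in a Fibonacci heap, and a vertex of minimum key determines the next pivot path ($t_u$ followed by the edge $(u,v)$ that defines the key). After a pivot, the edges entering and leaving each vertex whose path has changed are examined and vertex keys are updated. The output consists of $\lambda^*$, of $T_0$, and for each pivot of the pivot point, the vertex whose parent edge changes, and its new parent edge. Then the algorithm always halts and reports $\lambda^*$ correctly. If $\lambda^*=-\infty$, it outputs no trees. If $\lambda^*>-\infty$, its output encodes a run of the inductive pivoting method, with trees $T_0,\dots,T_k$ and breakpoints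 $-\infty=\lambda_0\le\lambda_1\le\dots\le\lambda_k\le\lambda_{k+1}=\lambda^*$ ($\lambda_1,\dots,\lambda_k$ real), such that: 1. $T_i$ is a shortest path tree in $G_\lambda$ for every $\lambda\in[\lambda_i,\lambda_{i+1}]$, $0\le i\le k$ (including $\lambda=\pm\infty$ where these belong to the interval); 2. there are at most $n^2$ trees, that is, $k+1\le n^2$; 3. for each vertex $v$, the path from $s$ to $v$ in $T_{i+1}$ differs from the path in $T_i$ for at most $n-1$ indices $i<k$. There is an absolute constant $C$ such that the running time, including the computation of $T_0$, is at most $C\,(nm+n^2\log n)$ for every such graph with $m\ge 1$. -/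

import Mathlib

namespace KarpOrlin

/-! ## The parametric shortest path problem -/

/-- An instance: a directed graph with vertex set `Fin n` and edge set `Fin m` (parallel edges and
loops are allowed), real edge costs, a set `E'` of parameterized edges and a source vertex. -/
structure ParamGraph (n m : ℕ) where
  src : Fin m → Fin n
  tgt : Fin m → Fin n
  cost : Fin m → ℝ
  param : Finset (Fin m)
  source : Fin n

namespace ParamGraph

variable {n m : ℕ} (G : ParamGraph n m)

/-- `G.IsWalk u p v`: the list of edges `p` is a (not necessarily simple) path from `u` to `v`. -/
def IsWalk : Fin n → List (Fin m) → Fin n → Prop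
  | u, [], v => u = v
  | u, e :: p, v => G.src e = u ∧ IsWalk (G.tgt e) p v

/-- The cost `c(p)` of a path in `G`. -/
def pathCost (p : List (Fin m)) : ℝ := (p.map G.cost).sum

/-- The number `δ_{E'}(p)` of parameterized edges on a path. -/
def pathParam (p : List (Fin m)) : ℕ := p.countP (fun e => decide (e ∈ G.param))

/-- The cost `c(p) - r δ_{E'}(p)` of a path in `G_r`. -/
def costAt (r : ℝ) (p : List (Fin m)) : ℝ := G.pathCost p - r * G.pathParam p

/-- Every vertex is reachable from the source. -/
def AllReachable : Prop := ∀ v, ∃ p, G.IsWalk G.source p v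

/-- `G_r` has no negative-cost cycle. -/
def NoNegCycle (r : ℝ) : Prop := ∀ v p, G.IsWalk v p v → 0 ≤ G.costAt r p

/-- `λ*`, the largest parameter for which there is no negative-cost cycle; it is `⊤` if there is
none for any real parameter, and `⊥` if there is one for every real parameter. -/
noncomputable def lambdaStar : EReal :=
  sSup ((fun r : ℝ => (r : EReal)) '' {r : ℝ | G.NoNegCycle r})

/-- In `G_lam`, the path `p` is at most as long as the path `q`. For `lam = -∞` (`lam = ∞`), paths
with fewer (more) parameterized edges are shorter, and ties are broken by the cost in `G`. -/
def NoLonger (lam : EReal) (p q : List (Fin m)) : Prop :=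
  match lam with
  | ⊥ => G.pathParam p < G.pathParam q ∨
      (G.pathParam p = G.pathParam q ∧ G.pathCost p ≤ G.pathCost q)
  | ⊤ => G.pathParam q < G.pathParam p ∨
      (G.pathParam p = G.pathParam q ∧ G.pathCost p ≤ G.pathCost q)
  | (r : ℝ) => G.costAt r p ≤ G.costAt r q

/-- `p` is a path from the source to `v` all of whose edges are in `T`. -/
def IsTreePath (T : Finset (Fin m)) (v : Fin n) (p : List (Fin m)) : Prop :=
  G.IsWalk G.source p v ∧ ∀ e ∈ p, e ∈ T

/-- `T` is (the edge set of) a spanning tree directed away from the source: it contains exactly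
one path from the source to each vertex. -/
def IsTree (T : Finset (Fin m)) : Prop := ∀ v, ∃! p, G.IsTreePath T v p

/-- `T` is a shortest path tree in `G_lam`. -/
def IsShortestPathTree (lam : EReal) (T : Finset (Fin m)) : Prop :=
  G.IsTree T ∧ ∀ v p, G.IsTreePath T v p → ∀ q, G.IsWalk G.source q v → G.NoLonger lam p q

/-- The trees `T 0, …, T k` and the numbers `lam 0 ≤ … ≤ lam (k + 1)` are a solution of the
parametric shortest path problem. -/
structure IsSolution (k : ℕ) (T : ℕ → Finset (Fin m)) (lam : ℕ → EReal) : Prop where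
  first : lam 0 = ⊥
  last : lam (k + 1) = G.lambdaStar
  real : ∀ i, 1 ≤ i → i ≤ k → ∃ r : ℝ, lam i = r
  mono : ∀ i, i ≤ k → lam i ≤ lam (i + 1)
  tree : ∀ i, i ≤ k → ∀ x : EReal, lam i ≤ x → x ≤ lam (i + 1) → G.IsShortestPathTree x (T i)

/-- The number of `i < k` for which the path into `v` in `T i` is not the path in `T (i + 1)`. -/
noncomputable def pathChanges (k : ℕ) (T : ℕ → Finset (Fin m)) (v : Fin n) : ℕ :=
  {i : ℕ | i < k ∧ ∃ p, G.IsTreePath (T i) v p ∧ ¬ G.IsTreePath (T (i + 1)) v p}.ncard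

/-- `p` is a nondegenerate pivot path into `v` for the tree `T`, with pivot point `r`. -/
structure IsPivotPath (T : Finset (Fin m)) (r : ℝ) (v : Fin n) (p : List (Fin m)) : Prop where
  tree : G.IsShortestPathTree r T
  walk : G.IsWalk G.source p v
  shortest : ∀ q, G.IsWalk G.source q v → G.NoLonger r p q
  more : ∀ q, G.IsTreePath T v q → G.pathParam q < G.pathParam p
  proper_prefix : ∀ a b w, p = a ++ b → b ≠ [] → G.IsWalk G.source a w →
    ∀ q, G.IsTreePath T w q → G.pathParam q ≤ G.pathParam a
  no_null_cycle : ∀ a b c w, p = a ++ b ++ c → b ≠ [] → G.IsWalk w b w →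
    ¬ (G.costAt r b = 0 ∧ G.pathParam b = 0)

/-- The subgraph `T'`: delete the edges of `T` that lead into vertices of the pivot path `p`, and
add the edges of `p`. -/
def pivot (T : Finset (Fin m)) (p : List (Fin m)) : Finset (Fin m) :=
  T.filter (fun e => G.tgt e ∉ p.map G.tgt) ∪ p.toFinset

/-- The sequence is produced by the inductive pivoting method: each tree arises from its
predecessor by a nondegenerate pivot path at the corresponding pivot point, and the method stops
because there is no pivot path (then `λ* = ∞`), or because the subgraph obtained from a pivot path
is not a tree (then `λ*` is the pivot point). -/
structure IsPivotRun (k : ℕ) (T : ℕ → Finset (Fin m)) (lam : ℕ → EReal) : Prop where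
  initial : G.IsShortestPathTree ⊥ (T 0)
  step : ∀ i, i < k → ∃ (r : ℝ) (v : Fin n) (p : List (Fin m)),
    lam (i + 1) = r ∧ G.IsPivotPath (T i) r v p ∧ T (i + 1) = G.pivot (T i) p
  final : (lam (k + 1) = ⊤ ∧ ∀ r v p, ¬ G.IsPivotPath (T k) r v p) ∨
    ∃ (r : ℝ) (v : Fin n) (p : List (Fin m)),
      lam (k + 1) = r ∧ G.IsPivotPath (T k) r v p ∧ ¬ G.IsTree (G.pivot (T k) p)

end ParamGraph

/-! ## The machine model

A unit-cost random access machine with natural number cells and real number cells. Memory is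
organized in finitely many named arrays with up to two indices; a scalar variable is the cell with
indices `0, 0` of its array, a one-dimensional array has second index `0`. Every elementary
operation (memory access, constant, arithmetic operation, comparison, boolean connective,
assignment, branching) costs one unit of time. -/

/-- Names of the natural number arrays. -/
inductive NVar
  -- input: numbers of vertices and edges, source, ends of the edges, indicator of `E'`
  | n | m | s | src | tgt | isP
  -- output: result code, number of pivots, parent edges in the first tree, pivots
  | status | numPiv | par0 | outVert | outEdge
  -- incidence lists; edge `e` is stored as `e + 1`, and `0` ends a list
  | outHead | outNext | inHead | inNext
  -- current tree: parent edges (`e + 1`, or `0` for none), `δ_{E'}(t_w)`, edge defining a key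
  | par | cnt | vEdge
  -- initialization
  | ie | round | reach | chg
  -- Fibonacci heap: membership, parent, number of children (rank), children, position of a node
  -- among the children of its parent, mark, table used for linking
  | inHeap | hpar | deg | child | hpos | mark | bucket
  -- local variables of the heap operations
  | dp | dl | cx | cq | hx | hy | fx | fy | ft | fr | maxRank | best
  -- local variables of a pivot
  | pv | pe | sub | subN | inSub | si | sw | se | ke | kx | dN
  deriving DecidableEq

/-- Names of the real number arrays. -/
inductive RVar
  -- input: edge costs
  | cost
  -- output: pivot points, and `λ*` if it is finite
  | outLam | lamStar
  -- `c(t_w)`, vertex keys, a computed edge key, cost of a parameterized edge in the initialization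
  | cst | key | kap | big
  | dC
  deriving DecidableEq

/-- Natural number expressions; subtraction is truncated at `0`. -/
inductive NExp
  | lit (k : ℕ)
  | get (A : NVar) (i j : NExp)
  | add (a b : NExp)
  | sub (a b : NExp)

/-- Real number expressions. -/
inductive RExp
  | ofN (a : NExp)
  | get (A : RVar) (i j : NExp)
  | add (a b : RExp)
  | sub (a b : RExp)
  | mul (a b : RExp)
  | div (a b : RExp)

/-- Conditions. -/
inductive BExp
  | eqN (a b : NExp)
  | ltN (a b : NExp)
  | ltR (a b : RExp)
  | not (b : BExp)
  | and (b c : BExp)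
  | or (b c : BExp)

/-- Programs. -/
inductive Stmt
  | setN (A : NVar) (i j : NExp) (e : NExp)
  | setR (A : RVar) (i j : NExp) (e : RExp)
  | seq (p q : Stmt)
  | ite (b : BExp) (p q : Stmt)
  | skip
  | loop (b : BExp) (p : Stmt)

/-- The contents of the memory. -/
structure Store where
  nat : NVar → ℕ → ℕ → ℕ
  real : RVar → ℕ → ℕ → ℝ

namespace Store

def setNat (σ : Store) (A : NVar) (i j x : ℕ) : Store where
  nat := fun B k l => if B = A ∧ k = i ∧ l = j then x else σ.nat B k l
  real := σ.real

noncomputable def setReal (σ : Store) (A : RVar) (i j : ℕ) (x : ℝ) : Store where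
  nat := σ.nat
  real := fun B k l => if B = A ∧ k = i ∧ l = j then x else σ.real B k l

end Store

def NExp.eval (σ : Store) : NExp → ℕ
  | .lit k => k
  | .get A i j => σ.nat A (i.eval σ) (j.eval σ)
  | .add a b => a.eval σ + b.eval σ
  | .sub a b => a.eval σ - b.eval σ

def NExp.time : NExp → ℕ
  | .lit _ => 1
  | .get _ i j => 1 + i.time + j.time
  | .add a b => 1 + a.time + b.time
  | .sub a b => 1 + a.time + b.time

noncomputable def RExp.eval (σ : Store) : RExp → ℝ
  | .ofN a => (a.eval σ : ℝ)
  | .get A i j => σ.real A (i.eval σ) (j.eval σ)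
  | .add a b => a.eval σ + b.eval σ
  | .sub a b => a.eval σ - b.eval σ
  | .mul a b => a.eval σ * b.eval σ
  | .div a b => a.eval σ / b.eval σ

def RExp.time : RExp → ℕ
  | .ofN a => 1 + a.time
  | .get _ i j => 1 + i.time + j.time
  | .add a b => 1 + a.time + b.time
  | .sub a b => 1 + a.time + b.time
  | .mul a b => 1 + a.time + b.time
  | .div a b => 1 + a.time + b.time

def BExp.holds (σ : Store) : BExp → Prop
  | .eqN a b => a.eval σ = b.eval σ
  | .ltN a b => a.eval σ < b.eval σ
  | .ltR a b => a.eval σ < b.eval σ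
  | .not b => ¬ b.holds σ
  | .and b c => b.holds σ ∧ c.holds σ
  | .or b c => b.holds σ ∨ c.holds σ

def BExp.time : BExp → ℕ
  | .eqN a b => 1 + a.time + b.time
  | .ltN a b => 1 + a.time + b.time
  | .ltR a b => 1 + a.time + b.time
  | .not b => 1 + b.time
  | .and b c => 1 + b.time + c.time
  | .or b c => 1 + b.time + c.time

/-- `Exec p σ τ t`: started with memory `σ`, the program `p` halts after exactly `t` units of time
with memory `τ`. -/
inductive Exec : Stmt → Store → Store → ℕ → Prop
  | setN (A i j e σ) : Exec (.setN A i j e) σ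
      (σ.setNat A (i.eval σ) (j.eval σ) (e.eval σ)) (1 + i.time + j.time + e.time)
  | setR (A i j e σ) : Exec (.setR A i j e) σ
      (σ.setReal A (i.eval σ) (j.eval σ) (e.eval σ)) (1 + i.time + j.time + e.time)
  | seq {p q σ σ' σ'' t t'} : Exec p σ σ' t → Exec q σ' σ'' t' → Exec (.seq p q) σ σ'' (t + t')
  | iteTrue {b p q σ σ' t} : b.holds σ → Exec p σ σ' t → Exec (.ite b p q) σ σ' (1 + b.time + t)
  | iteFalse {b p q σ σ' t} :
      ¬ b.holds σ → Exec q σ σ' t → Exec (.ite b p q) σ σ' (1 + b.time + t)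
  | skip (σ) : Exec .skip σ σ 1
  | loopTrue {b p σ σ' σ'' t t'} : b.holds σ → Exec p σ σ' t → Exec (.loop b p) σ' σ'' t' →
      Exec (.loop b p) σ σ'' (1 + b.time + t + t')
  | loopFalse {b p σ} : ¬ b.holds σ → Exec (.loop b p) σ σ (1 + b.time)

/-- The machine is deterministic. -/
theorem Exec.deterministic {p : Stmt} {σ τ τ' : Store} {t t' : ℕ}
    (h : Exec p σ τ t) (h' : Exec p σ τ' t') : τ = τ' ∧ t = t' := by
  induction h generalizing τ' t' with
  | setN => cases h'; exact ⟨rfl, rfl⟩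
  | setR => cases h'; exact ⟨rfl, rfl⟩
  | skip => cases h'; exact ⟨rfl, rfl⟩
  | seq _ _ ih1 ih2 =>
    cases h' with
    | seq a b =>
      obtain ⟨rfl, rfl⟩ := ih1 a
      obtain ⟨rfl, rfl⟩ := ih2 b
      exact ⟨rfl, rfl⟩
  | iteTrue hb _ ih =>
    cases h' with
    | iteTrue _ a => obtain ⟨rfl, rfl⟩ := ih a; exact ⟨rfl, rfl⟩
    | iteFalse hb' _ => exact absurd hb hb'
  | iteFalse hb _ ih =>
    cases h' with
    | iteTrue hb' _ => exact absurd hb' hb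
    | iteFalse _ a => obtain ⟨rfl, rfl⟩ := ih a; exact ⟨rfl, rfl⟩
  | loopTrue hb _ _ ih1 ih2 =>
    cases h' with
    | loopTrue _ a b =>
      obtain ⟨rfl, rfl⟩ := ih1 a
      obtain ⟨rfl, rfl⟩ := ih2 b
      exact ⟨rfl, rfl⟩
    | loopFalse hb' => exact absurd hb hb'
  | loopFalse hb =>
    cases h' with
    | loopTrue hb' _ _ => exact absurd hb' hb
    | loopFalse => exact ⟨rfl, rfl⟩

/-! Abbreviations for writing programs -/

instance (k : ℕ) : OfNat NExp k := ⟨.lit k⟩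
instance : Add NExp := ⟨.add⟩
instance : Sub NExp := ⟨.sub⟩
instance : Add RExp := ⟨.add⟩
instance : Sub RExp := ⟨.sub⟩
instance : Mul RExp := ⟨.mul⟩
instance : Div RExp := ⟨.div⟩

abbrev NVar.val (A : NVar) : NExp := .get A 0 0
abbrev NVar.ix (A : NVar) (i : NExp) : NExp := .get A i 0
abbrev NVar.ix2 (A : NVar) (i j : NExp) : NExp := .get A i j
abbrev NVar.put (A : NVar) (e : NExp) : Stmt := .setN A 0 0 e
abbrev NVar.put1 (A : NVar) (i e : NExp) : Stmt := .setN A i 0 e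
abbrev NVar.put2 (A : NVar) (i j e : NExp) : Stmt := .setN A i j e
abbrev RVar.val (A : RVar) : RExp := .get A 0 0
abbrev RVar.ix (A : RVar) (i : NExp) : RExp := .get A i 0
abbrev RVar.put (A : RVar) (e : RExp) : Stmt := .setR A 0 0 e
abbrev RVar.put1 (A : RVar) (i : NExp) (e : RExp) : Stmt := .setR A i 0 e
abbrev BExp.neN (a b : NExp) : BExp := .not (.eqN a b)

/-- Execute the statements of a list in order. -/
def block : List Stmt → Stmt
  | [] => .skip
  | [p] => p
  | p :: q :: l => .seq p (block (q :: l))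

/-- `for A = 0, …, e - 1 do p`, where `p` does not change `A` and the value of `e`. -/
def forUpTo (A : NVar) (e : NExp) (p : Stmt) : Stmt :=
  block [A.put 0, .loop (.ltN A.val e) (block [p, A.put (A.val + 1)])]

/-- `if b then p`. -/
def when (b : BExp) (p : Stmt) : Stmt := .ite b p .skip

section Program

open NVar RVar

/-! ## The Fibonacci heap

The nodes are the vertices `0, …, n - 1` with a finite key. Node `n` is an artificial node whose
children are the roots of the heap-ordered trees. The children of a node `x` are stored in
`child[x][0], …, child[x][deg[x] - 1]`, so that a child is added, or removed, in constant time. -/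

/-- Make `x` a child of `p`. -/
def attach (p x : NExp) : Stmt := block [
  child.put2 p (deg.ix p) x,
  hpos.put1 x (deg.ix p),
  hpar.put1 x p,
  deg.put1 p (deg.ix p + 1)]

/-- Remove `x` from the children of its parent; the last child takes its place. -/
def detach (x : NExp) : Stmt := block [
  dp.put (hpar.ix x),
  dl.put (child.ix2 dp.val (deg.ix dp.val - 1)),
  child.put2 dp.val (hpos.ix x) dl.val,
  hpos.put1 dl.val (hpos.ix x),
  deg.put1 dp.val (deg.ix dp.val - 1)]

/-- Make `x` a root, with cascading cuts: a node that is not a root is marked when it loses a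
child, and is made a root, too, when it loses a second one. The loop is left by setting
`cx` to the artificial node `n`, which is its own parent. -/
def cut (x : NExp) : Stmt := block [
  cx.put x,
  .loop (.neN (hpar.ix cx.val) n.val) (block [
    cq.put (hpar.ix cx.val),
    detach cx.val,
    mark.put1 cx.val 0,
    attach n.val cx.val,
    .ite (.and (.eqN (mark.ix cq.val) 0) (.neN (hpar.ix cq.val) n.val))
      (block [mark.put1 cq.val 1, cx.put n.val])
      (cx.put cq.val)])]

/-- Insert `x` with the given key. -/
def heapInsert (x : NExp) (k : RExp) : Stmt := block [
  key.put1 x k,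
  inHeap.put1 x 1,
  deg.put1 x 0,
  mark.put1 x 0,
  attach n.val x]

/-- Decrease the key of `x` to the given key. -/
def heapDecrease (x : NExp) (k : RExp) : Stmt := block [
  key.put1 x k,
  when (.and (.neN (hpar.ix x) n.val) (.ltR (key.ix x) (key.ix (hpar.ix x)))) (cut x)]

/-- Delete `x`; its children become roots. -/
def heapDelete (x : NExp) : Stmt := block [
  hx.put x,
  cut hx.val,
  detach hx.val,
  .loop (.ltN 0 (deg.ix hx.val)) (block [
    hy.put (child.ix2 hx.val (deg.ix hx.val - 1)),
    detach hy.val,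
    mark.put1 hy.val 0,
    attach n.val hy.val]),
  inHeap.put1 hx.val 0]

/-- Link trees whose roots have equal rank until all ranks are distinct, and set `best` to `x + 1`
for a root `x` of minimum key, and to `0` if the heap is empty. -/
def heapFindMin : Stmt := block [
  maxRank.put 0,
  .loop (.ltN 0 (deg.ix n.val)) (block [
    fx.put (child.ix2 n.val (deg.ix n.val - 1)),
    deg.put1 n.val (deg.ix n.val - 1),
    .loop (.neN (bucket.ix (deg.ix fx.val)) 0) (block [
      fy.put (bucket.ix (deg.ix fx.val) - 1),
      bucket.put1 (deg.ix fx.val) 0,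
      when (.ltR (key.ix fy.val) (key.ix fx.val))
        (block [ft.put fx.val, fx.put fy.val, fy.put ft.val]),
      attach fx.val fy.val]),
    bucket.put1 (deg.ix fx.val) (fx.val + 1),
    when (.ltN maxRank.val (deg.ix fx.val + 1)) (maxRank.put (deg.ix fx.val + 1))]),
  best.put 0,
  forUpTo fr maxRank.val (when (.neN (bucket.ix fr.val) 0) (block [
    fx.put (bucket.ix fr.val - 1),
    bucket.put1 fr.val 0,
    attach n.val fx.val,
    .ite (.eqN best.val 0) (best.put (fx.val + 1))
      (when (.ltR (key.ix fx.val) (key.ix (best.val - 1))) (best.put (fx.val + 1)))]))]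

/-! ## The parametric shortest path algorithm -/

/-- Build the incidence lists. -/
def buildLists : Stmt :=
  forUpTo ie m.val (block [
    outNext.put1 ie.val (outHead.ix (src.ix ie.val)),
    outHead.put1 (src.ix ie.val) (ie.val + 1),
    inNext.put1 ie.val (inHead.ix (tgt.ix ie.val)),
    inHead.put1 (tgt.ix ie.val) (ie.val + 1)])

/-- `big := 1 + ∑ |c(e)|`; the parameter value `α = -big` is used for the first tree. -/
def computeBig : Stmt := block [
  big.put (.ofN 1),
  forUpTo ie m.val (.ite (.ltR (cost.ix ie.val) (.ofN 0))
    (big.put (big.val - cost.ix ie.val))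
    (big.put (big.val + cost.ix ie.val)))]

/-- `n` rounds of the Bellman-Ford algorithm in `G_α`, where the tentative distance of `v` is
`cst[v] - α * cnt[v]`. Afterwards `chg = 1` iff a distance has changed in the last round, that is,
iff there is a negative-cost cycle. -/
def bellmanFord : Stmt := block [
  reach.put1 s.val 1,
  forUpTo round n.val (block [
    chg.put 0,
    forUpTo ie m.val (when
      (.and (.eqN (reach.ix (src.ix ie.val)) 1)
        (.or (.eqN (reach.ix (tgt.ix ie.val)) 0)
          (.ltR (cst.ix (src.ix ie.val) + cost.ix ie.val
              + big.val * .ofN (cnt.ix (src.ix ie.val) + isP.ix ie.val))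
            (cst.ix (tgt.ix ie.val) + big.val * .ofN (cnt.ix (tgt.ix ie.val))))))
      (block [
        cst.put1 (tgt.ix ie.val) (cst.ix (src.ix ie.val) + cost.ix ie.val),
        cnt.put1 (tgt.ix ie.val) (cnt.ix (src.ix ie.val) + isP.ix ie.val),
        par.put1 (tgt.ix ie.val) (ie.val + 1),
        reach.put1 (tgt.ix ie.val) 1,
        chg.put 1]))])]

/-- Compute the key of the edge `ke`. If it is finite and smaller than the key of the vertex `v`
which the edge enters, decrease the key of `v` to it (insert `v`, if its key was infinite). -/
def improveKey : Stmt :=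
  when (.ltN (cnt.ix (tgt.ix ke.val)) (cnt.ix (src.ix ke.val) + isP.ix ke.val)) (block [
    kx.put (tgt.ix ke.val),
    kap.put ((cst.ix (src.ix ke.val) + cost.ix ke.val - cst.ix kx.val) /
      .ofN (cnt.ix (src.ix ke.val) + isP.ix ke.val - cnt.ix kx.val)),
    .ite (.eqN (inHeap.ix kx.val) 0)
      (block [vEdge.put1 kx.val ke.val, heapInsert kx.val kap.val])
      (when (.ltR kap.val (key.ix kx.val))
        (block [vEdge.put1 kx.val ke.val, heapDecrease kx.val kap.val]))])

/-- Store the first tree, and determine the vertex keys. -/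
def initKeys : Stmt := block [
  forUpTo ie n.val (par0.put1 ie.val (par.ix ie.val)),
  hpar.put1 n.val n.val,
  forUpTo ke m.val improveKey]

/-- Determine the vertices `sub[0], …, sub[subN - 1]` of the subtree with root `pv` of the
current tree. -/
def searchSubtree : Stmt := block [
  sub.put1 0 pv.val,
  subN.put 1,
  inSub.put1 pv.val 1,
  forUpTo si subN.val (block [
    sw.put (sub.ix si.val),
    se.put (outHead.ix sw.val),
    .loop (.neN se.val 0) (block [
      when (.eqN (par.ix (tgt.ix (se.val - 1))) se.val) (block [
        sub.put1 subN.val (tgt.ix (se.val - 1)),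
        subN.put (subN.val + 1),
        inSub.put1 (tgt.ix (se.val - 1)) 1]),
      se.put (outNext.ix (se.val - 1))])])]

/-- For all vertices of the subtree, update the cost of the path and its number of parameterized
edges. -/
def updatePaths : Stmt := block [
  dC.put (cst.ix (src.ix pe.val) + cost.ix pe.val - cst.ix pv.val),
  dN.put (cnt.ix (src.ix pe.val) + isP.ix pe.val - cnt.ix pv.val),
  par.put1 pv.val (pe.val + 1),
  forUpTo si subN.val (block [
    cst.put1 (sub.ix si.val) (cst.ix (sub.ix si.val) + dC.val),
    cnt.put1 (sub.ix si.val) (cnt.ix (sub.ix si.val) + dN.val),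
    inSub.put1 (sub.ix si.val) 0])]

/-- For all vertices of the subtree, determine the new key from the entering edges, and examine
the leaving edges. -/
def updateKeys : Stmt :=
  forUpTo si subN.val (block [
    sw.put (sub.ix si.val),
    when (.eqN (inHeap.ix sw.val) 1) (heapDelete sw.val),
    se.put (inHead.ix sw.val),
    .loop (.neN se.val 0) (block [
      ke.put (se.val - 1), improveKey, se.put (inNext.ix (se.val - 1))]),
    se.put (outHead.ix sw.val),
    .loop (.neN se.val 0) (block [
      ke.put (se.val - 1), improveKey, se.put (outNext.ix (se.val - 1))])])

/-- Record the pivot in the output. -/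
def recordPivot : Stmt := block [
  outVert.put1 numPiv.val pv.val,
  outEdge.put1 numPiv.val pe.val,
  outLam.put1 numPiv.val (key.ix pv.val),
  numPiv.put (numPiv.val + 1)]

/-- The pivot path is the path in the current tree to the tail of the edge `pe`, followed by `pe`;
the new subgraph is not a tree iff that tail is in the subtree with root `pv`. -/
def pivotStep : Stmt := block [
  heapFindMin,
  .ite (.eqN best.val 0) (status.put 2) (block [
    pv.put (best.val - 1),
    pe.put (vEdge.ix pv.val),
    searchSubtree,
    .ite (.eqN (inSub.ix (src.ix pe.val)) 1)
      (block [lamStar.put (key.ix pv.val), status.put 3])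
      (block [recordPivot, updatePaths, updateKeys])])]

/-- The algorithm: the inductive pivoting method with vertex keys in a Fibonacci heap. -/
def parametricShortestPaths : Stmt := block [
  buildLists,
  computeBig,
  bellmanFord,
  .ite (.eqN chg.val 1) (status.put 1) (block [
    initKeys,
    .loop (.eqN status.val 0) pivotStep])]

end Program

/-! ## Input and output -/

/-- The initial memory: it holds the input, and `0` in all other cells. -/
noncomputable def ParamGraph.load {n m : ℕ} (G : ParamGraph n m) : Store where
  nat := fun A i j =>
    match A with
    | .n => if i = 0 ∧ j = 0 then n else 0
    | .m => if i = 0 ∧ j = 0 then m else 0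
    | .s => if i = 0 ∧ j = 0 then G.source else 0
    | .src => if h : i < m then (if j = 0 then G.src ⟨i, h⟩ else 0) else 0
    | .tgt => if h : i < m then (if j = 0 then G.tgt ⟨i, h⟩ else 0) else 0
    | .isP => if h : i < m then (if j = 0 ∧ ⟨i, h⟩ ∈ G.param then 1 else 0) else 0
    | _ => 0
  real := fun A i j =>
    match A with
    | .cost => if h : i < m then (if j = 0 then G.cost ⟨i, h⟩ else 0) else 0
    | _ => 0

namespace Store

/-- The number of pivots made. -/
def pivots (σ : Store) : ℕ := σ.nat .numPiv 0 0

/-- The number of trees in the output: none, if the algorithm has reported `λ* = -∞`. -/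
def numTrees (σ : Store) : ℕ := if σ.nat .status 0 0 = 1 then 0 else σ.pivots + 1

/-- The reported value of `λ*`. -/
noncomputable def reportedLambdaStar (σ : Store) : EReal :=
  if σ.nat .status 0 0 = 1 then ⊥
  else if σ.nat .status 0 0 = 2 then ⊤
  else (σ.real .lamStar 0 0 : EReal)

/-- The output breakpoints `λ_0, …, λ_{k+1}`, where `k` is the number of pivots. -/
noncomputable def breakpoint (σ : Store) (i : ℕ) : EReal :=
  if i = 0 then ⊥
  else if i ≤ σ.pivots then (σ.real .outLam (i - 1) 0 : EReal)
  else σ.reportedLambdaStar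

/-- The output trees `T_0, …, T_k`: the first one is given by the parent edges of the vertices,
and for each later one a vertex and its new parent edge are given. -/
def tree (σ : Store) {n m : ℕ} (G : ParamGraph n m) : ℕ → Finset (Fin m)
  | 0 => Finset.univ.filter (fun e => σ.nat .par0 (G.tgt e) 0 = (e : ℕ) + 1)
  | i + 1 => Finset.univ.filter (fun e => (e : ℕ) = σ.nat .outEdge i 0 ∨
      (e ∈ tree σ G i ∧ (G.tgt e : ℕ) ≠ σ.nat .outVert i 0))

end Store

end KarpOrlin

namespace KarpOrlin

/-! ## Program logic -/

/-- Started with memory `σ`, the program `p` halts, and its final memory and running time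
satisfy `Q`. -/
def Runs (p : Stmt) (σ : Store) (Q : Store → ℕ → Prop) : Prop :=
  ∃ τ t, Exec p σ τ t ∧ Q τ t

theorem Runs.mono {p : Stmt} {σ : Store} {Q Q' : Store → ℕ → Prop} (h : Runs p σ Q)
    (hQ : ∀ τ t, Q τ t → Q' τ t) : Runs p σ Q' := by
  obtain ⟨τ, t, he, hq⟩ := h
  exact ⟨τ, t, he, hQ τ t hq⟩

theorem runs_setN {A i j e σ Q} : Runs (.setN A i j e) σ Q ↔
    Q (σ.setNat A (i.eval σ) (j.eval σ) (e.eval σ)) (1 + i.time + j.time + e.time) := by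
  constructor
  · rintro ⟨τ, t, he, hq⟩
    cases he
    exact hq
  · exact fun h => ⟨_, _, .setN .., h⟩

theorem runs_setR {A i j e σ Q} : Runs (.setR A i j e) σ Q ↔
    Q (σ.setReal A (i.eval σ) (j.eval σ) (e.eval σ)) (1 + i.time + j.time + e.time) := by
  constructor
  · rintro ⟨τ, t, he, hq⟩
    cases he
    exact hq
  · exact fun h => ⟨_, _, .setR .., h⟩

theorem runs_skip {σ Q} : Runs .skip σ Q ↔ Q σ 1 := by
  constructor
  · rintro ⟨τ, t, he, hq⟩
    cases he
    exact hq
  · exact fun h => ⟨_, _, .skip _, h⟩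

theorem runs_seq {p q σ Q} : Runs (.seq p q) σ Q ↔
    Runs p σ (fun σ' t => Runs q σ' (fun τ t' => Q τ (t + t'))) := by
  constructor
  · rintro ⟨τ, t, he, hq⟩
    cases he with
    | seq h1 h2 => exact ⟨_, _, h1, _, _, h2, hq⟩
  · rintro ⟨_, _, h1, _, _, h2, hq⟩
    exact ⟨_, _, .seq h1 h2, hq⟩

theorem runs_ite {b p q σ Q} : Runs (.ite b p q) σ Q ↔
    (b.holds σ → Runs p σ (fun τ t => Q τ (1 + b.time + t))) ∧
    (¬ b.holds σ → Runs q σ (fun τ t => Q τ (1 + b.time + t))) := by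
  constructor
  · rintro ⟨τ, t, he, hq⟩
    cases he with
    | iteTrue hb h => exact ⟨fun _ => ⟨_, _, h, hq⟩, fun h' => absurd hb h'⟩
    | iteFalse hb h => exact ⟨fun h' => absurd h' hb, fun _ => ⟨_, _, h, hq⟩⟩
  · rintro ⟨h1, h2⟩
    by_cases hb : b.holds σ
    · obtain ⟨_, _, h, hq⟩ := h1 hb
      exact ⟨_, _, .iteTrue hb h, hq⟩
    · obtain ⟨_, _, h, hq⟩ := h2 hb
      exact ⟨_, _, .iteFalse hb h, hq⟩

theorem runs_block_cons {p q l σ Q} : Runs (block (p :: q :: l)) σ Q ↔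
    Runs p σ (fun σ' t => Runs (block (q :: l)) σ' (fun τ t' => Q τ (t + t'))) := runs_seq

theorem runs_block_single {p σ Q} : Runs (block [p]) σ Q ↔ Runs p σ Q := Iff.rfl

/-- The rule for loops: the running time is paid for by a potential, which is an argument of the
invariant. -/
theorem Runs.loop {b : BExp} {p : Stmt} (I : ℕ → Store → Prop)
    (hstep : ∀ k σ, I k σ → b.holds σ →
      Runs p σ (fun τ t => ∃ k', I k' τ ∧ 1 + b.time + t + k' ≤ k))
    {k : ℕ} {σ : Store} (h : I k σ) :
    Runs (.loop b p) σ (fun τ t => ∃ k', I k' τ ∧ ¬ b.holds τ ∧ t + k' ≤ k + (1 + b.time)) := by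
  induction k using Nat.strong_induction_on generalizing σ with
  | _ k ih =>
    by_cases hb : b.holds σ
    · obtain ⟨τ, t, he, k', hI, hk⟩ := hstep k σ h hb
      obtain ⟨τ', t', he', k'', hI', hb', hk'⟩ := ih k' (by omega) hI
      exact ⟨τ', _, .loopTrue hb he he', k'', hI', hb', by omega⟩
    · exact ⟨σ, _, .loopFalse hb, k, h, hb, by omega⟩

/-- The natural number arrays that a program can change. -/
def Stmt.writesN : Stmt → NVar → Bool
  | .setN A _ _ _, B => A = B
  | .setR _ _ _ _, _ => false
  | .seq p q, B => p.writesN B || q.writesN B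
  | .ite _ p q, B => p.writesN B || q.writesN B
  | .skip, _ => false
  | .loop _ p, B => p.writesN B

/-- The real number arrays that a program can change. -/
def Stmt.writesR : Stmt → RVar → Bool
  | .setN _ _ _ _, _ => false
  | .setR A _ _ _, B => A = B
  | .seq p q, B => p.writesR B || q.writesR B
  | .ite _ p q, B => p.writesR B || q.writesR B
  | .skip, _ => false
  | .loop _ p, B => p.writesR B

theorem Exec.frame {p : Stmt} {σ τ : Store} {t : ℕ} (h : Exec p σ τ t) :
    (∀ B, p.writesN B = false → τ.nat B = σ.nat B) ∧
    (∀ B, p.writesR B = false → τ.real B = σ.real B) := by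
  induction h with
  | setN A i j e σ =>
    refine ⟨fun B hB => ?_, fun B _ => rfl⟩
    have : ¬ B = A := fun h => by simp [Stmt.writesN, h] at hB
    funext k l
    simp [Store.setNat, this]
  | setR A i j e σ =>
    refine ⟨fun B _ => rfl, fun B hB => ?_⟩
    have : ¬ B = A := fun h => by simp [Stmt.writesR, h] at hB
    funext k l
    simp [Store.setReal, this]
  | skip => exact ⟨fun _ _ => rfl, fun _ _ => rfl⟩
  | seq _ _ ih1 ih2 =>
    constructor
    · intro B hB
      simp only [Stmt.writesN, Bool.or_eq_false_iff] at hB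
      rw [ih2.1 B hB.2, ih1.1 B hB.1]
    · intro B hB
      simp only [Stmt.writesR, Bool.or_eq_false_iff] at hB
      rw [ih2.2 B hB.2, ih1.2 B hB.1]
  | iteTrue _ _ ih =>
    constructor
    · intro B hB
      simp only [Stmt.writesN, Bool.or_eq_false_iff] at hB
      exact ih.1 B hB.1
    · intro B hB
      simp only [Stmt.writesR, Bool.or_eq_false_iff] at hB
      exact ih.2 B hB.1
  | iteFalse _ _ ih =>
    constructor
    · intro B hB
      simp only [Stmt.writesN, Bool.or_eq_false_iff] at hB
      exact ih.1 B hB.2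
    · intro B hB
      simp only [Stmt.writesR, Bool.or_eq_false_iff] at hB
      exact ih.2 B hB.2
  | loopTrue _ _ _ ih1 ih2 =>
    exact ⟨fun B hB => by rw [ih2.1 B hB, ih1.1 B hB], fun B hB => by rw [ih2.2 B hB, ih1.2 B hB]⟩
  | loopFalse _ => exact ⟨fun _ _ => rfl, fun _ _ => rfl⟩

/-- The arrays that `p` does not write have the same contents in both memories. -/
def Frame (p : Stmt) (σ τ : Store) : Prop :=
  (∀ B, p.writesN B = false → τ.nat B = σ.nat B) ∧
  (∀ B, p.writesR B = false → τ.real B = σ.real B)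

theorem Runs.frame {p : Stmt} {σ : Store} {Q : Store → ℕ → Prop} (h : Runs p σ Q) :
    Runs p σ (fun τ t => Q τ t ∧ Frame p σ τ) := by
  obtain ⟨τ, t, he, hq⟩ := h
  exact ⟨τ, t, he, hq, he.frame⟩

theorem Runs.mono_frame {p : Stmt} {σ : Store} {Q Q' : Store → ℕ → Prop} (h : Runs p σ Q)
    (hQ : ∀ τ t, Q τ t → Frame p σ τ → Q' τ t) : Runs p σ Q' :=
  h.frame.mono fun τ t h => hQ τ t h.1 h.2

/-- The rule for counting loops whose bound `M` is not changed by the body. -/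
theorem Runs.forUpTo {A : NVar} {e : NExp} {p : Stmt} (M : ℕ) (I : ℕ → ℕ → Store → Prop)
    {k : ℕ} {σ : Store} (h0 : I 0 k (σ.setNat A 0 0 0))
    (hA : p.writesN A = false)
    (he : ∀ i k σ, I i k σ → e.eval σ = M)
    (hstep : ∀ i k σ, i < M → I i k σ → σ.nat A 0 0 = i →
      Runs p σ (fun τ t => ∃ k', I (i + 1) k' (τ.setNat A 0 0 (i + 1)) ∧
        t + k' + (13 + e.time) ≤ k)) :
    Runs (forUpTo A e p) σ (fun τ t => ∃ k', I M k' τ ∧ t + k' ≤ k + (20 + e.time)) := by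
  have key := Runs.loop (b := .ltN A.val e) (p := block [p, A.put (A.val + 1)])
    (fun k σ => ∃ i ≤ M, I i k σ ∧ σ.nat A 0 0 = i) (by
      rintro k σ ⟨i, hi, hI, hAi⟩ hb
      have hiM : i < M := by
        have := he _ _ _ hI
        simp only [BExp.holds, NExp.eval] at hb
        change σ.nat A 0 0 < _ at hb
        omega
      rw [runs_block_cons]
      refine (hstep i k σ hiM hI hAi).mono_frame ?_
      rintro τ t ⟨k', hI', hk⟩ hf
      have hAτ : τ.nat A 0 0 = i := by rw [hf.1 A hA, hAi]
      rw [runs_block_single, runs_setN]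
      refine ⟨k', ⟨i + 1, hiM, ?_, ?_⟩, ?_⟩
      · have : NExp.eval τ (A.val + 1) = i + 1 := by
          change τ.nat A 0 0 + 1 = _
          rw [hAτ]
        rw [this]
        exact hI'
      · change (if A = A ∧ 0 = 0 ∧ 0 = 0 then τ.nat A 0 0 + 1 else _) = _
        simp [hAτ]
      · change 1 + (1 + (1 + 1 + 1) + e.time) + (t + (1 + 1 + 1 + (1 + (1 + 1 + 1) + 1))) + k' ≤ k
        omega)
    (k := k) (σ := σ.setNat A 0 0 0) ⟨0, Nat.zero_le _, h0, by simp [Store.setNat]⟩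
  unfold KarpOrlin.forUpTo
  rw [runs_block_cons, runs_setN, runs_block_single]
  refine key.mono ?_
  rintro τ t ⟨k', ⟨i, hi, hI, hAi⟩, hb, hk⟩
  have : i = M := by
    have := he _ _ _ hI
    simp only [BExp.holds, NExp.eval] at hb
    change ¬ τ.nat A 0 0 < _ at hb
    omega
  subst this
  refine ⟨k', hI, ?_⟩
  change t + k' ≤ k + (1 + (1 + (1 + 1 + 1) + e.time)) at hk
  change 1 + 1 + 1 + 1 + t + k' ≤ _
  omega

namespace Store

variable (σ : Store)

@[simp] theorem nat_setNat (A B : NVar) (i j x k l : ℕ) : (σ.setNat A i j x).nat B k l =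
    if B = A ∧ k = i ∧ l = j then x else σ.nat B k l := rfl

@[simp] theorem real_setNat (A : NVar) (i j x : ℕ) : (σ.setNat A i j x).real = σ.real := rfl

@[simp] theorem nat_setReal (A : RVar) (i j : ℕ) (x : ℝ) : (σ.setReal A i j x).nat = σ.nat := rfl

@[simp] theorem real_setReal (A B : RVar) (i j : ℕ) (x : ℝ) (k l : ℕ) :
    (σ.setReal A i j x).real B k l =
    if B = A ∧ k = i ∧ l = j then x else σ.real B k l := rfl

end Store

@[simp] theorem NExp.eval_zero (σ : Store) : NExp.eval σ 0 = 0 := rfl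
@[simp] theorem NExp.eval_one (σ : Store) : NExp.eval σ 1 = 1 := rfl
@[simp] theorem NExp.eval_get (σ : Store) (A : NVar) (i j : NExp) :
    NExp.eval σ (.get A i j) = σ.nat A (i.eval σ) (j.eval σ) := rfl
@[simp] theorem NExp.eval_add (σ : Store) (a b : NExp) :
    NExp.eval σ (a + b) = a.eval σ + b.eval σ := rfl
@[simp] theorem NExp.eval_sub (σ : Store) (a b : NExp) :
    NExp.eval σ (a - b) = a.eval σ - b.eval σ := rfl
@[simp] theorem NExp.time_zero : NExp.time 0 = 1 := rfl
@[simp] theorem NExp.time_one : NExp.time 1 = 1 := rfl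
@[simp] theorem NExp.time_get (A : NVar) (i j : NExp) :
    NExp.time (.get A i j) = 1 + i.time + j.time := rfl
@[simp] theorem NExp.time_add (a b : NExp) : NExp.time (a + b) = 1 + a.time + b.time := rfl
@[simp] theorem NExp.time_sub (a b : NExp) : NExp.time (a - b) = 1 + a.time + b.time := rfl
@[simp] theorem RExp.eval_ofN (σ : Store) (a : NExp) :
    RExp.eval σ (.ofN a) = (a.eval σ : ℝ) := rfl
@[simp] theorem RExp.eval_get (σ : Store) (A : RVar) (i j : NExp) :
    RExp.eval σ (.get A i j) = σ.real A (i.eval σ) (j.eval σ) := rfl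
@[simp] theorem RExp.eval_add (σ : Store) (a b : RExp) :
    RExp.eval σ (a + b) = a.eval σ + b.eval σ := rfl
@[simp] theorem RExp.eval_sub (σ : Store) (a b : RExp) :
    RExp.eval σ (a - b) = a.eval σ - b.eval σ := rfl
@[simp] theorem RExp.eval_mul (σ : Store) (a b : RExp) :
    RExp.eval σ (a * b) = a.eval σ * b.eval σ := rfl
@[simp] theorem RExp.eval_div (σ : Store) (a b : RExp) :
    RExp.eval σ (a / b) = a.eval σ / b.eval σ := rfl
@[simp] theorem RExp.time_ofN (a : NExp) : RExp.time (.ofN a) = 1 + a.time := rfl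
@[simp] theorem RExp.time_get (A : RVar) (i j : NExp) :
    RExp.time (.get A i j) = 1 + i.time + j.time := rfl
@[simp] theorem RExp.time_add (a b : RExp) : RExp.time (a + b) = 1 + a.time + b.time := rfl
@[simp] theorem RExp.time_sub (a b : RExp) : RExp.time (a - b) = 1 + a.time + b.time := rfl
@[simp] theorem RExp.time_mul (a b : RExp) : RExp.time (a * b) = 1 + a.time + b.time := rfl
@[simp] theorem RExp.time_div (a b : RExp) : RExp.time (a / b) = 1 + a.time + b.time := rfl

attribute [simp] BExp.holds BExp.time runs_setN runs_setR runs_skip runs_seq runs_ite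
  runs_block_cons runs_block_single


/-! ## Fibonacci heaps: structure -/

/-- The link structure of the heap. -/
@[ext]
structure HeapData where
  hpar : ℕ → ℕ
  deg : ℕ → ℕ
  hpos : ℕ → ℕ
  mark : ℕ → ℕ
  child : ℕ → ℕ → ℕ

namespace HeapData

/-- Make `x` a child of `p`. -/
def attach (h : HeapData) (p x : ℕ) : HeapData where
  hpar := Function.update h.hpar x p
  deg := Function.update h.deg p (h.deg p + 1)
  hpos := Function.update h.hpos x (h.deg p)
  mark := h.mark
  child := Function.update h.child p (Function.update (h.child p) (h.deg p) x)

/-- Remove `x` from the children of its parent. -/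
def detach (h : HeapData) (x : ℕ) : HeapData where
  hpar := h.hpar
  deg := Function.update h.deg (h.hpar x) (h.deg (h.hpar x) - 1)
  hpos := Function.update h.hpos (h.child (h.hpar x) (h.deg (h.hpar x) - 1)) (h.hpos x)
  mark := h.mark
  child := Function.update h.child (h.hpar x) (Function.update (h.child (h.hpar x)) (h.hpos x)
    (h.child (h.hpar x) (h.deg (h.hpar x) - 1)))

/-- Set the mark of `x`. -/
def setMark (h : HeapData) (x k : ℕ) : HeapData := { h with mark := Function.update h.mark x k }

/-- The arrays of children represent the parent function on the set `K`. -/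
structure Links (h : HeapData) (K : Finset ℕ) : Prop where
  pos_lt : ∀ x ∈ K, h.hpos x < h.deg (h.hpar x)
  child_pos : ∀ x ∈ K, h.child (h.hpar x) (h.hpos x) = x
  mem : ∀ p i, i < h.deg p → h.child p i ∈ K
  par_child : ∀ p i, i < h.deg p → h.hpar (h.child p i) = p
  pos_child : ∀ p i, i < h.deg p → h.hpos (h.child p i) = i

variable {h : HeapData} {N : ℕ} {H K : Finset ℕ}

theorem Links.setMark (hl : Links h K) (x k : ℕ) : Links (h.setMark x k) K :=
  ⟨hl.pos_lt, hl.child_pos, hl.mem, hl.par_child, hl.pos_child⟩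

theorem Links.attach (hl : Links h K) {p x : ℕ} (hx : x ∉ K) :
    Links (h.attach p x) (insert x K) := by
  have hne : ∀ q i, i < h.deg q → h.child q i ≠ x := fun q i hi he => hx (he ▸ hl.mem q i hi)
  refine ⟨?_, ?_, ?_, ?_, ?_⟩
  · intro y hy
    by_cases hyx : y = x
    · subst hyx; simp [HeapData.attach]
    · have hyK : y ∈ K := by simpa [hyx] using hy
      have := hl.pos_lt y hyK
      simp only [HeapData.attach, Function.update_of_ne hyx, Function.update_apply]
      split_ifs with h1
      · rw [h1] at this; omega
      · exact this
  · intro y hy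
    by_cases hyx : y = x
    · subst hyx; simp [HeapData.attach]
    · have hyK : y ∈ K := by simpa [hyx] using hy
      have := hl.pos_lt y hyK
      have h2 := hl.child_pos y hyK
      simp only [HeapData.attach, Function.update_of_ne hyx]
      by_cases h1 : h.hpar y = p
      · rw [h1] at this h2 ⊢
        rw [Function.update_self, Function.update_of_ne (by omega), h2]
      · rw [Function.update_of_ne h1, h2]
  · intro q i hi
    by_cases h1 : q = p
    · subst h1
      simp only [HeapData.attach, Function.update_self] at hi ⊢
      by_cases h2 : i = h.deg q
      · simp [h2]
      · rw [Function.update_of_ne h2]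
        exact Finset.mem_insert_of_mem (hl.mem _ _ (by omega))
    · simp only [HeapData.attach, Function.update_of_ne h1] at hi ⊢
      exact Finset.mem_insert_of_mem (hl.mem _ _ hi)
  · intro q i hi
    by_cases h1 : q = p
    · subst h1
      simp only [HeapData.attach, Function.update_self] at hi ⊢
      by_cases h2 : i = h.deg q
      · simp [h2]
      · rw [Function.update_of_ne h2, Function.update_of_ne (hne _ _ (by omega))]
        exact hl.par_child _ _ (by omega)
    · simp only [HeapData.attach, Function.update_of_ne h1] at hi ⊢
      rw [Function.update_of_ne (hne _ _ hi)]
      exact hl.par_child _ _ hi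
  · intro q i hi
    by_cases h1 : q = p
    · subst h1
      simp only [HeapData.attach, Function.update_self] at hi ⊢
      by_cases h2 : i = h.deg q
      · simp [h2]
      · rw [Function.update_of_ne h2, Function.update_of_ne (hne _ _ (by omega))]
        exact hl.pos_child _ _ (by omega)
    · simp only [HeapData.attach, Function.update_of_ne h1] at hi ⊢
      rw [Function.update_of_ne (hne _ _ hi)]
      exact hl.pos_child _ _ hi

theorem Links.detach (hl : Links h K) {x : ℕ} (hx : x ∈ K) :
    Links (h.detach x) (K.erase x) := by
  set q := h.hpar x with hq
  set l := h.child q (h.deg q - 1) with hl'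
  have hpos : h.hpos x < h.deg q := hl.pos_lt x hx
  have hcx : h.child q (h.hpos x) = x := hl.child_pos x hx
  have hlpar : h.hpar l = q := hl.par_child _ _ (by omega)
  have hlpos : h.hpos l = h.deg q - 1 := hl.pos_child _ _ (by omega)
  have hd : h.detach x = ⟨h.hpar, Function.update h.deg q (h.deg q - 1),
    Function.update h.hpos l (h.hpos x), h.mark,
    Function.update h.child q (Function.update (h.child q) (h.hpos x) l)⟩ := rfl
  rw [hd]
  have hcne : ∀ i, i < h.deg q → i ≠ h.hpos x → h.child q i ≠ x := by
    intro i hi hne he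
    exact hne (by rw [← hl.pos_child q i hi, he])
  have hlne : ∀ i, i < h.deg q - 1 → h.child q i ≠ l := by
    intro i hi he
    have := hl.pos_child q i (by omega)
    rw [he, hlpos] at this
    omega
  have hone : ∀ p i, i < h.deg p → p ≠ q → h.child p i ≠ x ∧ h.child p i ≠ l := by
    intro p i hi hp
    have := hl.par_child p i hi
    exact ⟨fun he => hp (by rw [← this, he]), fun he => hp (by rw [← this, he, hlpar])⟩
  have hlx : h.hpos x < h.deg q - 1 → l ≠ x := fun h1 h2 => by
    rw [h2] at hlpos; omega
  refine ⟨?_, ?_, ?_, ?_, ?_⟩ <;> try dsimp only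
  · intro y hy
    obtain ⟨hyx, hyK⟩ := Finset.mem_erase.1 hy
    have h1 := hl.pos_lt y hyK
    by_cases hyl : y = l
    · rw [hyl, Function.update_self, hlpar, Function.update_self]
      have : h.hpos x ≠ h.deg q - 1 := fun h2 => hyx (by rw [hyl, hl', ← h2, hcx])
      omega
    · rw [Function.update_of_ne hyl]
      by_cases h2 : h.hpar y = q
      · rw [h2, Function.update_self]
        rw [h2] at h1
        have : h.hpos y ≠ h.deg q - 1 := fun h3 => hyl (by
          rw [hl', ← h3, ← h2, hl.child_pos y hyK])
        omega
      · rwa [Function.update_of_ne h2]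
  · intro y hy
    obtain ⟨hyx, hyK⟩ := Finset.mem_erase.1 hy
    have h1 := hl.child_pos y hyK
    by_cases hyl : y = l
    · rw [hyl, Function.update_self, hlpar, Function.update_self, Function.update_self]
    · rw [Function.update_of_ne hyl]
      by_cases h2 : h.hpar y = q
      · rw [h2] at h1
        rw [h2, Function.update_self, Function.update_of_ne, h1]
        intro h3
        rw [h3, hcx] at h1
        exact hyx h1.symm
      · rwa [Function.update_of_ne h2]
  · intro p i hi
    by_cases hp : p = q
    · rw [hp, Function.update_self] at hi ⊢
      by_cases hix : i = h.hpos x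
      · rw [hix, Function.update_self]
        exact Finset.mem_erase.2 ⟨hlx (by omega), hl.mem _ _ (by omega)⟩
      · rw [Function.update_of_ne hix]
        exact Finset.mem_erase.2 ⟨hcne i (by omega) hix, hl.mem _ _ (by omega)⟩
    · rw [Function.update_of_ne hp] at hi ⊢
      exact Finset.mem_erase.2 ⟨(hone p i hi hp).1, hl.mem _ _ hi⟩
  · intro p i hi
    by_cases hp : p = q
    · rw [hp, Function.update_self] at hi ⊢
      by_cases hix : i = h.hpos x
      · rw [hix, Function.update_self, hlpar]
      · rw [Function.update_of_ne hix]
        exact hl.par_child _ _ (by omega)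
    · rw [Function.update_of_ne hp] at hi ⊢
      exact hl.par_child _ _ hi
  · intro p i hi
    by_cases hp : p = q
    · rw [hp, Function.update_self] at hi ⊢
      by_cases hix : i = h.hpos x
      · rw [hix, Function.update_self, Function.update_self]
      · rw [Function.update_of_ne hix, Function.update_of_ne (hlne i hi)]
        exact hl.pos_child _ _ (by omega)
    · rw [Function.update_of_ne hp] at hi ⊢
      rw [Function.update_of_ne (hone p i hi hp).2]
      exact hl.pos_child _ _ hi

theorem Links.card (hl : Links h K) (p : ℕ) : (K.filter (fun y => h.hpar y = p)).card = h.deg p := by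
  conv_rhs => rw [← Finset.card_range (h.deg p)]
  symm
  refine Finset.card_bij (fun i _ => h.child p i) ?_ ?_ ?_
  · intro i hi
    have hi := Finset.mem_range.1 hi
    exact Finset.mem_filter.2 ⟨hl.mem p i hi, hl.par_child p i hi⟩
  · intro i hi j hj hij
    rw [← hl.pos_child p i (Finset.mem_range.1 hi), hij, hl.pos_child p j (Finset.mem_range.1 hj)]
  · intro y hy
    obtain ⟨hyK, rfl⟩ := Finset.mem_filter.1 hy
    exact ⟨h.hpos y, Finset.mem_range.2 (hl.pos_lt y hyK), hl.child_pos y hyK⟩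

/-- The forest of the heap with nodes `H` and artificial root `N`. The nodes in `H \ K` are roots
that are not stored among the children of `N`. The children of a node can be numbered such that the
`i`-th one has lost at most one child since it had `i` children; here a child that has not yet been
accounted for in the mark of `y` is counted by `b y`. -/
structure Forest (N : ℕ) (H K : Finset ℕ) (h : HeapData) (b : ℕ → ℕ) : Prop where
  lt : ∀ x ∈ H, x < N
  sub : K ⊆ H
  par_top : h.hpar N = N
  par : ∀ x ∈ H, h.hpar x = N ∨ (h.hpar x ∈ H ∧ x ∈ K)
  rank : ∀ p ∈ H, ∀ j,
    (K.filter (fun y => h.hpar y = p ∧ h.deg y + h.mark y + b y < j)).card ≤ j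
  height : ∃ g : ℕ → ℕ, ∀ x ∈ H, h.hpar x ≠ N → g x < g (h.hpar x)
  mark_le : ∀ x, h.mark x ≤ 1
  mark_root : ∀ x ∈ H, h.hpar x = N → h.mark x = 0
  outside : ∀ x, x ∉ H → x ≠ N → h.deg x = 0 ∧ h.mark x = 0

variable {b b' : ℕ → ℕ}

theorem Forest.par_ne (hf : Forest N H K h b) {x : ℕ} (hx : x ∈ H) : h.hpar x ≠ x := by
  intro he
  obtain ⟨g, hg⟩ := hf.height
  have h1 : h.hpar x ≠ N := by rw [he]; exact (hf.lt x hx).ne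
  have := hg x hx h1
  rw [he] at this
  exact lt_irrefl _ this

theorem Forest.mono (hf : Forest N H K h b)
    (hb : ∀ y ∈ H, h.hpar y ≠ N → b y ≤ b' y) : Forest N H K h b' := by
  refine ⟨hf.lt, hf.sub, hf.par_top, hf.par, ?_, hf.height, hf.mark_le, hf.mark_root, hf.outside⟩
  intro p hp j
  refine le_trans (Finset.card_le_card ?_) (hf.rank p hp j)
  intro y hy
  obtain ⟨hyK, hyp, hyj⟩ := Finset.mem_filter.1 hy
  have := hb y (hf.sub hyK) (by rw [hyp]; exact (hf.lt p hp).ne)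
  exact Finset.mem_filter.2 ⟨hyK, hyp, by omega⟩

theorem Forest.attachRoot (hf : Forest N H K h b) {x : ℕ} (hxN : x < N) (hxK : x ∉ K) :
    Forest N (insert x H) (insert x K) (h.attach N x) b := by
  have hroot : x ∈ H → h.hpar x = N := fun hx => by
    rcases hf.par x hx with h1 | h1
    · exact h1
    · exact absurd h1.2 hxK
  refine ⟨?_, Finset.insert_subset_insert _ hf.sub, ?_, ?_, ?_, ?_, hf.mark_le, ?_, ?_⟩
  · intro y hy
    rcases Finset.mem_insert.1 hy with rfl | hy
    · exact hxN
    · exact hf.lt y hy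
  · simp only [HeapData.attach]
    rw [Function.update_of_ne hxN.ne', hf.par_top]
  · intro y hy
    by_cases hyx : y = x
    · left; simp [HeapData.attach, hyx]
    · have hyH : y ∈ H := by simpa [hyx] using hy
      simp only [HeapData.attach, Function.update_of_ne hyx]
      rcases hf.par y hyH with h1 | h1
      · exact .inl h1
      · exact .inr ⟨Finset.mem_insert_of_mem h1.1, Finset.mem_insert_of_mem h1.2⟩
  · intro p hp j
    have hpN : p ≠ N := by
      rcases Finset.mem_insert.1 hp with rfl | hp
      · exact hxN.ne
      · exact (hf.lt p hp).ne
    have hsub : ((insert x K).filter (fun y => (h.attach N x).hpar y = p ∧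
        (h.attach N x).deg y + (h.attach N x).mark y + b y < j)) ⊆
        K.filter (fun y => h.hpar y = p ∧ h.deg y + h.mark y + b y < j) := by
      intro y hy
      obtain ⟨hyK, hyp, hyj⟩ := Finset.mem_filter.1 hy
      simp only [HeapData.attach] at hyp hyj
      have hyx : y ≠ x := by
        rintro rfl
        rw [Function.update_self] at hyp
        exact hpN hyp.symm
      have hyK : y ∈ K := by simpa [hyx] using hyK
      rw [Function.update_of_ne hyx] at hyp
      rw [Function.update_of_ne (hf.lt y (hf.sub hyK)).ne] at hyj
      exact Finset.mem_filter.2 ⟨hyK, hyp, hyj⟩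
    refine le_trans (Finset.card_le_card hsub) ?_
    by_cases hpH : p ∈ H
    · exact hf.rank p hpH j
    · rw [Finset.card_eq_zero.2, ]
      · exact Nat.zero_le _
      · rw [Finset.filter_eq_empty_iff]
        rintro y hy ⟨h1, -⟩
        rcases hf.par y (hf.sub hy) with h2 | h2
        · exact hpN (h1.symm.trans h2)
        · exact hpH (h1 ▸ h2.1)
  · obtain ⟨g, hg⟩ := hf.height
    refine ⟨g, fun y hy hyN => ?_⟩
    simp only [HeapData.attach] at hyN ⊢
    have hyx : y ≠ x := by
      rintro rfl
      simp at hyN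
    have hyH : y ∈ H := by simpa [hyx] using hy
    rw [Function.update_of_ne hyx] at hyN ⊢
    exact hg y hyH hyN
  · intro y hy hyN
    simp only [HeapData.attach] at hyN ⊢
    by_cases hyx : y = x
    · rw [hyx]
      by_cases hxH : x ∈ H
      · exact hf.mark_root x hxH (hroot hxH)
      · exact (hf.outside x hxH hxN.ne).2
    · have hyH : y ∈ H := by simpa [hyx] using hy
      rw [Function.update_of_ne hyx] at hyN
      exact hf.mark_root y hyH hyN
  · intro y hy hyN
    simp only [HeapData.attach]
    rw [Function.update_of_ne hyN]
    exact hf.outside y (fun h1 => hy (Finset.mem_insert_of_mem h1)) hyN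

theorem Forest.detachRoot (hf : Forest N H K h b) {x : ℕ} (hx : h.hpar x = N) :
    Forest N H (K.erase x) (h.detach x) b := by
  refine ⟨hf.lt, (Finset.erase_subset _ _).trans hf.sub, hf.par_top, ?_, ?_, hf.height,
    hf.mark_le, hf.mark_root, ?_⟩
  · intro y hy
    rcases hf.par y hy with h1 | h1
    · exact .inl h1
    · by_cases hyx : y = x
      · left; rw [hyx]; exact hx
      · exact .inr ⟨h1.1, Finset.mem_erase.2 ⟨hyx, h1.2⟩⟩
  · intro p hp j
    refine le_trans (Finset.card_le_card ?_) (hf.rank p hp j)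
    intro y hy
    obtain ⟨hyK, hyp, hyj⟩ := Finset.mem_filter.1 hy
    have hyK := Finset.mem_of_mem_erase hyK
    simp only [HeapData.detach] at hyp hyj
    rw [hx, Function.update_of_ne (hf.lt y (hf.sub hyK)).ne] at hyj
    exact Finset.mem_filter.2 ⟨hyK, hyp, hyj⟩
  · intro y hy hyN
    simp only [HeapData.detach]
    rw [hx, Function.update_of_ne hyN]
    exact hf.outside y hy hyN

theorem Forest.link (hf : Forest N H K h 0) (hl : Links h K) {x y : ℕ} (hx : x ∈ H) (hy : y ∈ H)
    (hxy : x ≠ y) (hxK : x ∉ K) (hyK : y ∉ K) (hd : h.deg x = h.deg y) :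
    Forest N H (insert y K) (h.attach x y) 0 := by
  have hroot : ∀ z ∈ H, z ∉ K → h.hpar z = N := fun z hz hzK => by
    rcases hf.par z hz with h1 | h1
    · exact h1
    · exact absurd h1.2 hzK
  have hxN := hroot x hx hxK
  have hyN := hroot y hy hyK
  refine ⟨hf.lt, Finset.insert_subset hy hf.sub, ?_, ?_, ?_, ?_, hf.mark_le, ?_, ?_⟩
  · simp only [HeapData.attach]
    rw [Function.update_of_ne (hf.lt y hy).ne', hf.par_top]
  · intro z hz
    simp only [HeapData.attach]
    by_cases hzy : z = y
    · right
      rw [hzy, Function.update_self]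
      exact ⟨hx, Finset.mem_insert_self _ _⟩
    · rw [Function.update_of_ne hzy]
      rcases hf.par z hz with h1 | h1
      · exact .inl h1
      · exact .inr ⟨h1.1, Finset.mem_insert_of_mem h1.2⟩
  · intro p hp j
    by_cases hbig : p = x ∧ h.deg x < j
    · obtain ⟨rfl, hj⟩ := hbig
      have hsub : ((insert y K).filter (fun z => (h.attach p y).hpar z = p ∧
          (h.attach p y).deg z + (h.attach p y).mark z + (0 : ℕ → ℕ) z < j)) ⊆
          insert y (K.filter (fun z => h.hpar z = p)) := by
        intro z hz
        obtain ⟨hzK, hzp, -⟩ := Finset.mem_filter.1 hz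
        simp only [HeapData.attach] at hzp
        by_cases hzy : z = y
        · simp [hzy]
        · rw [Function.update_of_ne hzy] at hzp
          have hzK : z ∈ K := by simpa [hzy] using hzK
          exact Finset.mem_insert_of_mem (Finset.mem_filter.2 ⟨hzK, hzp⟩)
      have h1 := Finset.card_le_card hsub
      have h2 := Finset.card_insert_le y (K.filter (fun z => h.hpar z = p))
      rw [hl.card] at h2
      omega
    · refine le_trans (Finset.card_le_card ?_) (hf.rank p hp j)
      intro z hz
      obtain ⟨hzK, hzp, hzj⟩ := Finset.mem_filter.1 hz
      simp only [HeapData.attach] at hzp hzj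
      have hzy : z ≠ y := by
        rintro rfl
        rw [Function.update_self] at hzp
        rw [Function.update_of_ne hxy.symm] at hzj
        exact hbig ⟨hzp.symm, by omega⟩
      have hzK : z ∈ K := by simpa [hzy] using hzK
      have hzx : z ≠ x := fun h1 => hxK (h1 ▸ hzK)
      rw [Function.update_of_ne hzy] at hzp
      rw [Function.update_of_ne hzx] at hzj
      exact Finset.mem_filter.2 ⟨hzK, hzp, hzj⟩
  · obtain ⟨g, hg⟩ := hf.height
    refine ⟨Function.update g x (max (g x) (g y + 1)), fun z hz hzN => ?_⟩
    simp only [HeapData.attach] at hzN ⊢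
    by_cases hzy : z = y
    · rw [hzy, Function.update_self, Function.update_self, Function.update_of_ne hxy.symm]
      omega
    · rw [Function.update_of_ne hzy] at hzN ⊢
      have hzx : z ≠ x := fun h1 => hzN (h1 ▸ hxN)
      have := hg z hz hzN
      rw [Function.update_of_ne hzx, Function.update_apply]
      split_ifs with h1
      · rw [h1] at this; omega
      · exact this
  · intro z hz hzN
    simp only [HeapData.attach] at hzN ⊢
    have hzy : z ≠ y := by
      rintro rfl
      rw [Function.update_self] at hzN
      exact (hf.lt x hx).ne hzN
    rw [Function.update_of_ne hzy] at hzN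
    exact hf.mark_root z hz hzN
  · intro z hz hzN
    simp only [HeapData.attach]
    have hzx : z ≠ x := fun h1 => hz (h1 ▸ hx)
    rw [Function.update_of_ne hzx]
    exact hf.outside z hz hzN

/-- Make `x` a root. -/
def toRoot (h : HeapData) (N x : ℕ) : HeapData := ((h.detach x).setMark x 0).attach N x

theorem Links.toRoot (hl : Links h K) {x : ℕ} (hx : x ∈ K) : Links (h.toRoot N x) K := by
  have := ((hl.detach hx).setMark x 0).attach (p := N) (Finset.notMem_erase x K)
  rwa [Finset.insert_erase hx] at this

theorem toRoot_deg_top (h : HeapData) {x : ℕ} (hx : h.hpar x ≠ N) :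
    (h.toRoot N x).deg N = h.deg N + 1 := by
  simp [HeapData.toRoot, HeapData.attach, HeapData.setMark, HeapData.detach,
    Function.update_of_ne hx.symm]

theorem toRoot_hpar (h : HeapData) (x : ℕ) :
    (h.toRoot N x).hpar = Function.update h.hpar x N := rfl

theorem toRoot_mark (h : HeapData) (x : ℕ) :
    (h.toRoot N x).mark = Function.update h.mark x 0 := rfl

theorem toRoot_deg_of_ne (h : HeapData) {x y : ℕ} (hy : y ≠ N) :
    (h.toRoot N x).deg y = if y = h.hpar x then h.deg y - 1 else h.deg y := by
  simp only [HeapData.toRoot, HeapData.attach, HeapData.setMark, HeapData.detach]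
  rw [Function.update_of_ne hy, Function.update_apply]
  split_ifs with h1
  · rw [h1]
  · rfl

theorem Forest.toRoot (hf : Forest N H K h b) (hl : Links h K) {x : ℕ} (hxK : x ∈ K)
    (hxN : h.hpar x ≠ N) (hb : ∀ y, y ≠ x → y ≠ h.hpar x → b y ≤ b' y)
    (hq : b (h.hpar x) + 1 ≤ b' (h.hpar x) ∨ h.hpar (h.hpar x) = N) :
    Forest N H K (h.toRoot N x) b' := by
  have hxH := hf.sub hxK
  have hqH : h.hpar x ∈ H := by
    rcases hf.par x hxH with h1 | h1
    · exact absurd h1 hxN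
    · exact h1.1
  have hdeg : 0 < h.deg (h.hpar x) := (Nat.zero_le _).trans_lt (hl.pos_lt x hxK)
  refine ⟨hf.lt, hf.sub, ?_, ?_, ?_, ?_, ?_, ?_, ?_⟩
  · rw [toRoot_hpar, Function.update_of_ne (hf.lt x hxH).ne', hf.par_top]
  · intro y hy
    rw [toRoot_hpar]
    by_cases hyx : y = x
    · left; rw [hyx, Function.update_self]
    · rw [Function.update_of_ne hyx]
      exact hf.par y hy
  · intro p hp j
    have hpN := (hf.lt p hp).ne
    refine le_trans (Finset.card_le_card ?_) (hf.rank p hp j)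
    intro y hy
    obtain ⟨hyK, hyp, hyj⟩ := Finset.mem_filter.1 hy
    rw [toRoot_hpar] at hyp
    have hyx : y ≠ x := by
      rintro rfl
      rw [Function.update_self] at hyp
      exact hpN hyp.symm
    rw [Function.update_of_ne hyx] at hyp
    rw [toRoot_mark, Function.update_of_ne hyx,
      toRoot_deg_of_ne h (hf.lt y (hf.sub hyK)).ne] at hyj
    refine Finset.mem_filter.2 ⟨hyK, hyp, ?_⟩
    by_cases hyq : y = h.hpar x
    · rw [if_pos hyq] at hyj
      have h3 : b y + 1 ≤ b' y := by
        rcases hq with h1 | h1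
        · rw [hyq]; exact h1
        · rw [← hyq, hyp] at h1
          exact absurd h1 hpN
      rw [← hyq] at hdeg
      omega
    · rw [if_neg hyq] at hyj
      have := hb y hyx hyq
      omega
  · obtain ⟨g, hg⟩ := hf.height
    refine ⟨g, fun y hy hyN => ?_⟩
    rw [toRoot_hpar] at hyN ⊢
    have hyx : y ≠ x := by
      rintro rfl
      simp at hyN
    rw [Function.update_of_ne hyx] at hyN ⊢
    exact hg y hy hyN
  · intro y
    rw [toRoot_mark, Function.update_apply]
    split_ifs
    · exact Nat.zero_le _
    · exact hf.mark_le y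
  · intro y hy hyN
    rw [toRoot_mark, Function.update_apply]
    split_ifs with h1
    · rfl
    · rw [toRoot_hpar, Function.update_of_ne h1] at hyN
      exact hf.mark_root y hy hyN
  · intro y hy hyN
    have hyx : y ≠ x := fun h1 => hy (h1 ▸ hxH)
    have hyq : y ≠ h.hpar x := fun h1 => hy (h1 ▸ hqH)
    rw [toRoot_mark, Function.update_of_ne hyx, toRoot_deg_of_ne h hyN, if_neg hyq]
    exact hf.outside y hy hyN

theorem Forest.setMark (hf : Forest N H K h b) {x : ℕ} (hx : x ∈ H) (hxN : h.hpar x ≠ N)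
    (hb : ∀ y, y ≠ x → b y ≤ b' y) (hbx : h.mark x + b x ≤ 1 + b' x) :
    Forest N H K (h.setMark x 1) b' := by
  refine ⟨hf.lt, hf.sub, hf.par_top, hf.par, ?_, hf.height, ?_, ?_, ?_⟩
  · intro p hp j
    refine le_trans (Finset.card_le_card ?_) (hf.rank p hp j)
    intro y hy
    obtain ⟨hyK, hyp, hyj⟩ := Finset.mem_filter.1 hy
    simp only [HeapData.setMark] at hyp hyj
    refine Finset.mem_filter.2 ⟨hyK, hyp, ?_⟩
    by_cases hyx : y = x
    · rw [hyx, Function.update_self] at hyj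
      rw [hyx]
      omega
    · rw [Function.update_of_ne hyx] at hyj
      have := hb y hyx
      omega
  · intro y
    simp only [HeapData.setMark, Function.update_apply]
    split_ifs
    · exact le_rfl
    · exact hf.mark_le y
  · intro y hy hyN
    simp only [HeapData.setMark] at hyN ⊢
    have hyx : y ≠ x := fun h1 => hxN (h1 ▸ hyN)
    rw [Function.update_of_ne hyx]
    exact hf.mark_root y hy hyN
  · intro y hy hyN
    simp only [HeapData.setMark]
    have hyx : y ≠ x := fun h1 => hy (h1 ▸ hx)
    rw [Function.update_of_ne hyx]
    exact hf.outside y hy hyN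

theorem Forest.erase (hf : Forest N H (H.erase x) h b) (hl : Links h (H.erase x))
    (hx : x ∈ H) (hd : h.deg x = 0) : Forest N (H.erase x) (H.erase x) h b := by
  have hroot : h.hpar x = N := by
    rcases hf.par x hx with h1 | h1
    · exact h1
    · exact absurd h1.2 (Finset.notMem_erase _ _)
  have hsub := Finset.erase_subset x H
  refine ⟨fun y hy => hf.lt y (hsub hy), subset_rfl, hf.par_top, ?_,
    fun p hp => hf.rank p (hsub hp), ?_, hf.mark_le, fun y hy => hf.mark_root y (hsub hy), ?_⟩
  · intro y hy
    rcases hf.par y (hsub hy) with h1 | h1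
    · exact .inl h1
    · refine .inr ⟨Finset.mem_erase.2 ⟨fun h2 => ?_, h1.1⟩, hy⟩
      have := hl.pos_lt y hy
      rw [h2, hd] at this
      exact absurd this (Nat.not_lt_zero _)
  · obtain ⟨g, hg⟩ := hf.height
    exact ⟨g, fun y hy => hg y (hsub hy)⟩
  · intro y hy hyN
    by_cases hyx : y = x
    · rw [hyx]
      exact ⟨hd, hf.mark_root x hx hroot⟩
    · exact hf.outside y (fun h1 => hy (Finset.mem_erase.2 ⟨hyx, h1⟩)) hyN

/-! ### The number of children -/

theorem sum_range_le_sum_of_card_le {α : Type*} [DecidableEq α] (g : ℕ → ℕ) (hg : Monotone g)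
    (r : α → ℕ) (S : Finset α) (hS : ∀ j, (S.filter (fun y => r y < j)).card ≤ j) :
    ∑ i ∈ Finset.range S.card, g i ≤ ∑ y ∈ S, g (r y) := by
  induction hd : S.card generalizing S with
  | zero => simp
  | succ d ih =>
    obtain ⟨y, hy, hry⟩ : ∃ y ∈ S, d ≤ r y := by
      by_contra! hcon
      have := hS d
      rw [Finset.filter_true_of_mem hcon] at this
      omega
    have h1 := ih (S.erase y) (fun j => le_trans (Finset.card_le_card
      (Finset.filter_subset_filter _ (Finset.erase_subset _ _))) (hS j))
      (by rw [Finset.card_erase_of_mem hy, hd]; rfl)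
    rw [Finset.sum_range_succ, ← Finset.sum_erase_add _ _ hy]
    exact Nat.add_le_add h1 (hg hry)

/-- The nodes of the subtree with root `x`. -/
noncomputable def subtree (h : HeapData) (H : Finset ℕ) (x : ℕ) : Finset ℕ := by
  classical exact H.filter (fun y => ∃ k, h.hpar^[k] y = x)

theorem Forest.fib_le_card_subtree (hf : Forest N H K h 0) (hl : Links h K) {x : ℕ} (hx : x ∈ H) :
    Nat.fib (h.deg x + 2) ≤ (h.subtree H x).card := by
  classical
  obtain ⟨g, hg⟩ := hf.height
  have htop : ∀ k, h.hpar^[k] N = N := fun k => Function.iterate_fixed hf.par_top k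
  have hiter : ∀ k, ∀ y ∈ H, h.hpar^[k] y ∈ H → g y ≤ g (h.hpar^[k] y) := by
    intro k
    induction k with
    | zero => intro y _ _; exact le_rfl
    | succ k ih =>
      intro y hy hk
      rw [Function.iterate_succ_apply] at hk ⊢
      rcases hf.par y hy with h1 | h1
      · rw [h1, htop] at hk
        exact absurd (hf.lt N hk) (lt_irrefl _)
      · exact (hg y hy (hf.lt _ h1.1).ne).le.trans (ih _ h1.1 hk)
  induction hgx : g x using Nat.strong_induction_on generalizing x with
  | _ gx ih =>
    have hxN := (hf.lt x hx).ne
    set S := K.filter (fun y => h.hpar y = x) with hSdef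
    have hSH : ∀ y ∈ S, y ∈ H ∧ h.hpar y = x ∧ g y < g x := by
      intro y hy
      obtain ⟨hyK, hyx⟩ := Finset.mem_filter.1 hy
      have := hg y (hf.sub hyK) (by rw [hyx]; exact hxN)
      rw [hyx] at this
      exact ⟨hf.sub hyK, hyx, this⟩
    have hdisj : ∀ y ∈ S, ∀ z ∈ S, ∀ w ∈ H, ∀ k l, k ≤ l → h.hpar^[k] w = y →
        h.hpar^[l] w = z → y = z := by
      intro y hy z hz w hw k l hkl hk hlz
      obtain ⟨d, rfl⟩ := Nat.exists_eq_add_of_le hkl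
      rw [Nat.add_comm, Function.iterate_add_apply, hk] at hlz
      cases d with
      | zero => exact hlz
      | succ d =>
        exfalso
        rw [Function.iterate_succ_apply, (hSH y hy).2.1] at hlz
        have h1 := hiter d x hx (by rw [hlz]; exact (hSH z hz).1)
        rw [hlz] at h1
        have := (hSH z hz).2.2
        omega
    have hpd : (S : Set ℕ).PairwiseDisjoint (fun y => h.subtree H y) := by
      intro y hy z hz hyz
      rw [Function.onFun, Finset.disjoint_left]
      intro w hw hw'
      simp only [subtree, Finset.mem_filter] at hw hw'
      obtain ⟨hwH, k, hk⟩ := hw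
      obtain ⟨-, l, hlz⟩ := hw'
      rcases le_total k l with h1 | h1
      · exact hyz (hdisj y hy z hz w hwH k l h1 hk hlz)
      · exact hyz (hdisj z hz y hy w hwH l k h1 hlz hk).symm
    have hsub : insert x (S.biUnion (fun y => h.subtree H y)) ⊆ h.subtree H x := by
      intro w hw
      simp only [subtree, Finset.mem_filter]
      rcases Finset.mem_insert.1 hw with rfl | hw
      · exact ⟨hx, 0, rfl⟩
      · obtain ⟨y, hy, hwy⟩ := Finset.mem_biUnion.1 hw
        simp only [subtree, Finset.mem_filter] at hwy
        obtain ⟨hwH, k, hk⟩ := hwy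
        exact ⟨hwH, k + 1, by rw [Function.iterate_succ_apply', hk, (hSH y hy).2.1]⟩
    have hnot : x ∉ S.biUnion (fun y => h.subtree H y) := by
      intro hw
      obtain ⟨y, hy, hwy⟩ := Finset.mem_biUnion.1 hw
      simp only [subtree, Finset.mem_filter] at hwy
      obtain ⟨-, k, hk⟩ := hwy
      have := hiter k x hx (by rw [hk]; exact (hSH y hy).1)
      rw [hk] at this
      have := (hSH y hy).2.2
      omega
    have hcard := Finset.card_le_card hsub
    rw [Finset.card_insert_of_notMem hnot, Finset.card_biUnion hpd] at hcard
    have hsum : ∑ i ∈ Finset.range S.card, Nat.fib i.succ ≤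
        ∑ y ∈ S, Nat.fib (h.deg y + h.mark y).succ := by
      refine sum_range_le_sum_of_card_le (fun i => Nat.fib i.succ)
        (fun a b hab => Nat.fib_mono (Nat.succ_le_succ hab)) (fun y => h.deg y + h.mark y) S ?_
      intro j
      have := hf.rank x hx j
      rw [hSdef, Finset.filter_filter]
      simpa using this
    have hle : ∑ y ∈ S, Nat.fib (h.deg y + h.mark y).succ ≤ ∑ y ∈ S, (h.subtree H y).card := by
      refine Finset.sum_le_sum fun y hy => ?_
      refine le_trans (Nat.fib_mono ?_) (ih (g y) (by rw [← hgx]; exact (hSH y hy).2.2)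
        (hSH y hy).1 rfl)
      have := hf.mark_le y
      omega
    have hS : S.card = h.deg x := hl.card x
    have hfib := Nat.fib_succ_eq_succ_sum (h.deg x + 1)
    rw [Finset.sum_range_succ'] at hfib
    simp only [Nat.fib_zero, add_zero] at hfib
    rw [hS] at hsum
    simp only [Nat.succ_eq_add_one] at hsum hle
    have hfib : Nat.fib (h.deg x + 2) =
        ∑ k ∈ Finset.range (h.deg x), Nat.fib (k + 1) + 1 := hfib
    omega

theorem two_pow_le_fib (k : ℕ) : 2 ^ k ≤ Nat.fib (2 * k + 1 + 1) := by
  induction k with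
  | zero => simp
  | succ k ih =>
    have h1 : Nat.fib (2 * (k + 1) + 1 + 1) =
      Nat.fib (2 * k + 2) + Nat.fib (2 * k + 2 + 1) := by
      rw [← Nat.fib_add_two]
      rfl
    have h2 : Nat.fib (2 * k + 2) ≤ Nat.fib (2 * k + 2 + 1) := Nat.fib_le_fib_succ
    rw [h1, pow_succ]
    have : Nat.fib (2 * k + 1 + 1) = Nat.fib (2 * k + 2) := rfl
    omega

theorem Forest.deg_le (hf : Forest N H K h 0) (hl : Links h K) {x : ℕ} (hx : x ∈ H) :
    h.deg x ≤ 2 * Nat.log 2 N + 1 := by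
  classical
  have h1 := hf.fib_le_card_subtree hl hx
  have h2 : (h.subtree H x).card ≤ N := by
    rw [← Finset.card_range N]
    refine Finset.card_le_card fun y hy => ?_
    simp only [subtree, Finset.mem_filter] at hy
    exact Finset.mem_range.2 (hf.lt y hy.1)
  have h3 := two_pow_le_fib (h.deg x / 2)
  have h4 : Nat.fib (2 * (h.deg x / 2) + 1 + 1) ≤ Nat.fib (h.deg x + 2) :=
    Nat.fib_mono (by omega)
  have h5 : h.deg x / 2 ≤ Nat.log 2 N :=
    Nat.le_log_of_pow_le (by norm_num) (by omega)
  omega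

/-- The potential of a heap. -/
def potential (h : HeapData) (N : ℕ) : ℕ := h.deg N + 2 * ∑ x ∈ Finset.range N, h.mark x

theorem sum_update_le (f : ℕ → ℕ) {x k : ℕ} (hx : x < N) :
    ∑ y ∈ Finset.range N, Function.update f x k y + f x = ∑ y ∈ Finset.range N, f y + k := by
  have hx' := Finset.mem_range.2 hx
  rw [← Finset.sum_erase_add _ _ hx', ← Finset.sum_erase_add _ f hx',
    Function.update_self]
  have : ∑ y ∈ (Finset.range N).erase x, Function.update f x k y =
      ∑ y ∈ (Finset.range N).erase x, f y :=
    Finset.sum_congr rfl fun y hy => Function.update_of_ne (Finset.ne_of_mem_erase hy) _ _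
  omega

theorem toRoot_potential (h : HeapData) {x : ℕ} (hx : h.hpar x ≠ N) (hxN : x < N) :
    (h.toRoot N x).potential N + 2 * h.mark x = h.potential N + 1 := by
  have h1 := sum_update_le (N := N) h.mark (k := 0) hxN
  simp only [potential, toRoot_deg_top h hx, toRoot_mark]
  omega

theorem setMark_potential (h : HeapData) {x : ℕ} (hxN : x < N) :
    (h.setMark x 1).potential N + 2 * h.mark x = h.potential N + 2 := by
  have h1 := sum_update_le (N := N) h.mark (k := 1) hxN
  simp only [potential, setMark]
  omega

/-- A heap with nodes `H`. -/
structure IsHeap (N : ℕ) (H : Finset ℕ) (h : HeapData) (key : ℕ → ℝ) : Prop where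
  links : Links h H
  forest : Forest N H H h 0
  order : ∀ x ∈ H, h.hpar x ≠ N → key (h.hpar x) ≤ key x

end HeapData


open NVar RVar

/-! ## Fibonacci heaps: operations -/

/-- The link structure stored in the memory. -/
def heapData (σ : Store) : HeapData where
  hpar := fun x => σ.nat .hpar x 0
  deg := fun x => σ.nat .deg x 0
  hpos := fun x => σ.nat .hpos x 0
  mark := fun x => σ.nat .mark x 0
  child := σ.nat .child

theorem heapData_congr {σ τ : Store} (h1 : τ.nat hpar = σ.nat hpar) (h2 : τ.nat deg = σ.nat deg)
    (h3 : τ.nat hpos = σ.nat hpos) (h4 : τ.nat mark = σ.nat mark)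
    (h5 : τ.nat child = σ.nat child) : heapData τ = heapData σ := by
  simp only [heapData, h1, h2, h3, h4, h5]

theorem attach_runs (σ : Store) (p x : NVar)
    (hp : p ≠ child ∧ p ≠ hpos ∧ p ≠ hpar ∧ p ≠ deg)
    (hx : x ≠ child ∧ x ≠ hpos ∧ x ≠ hpar ∧ x ≠ deg) :
    Runs (attach p.val x.val) σ (fun τ t =>
      heapData τ = (heapData σ).attach (σ.nat p 0 0) (σ.nat x 0 0) ∧ t ≤ 42) := by
  simp [attach, hp, hx, heapData, HeapData.attach, funext_iff, Function.update_apply]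
  intro a b
  split_ifs <;> simp_all

theorem detach_runs (σ : Store) (x : NVar)
    (hx : x ≠ dp ∧ x ≠ dl ∧ x ≠ child ∧ x ≠ hpos ∧ x ≠ deg) :
    Runs (detach x.val) σ (fun τ t =>
      heapData τ = (heapData σ).detach (σ.nat x 0 0) ∧ t ≤ 100) := by
  simp [detach, hx, heapData, HeapData.detach, funext_iff, Function.update_apply]
  intro a b
  split_ifs <;> simp_all

/-- The potential of the heap stored in the memory. -/
def pot (σ : Store) : ℕ := (heapData σ).potential (σ.nat .n 0 0)

/-- A heap with nodes `H` is stored in the memory. -/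
structure Heap (N : ℕ) (H : Finset ℕ) (σ : Store) : Prop where
  top : σ.nat .n 0 0 = N
  isHeap : HeapData.IsHeap N H (heapData σ) (fun x => σ.real .key x 0)
  bucket : ∀ i, σ.nat .bucket i 0 = 0
  inHeap : ∀ x, σ.nat .inHeap x 0 = if x ∈ H then 1 else 0

/-- The invariant of the loop of `cut`, applied to the node `x`. -/
structure CutInv (N : ℕ) (H : Finset ℕ) (x : ℕ) (key : ℕ → ℝ) (k : ℕ) (σ : Store) : Prop where
  top : σ.nat .n 0 0 = N
  links : (heapData σ).Links H
  forest : HeapData.Forest N H H (heapData σ) (fun y => if y = σ.nat cx 0 0 then 1 else 0)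
  cur : σ.nat cx 0 0 = N ∨ σ.nat cx 0 0 ∈ H
  order : ∀ y ∈ H, y ≠ σ.nat cx 0 0 → (heapData σ).hpar y ≠ N →
    key ((heapData σ).hpar y) ≤ key y
  root : σ.nat cx 0 0 = x ∨ (heapData σ).hpar x = N
  paid : 1000 * pot σ + (if (heapData σ).hpar (σ.nat cx 0 0) = N then 0
    else 3000 + 2000 * (1 - (heapData σ).mark (σ.nat cx 0 0))) ≤ k

open HeapData in
theorem CutInv.step {N : ℕ} {H : Finset ℕ} {x : ℕ} {key : ℕ → ℝ} {k : ℕ} {σ : Store}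
    (h : CutInv N H x key k σ) (hnr : (heapData σ).hpar (σ.nat cx 0 0) ≠ N) :
    Runs (block [
    cq.put (hpar.ix cx.val),
    detach cx.val,
    mark.put1 cx.val 0,
    attach n.val cx.val,
    .ite (.and (.eqN (mark.ix cq.val) 0) (.neN (hpar.ix cq.val) n.val))
      (block [mark.put1 cq.val 1, cx.put n.val])
      (cx.put cq.val)]) σ (fun σ t => ∃ k', CutInv N H x key k' σ ∧ 50 + t + k' ≤ k) := by
  obtain ⟨hN, hl, hf, hcx, hord, hx, hk⟩ := h
  set c := σ.nat cx 0 0 with hc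
  have hcH : c ∈ H := by
    rcases hcx with h1 | h1
    · rw [h1, hf.par_top] at hnr
      exact absurd rfl hnr
    · exact h1
  set q := (heapData σ).hpar c with hq
  have hqH : q ∈ H := by
    rcases hf.par c hcH with h1 | h1
    · exact absurd h1 hnr
    · exact h1.1
  have hqc : q ≠ c := hf.par_ne hcH
  have hcN := hf.lt c hcH
  have hqN := hf.lt q hqH
  have hpot := toRoot_potential (heapData σ) hnr hcN
  have hle := hf.mark_le c
  rw [if_neg hnr] at hk
  simp only [runs_block_cons]
  rw [runs_setN]
  set σ1 := σ.setNat cq (NExp.eval σ 0) (NExp.eval σ 0) (NExp.eval σ (hpar.ix cx.val)) with hσ1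
  have e1 : heapData σ1 = heapData σ := heapData_congr (by rfl) (by rfl) (by rfl) (by rfl) (by rfl)
  have ec1 : σ1.nat cx 0 0 = c := rfl
  have eq1 : σ1.nat cq 0 0 = q := rfl
  have en1 : σ1.nat n 0 0 = N := hN
  refine (detach_runs σ1 cx (by decide)).mono_frame ?_
  rintro σ2 t2 ⟨e2, ht2⟩ f2
  have ec2 : σ2.nat cx 0 0 = c := by rw [f2.1 cx rfl, ec1]
  have eq2 : σ2.nat cq 0 0 = q := by rw [f2.1 cq rfl, eq1]
  have en2 : σ2.nat n 0 0 = N := by rw [f2.1 n rfl, en1]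
  rw [runs_setN]
  set σ3 := σ2.setNat mark (NExp.eval σ2 cx.val) (NExp.eval σ2 0) (NExp.eval σ2 0) with hσ3
  have e3 : heapData σ3 = ((heapData σ).detach c).setMark c 0 := by
    rw [ec1, e1] at e2
    rw [← e2]
    ext a b <;> simp [hσ3, heapData, setMark, Function.update_apply, ec2]
  have ec3 : σ3.nat cx 0 0 = c := ec2
  have eq3 : σ3.nat cq 0 0 = q := eq2
  have en3 : σ3.nat n 0 0 = N := en2
  refine (attach_runs σ3 n cx (by decide) (by decide)).mono_frame ?_
  rintro σ4 t4 ⟨e4, ht4⟩ f4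
  have ec4 : σ4.nat cx 0 0 = c := by rw [f4.1 cx rfl, ec3]
  have eq4 : σ4.nat cq 0 0 = q := by rw [f4.1 cq rfl, eq3]
  have en4 : σ4.nat n 0 0 = N := by rw [f4.1 n rfl, en3]
  replace e4 : heapData σ4 = (heapData σ).toRoot N c := by rw [e4, e3, en3, ec3]; rfl
  have hm4 : σ4.nat mark q 0 = (heapData σ).mark q := by
    change (heapData σ4).mark q = _
    rw [e4, toRoot_mark, Function.update_of_ne hqc]
  have hp4 : σ4.nat hpar q 0 = (heapData σ).hpar q := by
    change (heapData σ4).hpar q = _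
    rw [e4, toRoot_hpar, Function.update_of_ne hqc]
  have hl4 : Links (heapData σ4) H := by rw [e4]; exact hl.toRoot hcH
  have hf4 : Forest N H H (heapData σ4) (fun y => if y = q then 1 else 0) := by
    rw [e4]
    refine hf.toRoot hl hcH hnr (fun y h1 h2 => ?_) (.inl ?_)
    · simp [h1]
    · simp [← hq, hqc]
  have hord4 : ∀ y ∈ H, (heapData σ4).hpar y ≠ N → key ((heapData σ4).hpar y) ≤ key y := by
    intro y hy hyN
    rw [e4, toRoot_hpar] at hyN ⊢
    by_cases hyc : y = c
    · rw [hyc, Function.update_self] at hyN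
      exact absurd rfl hyN
    · rw [Function.update_of_ne hyc] at hyN ⊢
      exact hord y hy hyc hyN
  have hx4 : (heapData σ4).hpar x = N := by
    rw [e4, toRoot_hpar, Function.update_apply]
    split_ifs with h1
    · rfl
    · rcases hx with h2 | h2
      · exact absurd h2.symm h1
      · exact h2
  have hpot4 : pot σ4 + 2 * (heapData σ).mark c = pot σ + 1 := by
    rw [pot, pot, en4, e4, hN]; exact hpot
  rw [runs_block_single, runs_ite]
  simp only [BExp.holds, NExp.eval_get, NExp.eval_zero, eq4, en4, hm4, hp4, BExp.time,
    NExp.time_get, NExp.time_zero]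
  refine ⟨?_, ?_⟩
  · rintro ⟨hm, hr⟩
    simp only [runs_block_single, runs_block_cons, runs_setN, NExp.time_get, NExp.time_zero,
      NExp.time_one]
    set σ5 := Store.setNat _ cx _ _ _ with hσ5
    have e5 : heapData σ5 = (heapData σ4).setMark q 1 := by
      ext a b <;> simp [hσ5, heapData, HeapData.setMark, Function.update_apply, eq4]
    have ec5 : σ5.nat cx 0 0 = N := en4
    have en5 : σ5.nat n 0 0 = N := en4
    have hpar5 : (heapData σ5).hpar = (heapData σ4).hpar := by rw [e5]; rfl
    have hr4 : (heapData σ4).hpar q ≠ N := by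
      rw [show (heapData σ4).hpar q = (heapData σ).hpar q from hp4]; exact hr
    have hpot5 : pot σ5 + 2 * (heapData σ4).mark q = pot σ4 + 2 := by
      rw [pot, pot, e5, en4, en5]
      exact setMark_potential (heapData σ4) hqN
    have hm4' : (heapData σ4).mark q = 0 := by
      rw [show (heapData σ4).mark q = (heapData σ).mark q from hm4]; exact hm
    have hf5 : Forest N H H (heapData σ5) (fun y => if y = N then 1 else 0) := by
      rw [e5]
      refine hf4.setMark hqH hr4 (fun y hy => ?_) ?_
      · simp [hy]
      · simp [hm4']
    refine ⟨1000 * pot σ5, ⟨en5, by rw [e5]; exact hl4.setMark _ _, by rwa [ec5], .inl ec5, ?_,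
      .inr ?_, ?_⟩, ?_⟩
    · intro y hy _
      rw [hpar5]
      exact hord4 y hy
    · rw [hpar5]; exact hx4
    · rw [ec5, if_pos hf5.par_top]; exact le_rfl
    · omega
  · intro hnot
    simp only [runs_setN, NExp.time_get, NExp.time_zero]
    set σ5 := Store.setNat _ cx _ _ _ with hσ5
    have e5 : heapData σ5 = heapData σ4 :=
      heapData_congr (by rfl) (by rfl) (by rfl) (by rfl) (by rfl)
    have ec5 : σ5.nat cx 0 0 = q := eq4
    have hpp : pot σ5 = pot σ4 := by rw [pot, e5]; rfl
    refine ⟨1000 * pot σ4 + (if (heapData σ4).hpar q = N then 0 else 3000),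
      ⟨en4, by rwa [e5], by rwa [e5, ec5], .inr (by rwa [ec5]), ?_, .inr (by rwa [e5]), ?_⟩, ?_⟩
    · intro y hy _
      rw [e5]
      exact hord4 y hy
    · rw [hpp, e5, ec5]
      split_ifs with h1
      · exact le_rfl
      · have hm1 : (heapData σ4).mark q = 1 := by
          have h2 := hf4.mark_le q
          have h3 : (heapData σ4).hpar q = (heapData σ).hpar q := hp4
          have h4 : (heapData σ4).mark q = (heapData σ).mark q := hm4
          rw [h3] at h1
          have : (heapData σ).mark q ≠ 0 := fun h5 => hnot ⟨h5, h1⟩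
          omega
        simp [hm1]
    · split_ifs <;> omega

open HeapData in
theorem cut_runs {N : ℕ} {H : Finset ℕ} {σ : Store} {A : NVar}
    (hN : σ.nat n 0 0 = N) (hl : Links (heapData σ) H) (hf : Forest N H H (heapData σ) 0)
    (hx : σ.nat A 0 0 ∈ H)
    (hord : ∀ y ∈ H, y ≠ σ.nat A 0 0 → (heapData σ).hpar y ≠ N →
      σ.real .key ((heapData σ).hpar y) 0 ≤ σ.real .key y 0) :
    Runs (cut A.val) σ (fun τ t => IsHeap N H (heapData τ) (fun x => τ.real .key x 0) ∧
      (heapData τ).hpar (σ.nat A 0 0) = N ∧ t + 1000 * pot τ ≤ 1000 * pot σ + 6000) := by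
  rw [cut, runs_block_cons, runs_setN, runs_block_single]
  set σ1 := σ.setNat cx (NExp.eval σ 0) (NExp.eval σ 0) (NExp.eval σ A.val) with hσ1
  have e1 : heapData σ1 = heapData σ := heapData_congr (by rfl) (by rfl) (by rfl) (by rfl) (by rfl)
  have ec1 : σ1.nat cx 0 0 = σ.nat A 0 0 := rfl
  have hp1 : pot σ1 = pot σ := by rw [pot, e1]; rfl
  refine (Runs.loop (fun k σ' => σ'.real .key = σ.real .key ∧
      CutInv N H (σ.nat A 0 0) (fun x => σ.real .key x 0) k σ') ?_
      (k := 1000 * pot σ + 5000) (σ := σ1) ?_).mono ?_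
  · rintro k σ' ⟨hkey, h⟩ hb
    simp only [BExp.holds, NExp.eval_get, NExp.eval_zero, h.top] at hb
    refine (h.step hb).mono_frame ?_
    rintro τ t ⟨k', h', hk'⟩ hfr
    refine ⟨k', ⟨by rw [hfr.2 key rfl, hkey], h'⟩, ?_⟩
    simp only [BExp.time, NExp.time_get, NExp.time_zero]
    omega
  · refine ⟨rfl, hN, by rwa [e1], ?_, .inr hx, ?_, .inl ec1, ?_⟩
    · rw [e1]; exact hf.mono fun y _ _ => Nat.zero_le _
    · rw [e1, ec1]; exact hord
    · rw [hp1]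
      split_ifs <;> omega
  · rintro τ t ⟨k', ⟨hkey, hN', hl', hf', hcx, hord', hx', hk'⟩, hb, hk⟩
    simp only [BExp.holds, NExp.eval_get, NExp.eval_zero, hN', not_not] at hb
    change (heapData τ).hpar (τ.nat cx 0 0) = N at hb
    have hsub : ∀ y ∈ H, (heapData τ).hpar y ≠ N → y ≠ τ.nat cx 0 0 := by
      rintro y _ hyN rfl
      exact hyN hb
    refine ⟨⟨hl', hf'.mono fun y hy hyN => ?_, ?_⟩, ?_, ?_⟩
    · simp [hsub y hy hyN]
    · intro y hy hyN
      rw [hkey]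
      exact hord' y hy (hsub y hy hyN) hyN
    · rcases hx' with h1 | h1
      · rw [← h1]; exact hb
      · exact h1
    · simp only [NExp.time_get, NExp.time_zero, BExp.time] at hk ⊢
      split_ifs at hk'
      omega


open NVar RVar

theorem heapInsert_runs {N : ℕ} {H : Finset ℕ} {σ : Store} (h : Heap N H σ)
    (hxN : σ.nat kx 0 0 < N) (hxH : σ.nat kx 0 0 ∉ H) :
    Runs (heapInsert kx.val kap.val) σ (fun τ t => Heap N (insert (σ.nat kx 0 0) H) τ ∧
      (∀ y, τ.real .key y 0 = if y = σ.nat kx 0 0 then σ.real .kap 0 0 else σ.real .key y 0) ∧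
      t + 1000 * pot τ ≤ 1000 * pot σ + 2000) := by
  set x := σ.nat kx 0 0 with hx
  obtain ⟨hN, ⟨hl, hf, hord⟩, hb, hi⟩ := h
  have hout := hf.outside x hxH hxN.ne
  rw [heapInsert, runs_block_cons, runs_setR, runs_block_cons, runs_setN, runs_block_cons,
    runs_setN, runs_block_cons, runs_setN, runs_block_single]
  set σ1 := Store.setNat _ mark _ _ _ with hσ1
  have e1 : heapData σ1 = heapData σ := by
    have h1 : σ.nat deg x 0 = 0 := hout.1
    have h2 : σ.nat mark x 0 = 0 := hout.2
    ext a b <;> simp [hσ1, heapData]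
    · intro h3; rw [h3, h1]
    · intro h3; rw [h3, h2]
  have en1 : σ1.nat n 0 0 = N := by simpa [hσ1] using hN
  have ex1 : σ1.nat kx 0 0 = x := by simp [hσ1, hx]
  have ei1 : ∀ y, σ1.nat inHeap y 0 = if y ∈ insert x H then 1 else 0 := by
    intro y
    simp only [hσ1, Store.nat_setNat, Finset.mem_insert]
    by_cases hy : y = x <;> simp [hi, hy, ← hx]
  have ek1 : ∀ y, σ1.real .key y 0 = if y = x then σ.real .kap 0 0 else σ.real .key y 0 := by
    intro y
    simp [hσ1, ← hx]
  have eb1 : ∀ y, σ1.nat bucket y 0 = 0 := by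
    intro y
    simp [hσ1, hb]
  refine (attach_runs σ1 n kx (by decide) (by decide)).mono_frame ?_
  rintro τ t ⟨e2, ht⟩ fr
  rw [e1, en1, ex1] at e2
  have ek2 : ∀ y, τ.real .key y 0 = if y = x then σ.real .kap 0 0 else σ.real .key y 0 := by
    intro y
    rw [fr.2 key rfl, ek1]
  have en2 : τ.nat n 0 0 = N := by rw [fr.1 n rfl, en1]
  refine ⟨⟨en2, ⟨?_, ?_, ?_⟩, ?_, ?_⟩, ek2, ?_⟩
  · rw [e2]; exact hl.attach hxH
  · rw [e2]; exact hf.attachRoot hxN hxH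
  · intro y hy hyN
    rw [e2] at hyN ⊢
    simp only [HeapData.attach] at hyN ⊢
    have hyx : y ≠ x := by
      rintro rfl
      simp at hyN
    have hyH : y ∈ H := by simpa [hyx] using hy
    rw [Function.update_of_ne hyx] at hyN ⊢
    have hpx : (heapData σ).hpar y ≠ x := by
      intro h1
      rcases hf.par y hyH with h2 | h2
      · exact hyN h2
      · exact hxH (h1 ▸ h2.1)
    rw [ek2, ek2, if_neg hyx, if_neg hpx]
    exact hord y hyH hyN
  · intro i
    rw [fr.1 bucket rfl, eb1]
  · intro y
    rw [fr.1 inHeap rfl, ei1]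
  · have : pot τ = pot σ + 1 := by
      rw [pot, pot, e2, en2, hN]
      simp [HeapData.potential, HeapData.attach]
      omega
    simp only [NExp.time_get, NExp.time_zero, NExp.time_one, RExp.time_get]
    omega

theorem heapDecrease_runs {N : ℕ} {H : Finset ℕ} {σ : Store} (h : Heap N H σ)
    (hxH : σ.nat kx 0 0 ∈ H) (hk : σ.real .kap 0 0 ≤ σ.real .key (σ.nat kx 0 0) 0) :
    Runs (heapDecrease kx.val kap.val) σ (fun τ t => Heap N H τ ∧
      (∀ y, τ.real .key y 0 = if y = σ.nat kx 0 0 then σ.real .kap 0 0 else σ.real .key y 0) ∧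
      t + 1000 * pot τ ≤ 1000 * pot σ + 7000) := by
  set x := σ.nat kx 0 0 with hx
  obtain ⟨hN, ⟨hl, hf, hord⟩, hb, hi⟩ := h
  rw [heapDecrease, runs_block_cons, runs_setR, runs_block_single, when, runs_ite]
  set σ1 := Store.setReal _ key _ _ _ with hσ1
  have e1 : heapData σ1 = heapData σ := rfl
  have ek1 : ∀ y, σ1.real .key y 0 = if y = x then σ.real .kap 0 0 else σ.real .key y 0 := by
    intro y
    simp [hσ1, ← hx]
  have ex1 : σ1.nat kx 0 0 = x := rfl
  have en1 : σ1.nat n 0 0 = N := hN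
  have hp1 : pot σ1 = pot σ := rfl
  have hord1 : ∀ y ∈ H, y ≠ x → (heapData σ).hpar y ≠ N →
      σ1.real .key ((heapData σ).hpar y) 0 ≤ σ1.real .key y 0 := by
    intro y hy hyx hyN
    have h1 := hord y hy hyN
    rw [ek1, ek1, if_neg hyx]
    split_ifs with h2
    · rw [h2] at h1; exact hk.trans h1
    · exact h1
  simp only [BExp.time, RExp.time_get, NExp.time_get, NExp.time_zero]
  constructor
  · intro _
    refine (cut_runs (A := kx) en1 (by rwa [e1]) (by rwa [e1]) hxH
      (by rw [e1]; exact hord1)).mono_frame ?_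
    rintro τ t ⟨hH, -, ht⟩ fr
    refine ⟨⟨by rw [fr.1 n rfl, en1], hH, ?_, ?_⟩, ?_, ?_⟩
    · intro i; rw [fr.1 bucket rfl]; exact hb i
    · intro i; rw [fr.1 inHeap rfl]; exact hi i
    · intro y; rw [fr.2 key rfl, ek1]
    · omega
  · intro hb'
    rw [runs_skip]
    refine ⟨⟨en1, ⟨hl, hf, ?_⟩, hb, hi⟩, ek1, ?_⟩
    · intro y hy hyN
      by_cases hyx : y = x
      · by_contra h1
        refine hb' ⟨?_, ?_⟩
        · intro h2
          exact hyN (by rw [hyx]; exact h2.trans hN)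
        · push Not at h1
          rw [hyx] at h1
          exact h1
      · exact hord1 y hy hyx hyN
    · omega

/-- The invariant of the loop of `heapDelete` that moves the children of `x`. -/
structure DeleteInv (N : ℕ) (H : Finset ℕ) (x : ℕ) (key : ℕ → ℝ) (k : ℕ) (σ : Store) : Prop where
  top : σ.nat .n 0 0 = N
  cur : σ.nat hx 0 0 = x
  links : (heapData σ).Links (H.erase x)
  forest : HeapData.Forest N H (H.erase x) (heapData σ) 0
  order : ∀ y ∈ H, (heapData σ).hpar y ≠ N → key ((heapData σ).hpar y) ≤ key y
  paid : 1000 * pot σ + 1500 * (heapData σ).deg x ≤ k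

open HeapData in
theorem DeleteInv.step {N : ℕ} {H : Finset ℕ} {x : ℕ} {key : ℕ → ℝ} {k : ℕ} {σ : Store}
    (h : DeleteInv N H x key k σ) (hxH : x ∈ H) (hd : 0 < (heapData σ).deg x) :
    Runs (block [
    hy.put (child.ix2 hx.val (deg.ix hx.val - 1)),
    detach hy.val,
    mark.put1 hy.val 0,
    attach n.val hy.val]) σ (fun σ t => ∃ k', DeleteInv N H x key k' σ ∧ 50 + t + k' ≤ k) := by
  obtain ⟨hN, hc, hl, hf, hord, hk⟩ := h
  have hxN := hf.lt x hxH
  have hxp : (heapData σ).hpar x = N := by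
    rcases hf.par x hxH with h1 | h1
    · exact h1
    · exact absurd h1.2 (Finset.notMem_erase _ _)
  set y := (heapData σ).child x ((heapData σ).deg x - 1) with hy
  have hyK : y ∈ H.erase x := hl.mem x _ (by omega)
  have hyp : (heapData σ).hpar y = x := hl.par_child x _ (by omega)
  have hyH := Finset.mem_of_mem_erase hyK
  have hyN := hf.lt y hyH
  have hpot := toRoot_potential (heapData σ) (N := N) (x := y) (by rw [hyp]; exact hxN.ne) hyN
  rw [runs_block_cons, runs_setN, runs_block_cons]
  set σ1 := Store.setNat _ NVar.hy _ _ _ with hσ1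
  have e1 : heapData σ1 = heapData σ := heapData_congr (by rfl) (by rfl) (by rfl) (by rfl) (by rfl)
  have ey1 : σ1.nat NVar.hy 0 0 = y := by
    change σ.nat child (σ.nat hx 0 0) (σ.nat deg (σ.nat hx 0 0) 0 - 1) = _
    rw [hc]; rfl
  have ex1 : σ1.nat hx 0 0 = x := hc
  have en1 : σ1.nat n 0 0 = N := hN
  refine (detach_runs σ1 NVar.hy (by decide)).mono_frame ?_
  rintro σ2 t2 ⟨e2, ht2⟩ f2
  have ey2 : σ2.nat NVar.hy 0 0 = y := by rw [f2.1 NVar.hy rfl, ey1]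
  have ex2 : σ2.nat hx 0 0 = x := by rw [f2.1 hx rfl, ex1]
  have en2 : σ2.nat n 0 0 = N := by rw [f2.1 n rfl, en1]
  rw [runs_block_cons, runs_setN, runs_block_single]
  set σ3 := Store.setNat _ mark _ _ _ with hσ3
  have e3 : heapData σ3 = ((heapData σ).detach y).setMark y 0 := by
    rw [ey1, e1] at e2
    rw [← e2]
    ext a b <;> simp [hσ3, heapData, HeapData.setMark, Function.update_apply, ey2]
  have ey3 : σ3.nat NVar.hy 0 0 = y := ey2
  have ex3 : σ3.nat hx 0 0 = x := ex2
  have en3 : σ3.nat n 0 0 = N := en2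
  refine (attach_runs σ3 n NVar.hy (by decide) (by decide)).mono_frame ?_
  rintro σ4 t4 ⟨e4, ht4⟩ f4
  have ex4 : σ4.nat hx 0 0 = x := by rw [f4.1 hx rfl, ex3]
  have en4 : σ4.nat n 0 0 = N := by rw [f4.1 n rfl, en3]
  replace e4 : heapData σ4 = (heapData σ).toRoot N y := by rw [e4, e3, en3, ey3]; rfl
  have hpot4 : pot σ4 + 2 * (heapData σ).mark y = pot σ + 1 := by
    rw [pot, pot, en4, e4, hN]; exact hpot
  have hdeg : (heapData σ4).deg x = (heapData σ).deg x - 1 := by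
    rw [e4, toRoot_deg_of_ne _ hxN.ne, if_pos hyp.symm]
  refine ⟨1000 * pot σ4 + 1500 * (heapData σ4).deg x,
    ⟨en4, ex4, by rw [e4]; exact hl.toRoot hyK, ?_, ?_, le_rfl⟩, ?_⟩
  · rw [e4]
    exact hf.toRoot hl hyK (by rw [hyp]; exact hxN.ne) (fun _ _ _ => le_rfl)
      (.inr (by rw [hyp, hxp]))
  · intro z hz hzN
    rw [e4, toRoot_hpar] at hzN ⊢
    by_cases hzy : z = y
    · rw [hzy, Function.update_self] at hzN
      exact absurd rfl hzN
    · rw [Function.update_of_ne hzy] at hzN ⊢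
      exact hord z hz hzN
  · simp only [NExp.time_get, NExp.time_zero, NExp.time_sub, NExp.time_one]
    omega

open HeapData in
theorem heapDelete_runs {N : ℕ} {H : Finset ℕ} {σ : Store} (h : Heap N H σ)
    (hxH : σ.nat sw 0 0 ∈ H) :
    Runs (heapDelete sw.val) σ (fun τ t => Heap N (H.erase (σ.nat sw 0 0)) τ ∧
      t + 1000 * pot τ ≤ 1000 * pot σ + 10000 * (Nat.log 2 N + 1)) := by
  set x := σ.nat sw 0 0 with hx'
  obtain ⟨hN, ⟨hl, hf, hord⟩, hb, hi⟩ := h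
  have hxN := hf.lt x hxH
  rw [heapDelete, runs_block_cons, runs_setN, runs_block_cons]
  set σ1 := Store.setNat _ hx _ _ _ with hσ1
  have e1 : heapData σ1 = heapData σ := heapData_congr (by rfl) (by rfl) (by rfl) (by rfl) (by rfl)
  have ex1 : σ1.nat hx 0 0 = x := rfl
  have en1 : σ1.nat n 0 0 = N := hN
  have hp1 : pot σ1 = pot σ := by rw [pot, pot, e1]; rfl
  refine (cut_runs (A := hx) en1 (by rwa [e1]) (by rwa [e1]) hxH
    (by rw [e1]; exact fun y hy _ => hord y hy)).mono_frame ?_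
  rintro σ2 t2 ⟨⟨hl2, hf2, hord2⟩, hr2, ht2⟩ f2
  rw [ex1] at hr2
  have ex2 : σ2.nat hx 0 0 = x := by rw [f2.1 hx rfl, ex1]
  have en2 : σ2.nat n 0 0 = N := by rw [f2.1 n rfl, en1]
  rw [runs_block_cons]
  refine (detach_runs σ2 hx (by decide)).mono_frame ?_
  rintro σ3 t3 ⟨e3, ht3⟩ f3
  rw [ex2] at e3
  have ex3 : σ3.nat hx 0 0 = x := by rw [f3.1 hx rfl, ex2]
  have en3 : σ3.nat n 0 0 = N := by rw [f3.1 n rfl, en2]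
  have hdeg3 : (heapData σ3).deg x ≤ 2 * Nat.log 2 N + 1 := by
    rw [e3, HeapData.detach, hr2]
    simp only [Function.update_of_ne hxN.ne]
    exact hf2.deg_le hl2 hxH
  have hpot3 : pot σ3 ≤ pot σ2 := by
    rw [pot, pot, e3, en3, en2]
    simp only [potential, HeapData.detach, hr2, Function.update_self]
    omega
  rw [runs_block_cons]
  refine (Runs.loop (fun k σ' => DeleteInv N H x (fun x => σ2.real .key x 0) k σ') ?_
      (k := 1000 * pot σ3 + 1500 * (heapData σ3).deg x) (σ := σ3) ?_).mono_frame ?_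
  · rintro k σ' h hb
    simp only [BExp.holds, NExp.eval_get, NExp.eval_zero, h.cur] at hb
    refine (h.step hxH hb).mono ?_
    rintro τ t ⟨k', h', hk'⟩
    refine ⟨k', h', ?_⟩
    simp only [BExp.time, NExp.time_get, NExp.time_zero]
    omega
  · refine ⟨en3, ex3, ?_, ?_, ?_, le_rfl⟩
    · rw [e3]; exact hl2.detach hxH
    · rw [e3]; exact hf2.detachRoot hr2
    · rw [e3]; exact hord2
  · rintro σ4 t4 ⟨k', ⟨en4, ex4, hl4, hf4, hord4, hk4⟩, hb4, hk'⟩ f4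
    simp only [BExp.holds, NExp.eval_get, NExp.eval_zero, ex4, not_lt, Nat.le_zero] at hb4
    rw [runs_block_single, runs_setN]
    set σ5 := Store.setNat _ inHeap _ _ _ with hσ5
    have e5 : heapData σ5 = heapData σ4 :=
      heapData_congr (by rfl) (by rfl) (by rfl) (by rfl) (by rfl)
    have hp5 : pot σ5 = pot σ4 := by rw [pot, pot, e5]; rfl
    have ekey : σ5.real .key = σ2.real .key := by
      change σ4.real .key = _
      rw [f4.2 key rfl, f3.2 key rfl]
    have einH : σ4.nat inHeap = σ.nat inHeap := by
      rw [f4.1 inHeap rfl, f3.1 inHeap rfl, f2.1 inHeap rfl]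
      rfl
    have ebuck : σ5.nat bucket = σ.nat bucket := by
      change σ4.nat bucket = _
      rw [f4.1 bucket rfl, f3.1 bucket rfl, f2.1 bucket rfl]
      rfl
    refine ⟨⟨en4, ⟨by rwa [e5], ?_, ?_⟩, ?_, ?_⟩, ?_⟩
    · rw [e5]; exact hf4.erase hl4 hxH hb4
    · rw [e5, ekey]
      exact fun y hy => hord4 y (Finset.mem_of_mem_erase hy)
    · intro i; rw [ebuck, hb]
    · intro y
      have : σ5.nat inHeap y 0 = if y = x then 0 else σ4.nat inHeap y 0 := by
        simp [hσ5, ex4]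
      rw [this, einH, hi]
      by_cases hyx : y = x <;> simp [hyx]
    · simp only [NExp.time_get, NExp.time_zero, BExp.time] at hk' ⊢
      omega


open NVar RVar HeapData

theorem HeapData.Forest.exists_root {N : ℕ} {H K : Finset ℕ} {h : HeapData} {b : ℕ → ℕ}
    (hf : Forest N H K h b) {key : ℕ → ℝ}
    (hord : ∀ x ∈ H, h.hpar x ≠ N → key (h.hpar x) ≤ key x) (hne : H.Nonempty) :
    ∃ r ∈ H, h.hpar r = N ∧ ∀ x ∈ H, key r ≤ key x := by
  obtain ⟨m, hm, hmin⟩ := H.exists_min_image key hne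
  obtain ⟨g, hg⟩ := hf.height
  obtain ⟨r, hr, hmax⟩ := (H.filter (fun y => key y ≤ key m)).exists_max_image g
    ⟨m, Finset.mem_filter.2 ⟨hm, le_rfl⟩⟩
  obtain ⟨hrH, hrm⟩ := Finset.mem_filter.1 hr
  refine ⟨r, hrH, ?_, fun x hx => hrm.trans (hmin x hx)⟩
  by_contra hrN
  have hp : h.hpar r ∈ H := by
    rcases hf.par r hrH with h1 | h1
    · exact absurd h1 hrN
    · exact h1.1
  have := hmax _ (Finset.mem_filter.2 ⟨hp, (hord r hrH hrN).trans hrm⟩)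
  have := hg r hrH hrN
  omega

/-- The invariant of the consolidation: the roots that are not stored among the children of `N`
are in the table `bucket`, except `e`. -/
structure FindInv (N : ℕ) (H K : Finset ℕ) (e : ℕ) (key : ℕ → ℝ) (σ : Store) : Prop where
  top : σ.nat .n 0 0 = N
  links : (heapData σ).Links K
  forest : Forest N H K (heapData σ) 0
  order : ∀ y ∈ H, (heapData σ).hpar y ≠ N → key ((heapData σ).hpar y) ≤ key y
  key_eq : ∀ y, σ.real .key y 0 = key y
  stored : ∀ y ∈ H, y ∉ K → y ≠ e → σ.nat bucket ((heapData σ).deg y) 0 = y + 1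
  bucket_mem : ∀ i, σ.nat .bucket i 0 ≠ 0 →
    ∃ y ∈ H, y ∉ K ∧ y ≠ e ∧ σ.nat .bucket i 0 = y + 1 ∧ (heapData σ).deg y = i
  lt_max : ∀ i, σ.nat bucket i 0 ≠ 0 → i < σ.nat maxRank 0 0
  max_le : σ.nat maxRank 0 0 ≤ 2 * Nat.log 2 N + 2

theorem FindInv.root {N : ℕ} {H K : Finset ℕ} {e : ℕ} {key : ℕ → ℝ} {σ : Store}
    (h : FindInv N H K e key σ) {y : ℕ} (hy : y ∈ H) (hyK : y ∉ K) : (heapData σ).hpar y = N := by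
  rcases h.forest.par y hy with h1 | h1
  · exact h1
  · exact absurd h1.2 hyK

/-- The effect of linking two roots of equal rank. -/
theorem FindInv.link {N : ℕ} {H K : Finset ℕ} {e : ℕ} {key : ℕ → ℝ} {σ τ : Store}
    (h : FindInv N H K e key σ) (he : e ∈ H) (heK : e ∉ K) {y : ℕ} (hy : y ∈ H) (hyK : y ∉ K)
    (hye : y ≠ e) (hd : (heapData σ).deg y = (heapData σ).deg e) {a c : ℕ}
    (hac : a = e ∧ c = y ∨ a = y ∧ c = e) (hkey : key a ≤ key c)
    (hτ : heapData τ = (heapData σ).attach a c) (hn : τ.nat n 0 0 = N)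
    (hkeyτ : ∀ y, τ.real .key y 0 = key y) (hmax : τ.nat maxRank 0 0 = σ.nat maxRank 0 0)
    (hb : ∀ i, τ.nat .bucket i 0 =
      if i = (heapData σ).deg e then 0 else σ.nat .bucket i 0) :
    FindInv N H (insert c K) a key τ ∧ a ∈ H ∧ a ∉ insert c K ∧ c ∉ K ∧ c ∈ H := by
  have haH : a ∈ H := by rcases hac with ⟨rfl, -⟩ | ⟨rfl, -⟩ <;> assumption
  have hcH : c ∈ H := by rcases hac with ⟨-, rfl⟩ | ⟨-, rfl⟩ <;> assumption
  have haK : a ∉ K := by rcases hac with ⟨rfl, -⟩ | ⟨rfl, -⟩ <;> assumption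
  have hcK : c ∉ K := by rcases hac with ⟨-, rfl⟩ | ⟨-, rfl⟩ <;> assumption
  have hacne : a ≠ c := by
    rcases hac with ⟨rfl, rfl⟩ | ⟨rfl, rfl⟩
    · exact hye.symm
    · exact hye
  have hdac : (heapData σ).deg a = (heapData σ).deg c := by
    rcases hac with ⟨rfl, rfl⟩ | ⟨rfl, rfl⟩
    · exact hd.symm
    · exact hd
  have hmem : ∀ z, z ≠ a → z ≠ c → z ≠ e ∧ z ≠ y := by
    rcases hac with ⟨rfl, rfl⟩ | ⟨rfl, rfl⟩ <;> tauto
  have hmem' : ∀ z, z ≠ e → z ≠ y → z ≠ a ∧ z ≠ c := by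
    rcases hac with ⟨rfl, rfl⟩ | ⟨rfl, rfl⟩ <;> tauto
  have hyst := h.stored y hy hyK hye
  have hanot : a ∉ insert c K := by simp [hacne, haK]
  have hdz : ∀ z, z ≠ a → (heapData τ).deg z = (heapData σ).deg z := by
    intro z hz
    rw [hτ]
    simp only [HeapData.attach, Function.update_of_ne hz]
  refine ⟨⟨hn, ?_, ?_, ?_, hkeyτ, ?_, ?_, ?_, ?_⟩, haH, hanot, hcK, hcH⟩
  · rw [hτ]; exact h.links.attach hcK
  · rw [hτ]; exact h.forest.link h.links haH hcH hacne haK hcK hdac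
  · intro z hz hzN
    rw [hτ] at hzN ⊢
    simp only [HeapData.attach] at hzN ⊢
    by_cases hzc : z = c
    · rw [hzc, Function.update_self]
      exact hkey
    · rw [Function.update_of_ne hzc] at hzN ⊢
      exact h.order z hz hzN
  · intro z hz hzK hza
    have hzc : z ≠ c := fun h1 => hzK (h1 ▸ Finset.mem_insert_self _ _)
    have hzK' : z ∉ K := fun h1 => hzK (Finset.mem_insert_of_mem h1)
    obtain ⟨hze, hzy⟩ := hmem z hza hzc
    have hzst := h.stored z hz hzK' hze
    rw [hdz z hza, hb, if_neg]
    · exact hzst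
    · intro h1
      rw [h1, ← hd, hyst] at hzst
      omega
  · intro i hi
    rw [hb] at hi ⊢
    split_ifs at hi with h1
    · exact absurd rfl hi
    · obtain ⟨z, hz, hzK, hze, hzi, hzd⟩ := h.bucket_mem i hi
      have hzy : z ≠ y := by
        rintro rfl
        exact h1 (by rw [← hzd, hd])
      obtain ⟨hza, hzc⟩ := hmem' z hze hzy
      refine ⟨z, hz, by simp [hzc, hzK], hza, ?_, by rw [hdz z hza, hzd]⟩
      rw [if_neg h1, hzi]
  · intro i hi
    rw [hb] at hi
    rw [hmax]
    split_ifs at hi with h1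
    · exact absurd rfl hi
    · exact h.lt_max i hi
  · rw [hmax]; exact h.max_le

theorem linkLoop_step {N : ℕ} {H K : Finset ℕ} {key : ℕ → ℝ} {σ : Store}
    (h : FindInv N H K (σ.nat fx 0 0) key σ) (hxH : σ.nat fx 0 0 ∈ H) (hxK : σ.nat fx 0 0 ∉ K)
    (hb : σ.nat .bucket (σ.nat deg (σ.nat fx 0 0) 0) 0 ≠ 0) :
    Runs (block [
      fy.put (bucket.ix (deg.ix fx.val) - 1),
      bucket.put1 (deg.ix fx.val) 0,
      when (.ltR (RVar.key.ix fy.val) (RVar.key.ix fx.val))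
        (block [ft.put fx.val, fx.put fy.val, fy.put ft.val]),
      attach fx.val fy.val]) σ (fun τ t => ∃ K' : Finset ℕ, FindInv N H K' (τ.nat fx 0 0) key τ ∧
        τ.nat fx 0 0 ∈ H ∧ τ.nat fx 0 0 ∉ K' ∧ (heapData τ).deg N = (heapData σ).deg N ∧
        (H \ K').card + 1 ≤ (H \ K).card ∧ t ≤ 200) := by
  set x := σ.nat fx 0 0 with hx
  obtain ⟨y, hy, hyK, hyx, hby, hdy⟩ := h.bucket_mem _ hb
  rw [runs_block_cons, runs_setN, runs_block_cons, runs_setN, runs_block_cons, when, runs_ite]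
  set σ1 := Store.setNat _ .bucket _ _ _ with hσ1
  have e1 : heapData σ1 = heapData σ := heapData_congr (by rfl) (by rfl) (by rfl) (by rfl) (by rfl)
  have ex1 : σ1.nat fx 0 0 = x := rfl
  have ey1 : σ1.nat fy 0 0 = y := by
    change σ.nat .bucket (σ.nat deg (σ.nat fx 0 0) 0) 0 - 1 = y
    rw [← hx, hby]; rfl
  have en1 : σ1.nat n 0 0 = N := h.top
  have hb1 : ∀ i, σ1.nat .bucket i 0 = if i = (heapData σ).deg x then 0 else σ.nat .bucket i 0 := by
    intro i
    simp [hσ1, heapData, hx]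
  have ek1 : ∀ z, σ1.real .key z 0 = key z := h.key_eq
  have em1 : σ1.nat maxRank 0 0 = σ.nat maxRank 0 0 := rfl
  have main : ∀ (σ2 : Store) (a c t2 : ℕ), heapData σ2 = heapData σ → σ2.nat fx 0 0 = a →
      σ2.nat fy 0 0 = c → σ2.nat n 0 0 = N → (σ2.nat .bucket = σ1.nat .bucket) →
      (σ2.real .key = σ1.real .key) → σ2.nat maxRank 0 0 = σ1.nat maxRank 0 0 →
      (a = x ∧ c = y ∨ a = y ∧ c = x) → key a ≤ key c → t2 ≤ 100 →
      Runs (block [attach fx.val fy.val]) σ2 (fun τ t => ∃ K' : Finset ℕ,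
        FindInv N H K' (τ.nat fx 0 0) key τ ∧
        τ.nat fx 0 0 ∈ H ∧ τ.nat fx 0 0 ∉ K' ∧ (heapData τ).deg N = (heapData σ).deg N ∧
        (H \ K').card + 1 ≤ (H \ K).card ∧ t2 + t ≤ 200) := by
    intro σ2 a c t2 e2 ea ec en eb ek em hac hkey ht
    rw [runs_block_single]
    refine (attach_runs σ2 fx fy (by decide) (by decide)).mono_frame ?_
    rintro τ t3 ⟨e3, ht3⟩ f3
    have ea3 : τ.nat fx 0 0 = a := by rw [f3.1 fx rfl, ea]
    rw [e2, ea, ec] at e3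
    obtain ⟨hinv, haH, haK, hcK, hcH⟩ := h.link hxH hxK hy hyK hyx hdy hac hkey e3
      (by rw [f3.1 n rfl, en]) (fun z => by rw [f3.2 RVar.key rfl, ek, ek1])
      (by rw [f3.1 maxRank rfl, em, em1]) (fun i => by rw [f3.1 .bucket rfl, eb, hb1])
    refine ⟨insert c K, ?_, ?_, ?_, ?_, ?_, by omega⟩
    · rwa [ea3]
    · rwa [ea3]
    · rwa [ea3]
    · rw [e3]
      simp only [HeapData.attach, Function.update_of_ne (h.forest.lt a haH).ne']
    · rw [Finset.sdiff_insert, Finset.card_erase_of_mem (Finset.mem_sdiff.2 ⟨hcH, hcK⟩)]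
      have : 0 < (H \ K).card := Finset.card_pos.2 ⟨c, Finset.mem_sdiff.2 ⟨hcH, hcK⟩⟩
      omega
  constructor
  · intro hlt
    simp only [BExp.holds, RExp.eval_get, NExp.eval_get, NExp.eval_zero, ex1, ey1, ek1] at hlt
    rw [runs_block_cons, runs_setN, runs_block_cons, runs_setN, runs_block_single, runs_setN]
    set σ2 := Store.setNat _ fy _ _ _ with hσ2
    refine (main σ2 y x 100 ?_ ?_ ?_ en1 rfl rfl rfl (.inr ⟨rfl, rfl⟩) hlt.le le_rfl).mono ?_
    · rw [← e1]
      exact heapData_congr (by rfl) (by rfl) (by rfl) (by rfl) (by rfl)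
    · exact ey1
    · exact ex1
    · rintro τ t ⟨K', h1, h2, h3, h4, h5, h6⟩
      refine ⟨K', h1, h2, h3, h4, h5, ?_⟩
      simp only [BExp.time, RExp.time_get, NExp.time_get, NExp.time_zero, NExp.time_sub,
        NExp.time_one]
      omega
  · intro hlt
    simp only [BExp.holds, RExp.eval_get, NExp.eval_get, NExp.eval_zero, ex1, ey1, ek1,
      not_lt] at hlt
    rw [runs_skip]
    refine (main σ1 x y 100 e1 ex1 ey1 en1 rfl rfl rfl (.inl ⟨rfl, rfl⟩) hlt le_rfl).mono ?_
    rintro τ t ⟨K', h1, h2, h3, h4, h5, h6⟩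
    refine ⟨K', h1, h2, h3, h4, h5, ?_⟩
    simp only [BExp.time, RExp.time_get, NExp.time_get, NExp.time_zero, NExp.time_sub,
      NExp.time_one]
    omega

theorem consolidate_step {N : ℕ} {H K : Finset ℕ} {key : ℕ → ℝ} {σ : Store}
    (h : FindInv N H K N key σ) (hd : 0 < (heapData σ).deg N) :
    Runs (block [
    fx.put (child.ix2 n.val (deg.ix n.val - 1)),
    deg.put1 n.val (deg.ix n.val - 1),
    .loop (.neN (bucket.ix (deg.ix fx.val)) 0) (block [
      fy.put (bucket.ix (deg.ix fx.val) - 1),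
      bucket.put1 (deg.ix fx.val) 0,
      when (.ltR (RVar.key.ix fy.val) (RVar.key.ix fx.val))
        (block [ft.put fx.val, fx.put fy.val, fy.put ft.val]),
      attach fx.val fy.val]),
    bucket.put1 (deg.ix fx.val) (fx.val + 1),
    when (.ltN maxRank.val (deg.ix fx.val + 1)) (maxRank.put (deg.ix fx.val + 1))]) σ
    (fun τ t => ∃ K' : Finset ℕ, FindInv N H K' N key τ ∧
      50 + t + (600 * (heapData τ).deg N + 300 * (H \ K').card) ≤
        600 * (heapData σ).deg N + 300 * (H \ K).card) := by
  set x := (heapData σ).child N ((heapData σ).deg N - 1) with hx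
  have hxK : x ∈ K := h.links.mem _ _ (by omega)
  have hxp : (heapData σ).hpar x = N := h.links.par_child _ _ (by omega)
  have hxpos : (heapData σ).hpos x = (heapData σ).deg N - 1 := h.links.pos_child _ _ (by omega)
  have hxH := h.forest.sub hxK
  have hxN := h.forest.lt x hxH
  rw [runs_block_cons, runs_setN, runs_block_cons, runs_setN]
  set σ1 := Store.setNat _ deg _ _ _ with hσ1
  have ex1 : σ1.nat fx 0 0 = x := by
    change σ.nat child (σ.nat n 0 0) (σ.nat deg (σ.nat n 0 0) 0 - 1) = _
    rw [h.top]; rfl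
  have en1 : σ1.nat n 0 0 = N := h.top
  have e1 : heapData σ1 = (heapData σ).detach x := by
    have h1 : (heapData σ1).deg = Function.update (heapData σ).deg N ((heapData σ).deg N - 1) := by
      funext a
      simp [hσ1, heapData, h.top, Function.update_apply]
    have h2 : (heapData σ).detach x = { heapData σ with deg := (heapData σ1).deg } := by
      rw [h1, HeapData.detach, hxp, ← hx, Function.update_eq_self x, hxpos, hx,
        Function.update_eq_self ((heapData σ).deg N - 1), Function.update_eq_self N]
    rw [h2]
    rfl
  have hinv1 : FindInv N H (K.erase x) x key σ1 := by
    have hdz : ∀ z ∈ H, (heapData σ1).deg z = (heapData σ).deg z := by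
      intro z hz
      rw [e1, HeapData.detach, hxp]
      simp only [Function.update_of_ne (h.forest.lt z hz).ne]
    refine ⟨en1, ?_, ?_, ?_, h.key_eq, ?_, ?_, h.lt_max, h.max_le⟩
    · rw [e1]; exact h.links.detach hxK
    · rw [e1]; exact h.forest.detachRoot hxp
    · rw [e1]; exact h.order
    · intro z hz hzK hzx
      rw [hdz z hz]
      exact h.stored z hz (fun h1 => hzK (Finset.mem_erase.2 ⟨hzx, h1⟩)) (h.forest.lt z hz).ne
    · intro i hi
      obtain ⟨z, hz, hzK, hzN, hzi, hzd⟩ := h.bucket_mem i hi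
      refine ⟨z, hz, fun h1 => hzK (Finset.mem_of_mem_erase h1), ?_, hzi, by rw [hdz z hz, hzd]⟩
      rintro rfl
      exact hzK hxK
  have hdeg1 : (heapData σ1).deg N = (heapData σ).deg N - 1 := by
    rw [e1, HeapData.detach, hxp]
    simp only [Function.update_self]
  have hcard1 : (H \ K.erase x).card ≤ (H \ K).card + 1 := by
    rw [Finset.sdiff_erase hxH]
    exact Finset.card_insert_le _ _
  rw [runs_block_cons]
  refine (Runs.loop (fun k σ' => ∃ K', FindInv N H K' (σ'.nat fx 0 0) key σ' ∧
    σ'.nat fx 0 0 ∈ H ∧ σ'.nat fx 0 0 ∉ K' ∧ (heapData σ').deg N = (heapData σ1).deg N ∧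
    300 * (H \ K').card ≤ k) ?_ (k := 300 * (H \ K.erase x).card) (σ := σ1) ?_).mono_frame ?_
  · rintro k σ' ⟨K', hinv', hxH', hxK', hdeg', hk⟩ hb
    refine (linkLoop_step hinv' hxH' hxK' hb).mono ?_
    rintro τ t ⟨K'', h1, h2, h3, h4, h5, h6⟩
    refine ⟨300 * (H \ K'').card, ⟨K'', h1, h2, h3, by rw [h4, hdeg'], le_rfl⟩, ?_⟩
    simp only [BExp.time, NExp.time_get, NExp.time_zero]
    omega
  · exact ⟨K.erase x, by rwa [ex1], by rwa [ex1], by rw [ex1]; exact Finset.notMem_erase _ _, rfl,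
      le_rfl⟩
  · rintro σ2 t2 ⟨k', ⟨K', hinv', hxH', hxK', hdeg', hk'⟩, hb, hk⟩ f2
    set x' := σ2.nat fx 0 0 with hx'
    simp only [BExp.holds, NExp.eval_get, NExp.eval_zero, not_not, ← hx'] at hb
    have hxN' := hinv'.forest.lt x' hxH'
    rw [runs_block_cons, runs_setN, runs_block_single, when, runs_ite]
    set σ3 := Store.setNat _ .bucket _ _ _ with hσ3
    have e3 : heapData σ3 = heapData σ2 :=
      heapData_congr (by rfl) (by rfl) (by rfl) (by rfl) (by rfl)
    have hb3 : ∀ i, σ3.nat .bucket i 0 =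
        if i = (heapData σ2).deg x' then x' + 1 else σ2.nat .bucket i 0 := by
      intro i
      simp [hσ3, heapData, hx']
    have main : ∀ (τ : Store), heapData τ = heapData σ2 → τ.nat n 0 0 = N →
        τ.nat .bucket = σ3.nat .bucket → τ.real .key = σ2.real .key →
        σ2.nat maxRank 0 0 ≤ τ.nat maxRank 0 0 → (heapData σ2).deg x' < τ.nat maxRank 0 0 →
        τ.nat maxRank 0 0 ≤ 2 * Nat.log 2 N + 2 → FindInv N H K' N key τ := by
      intro τ eτ en eb ek hm1 hm2 hm3
      refine ⟨en, by rw [eτ]; exact hinv'.links, by rw [eτ]; exact hinv'.forest,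
        by rw [eτ]; exact hinv'.order, fun z => by rw [ek]; exact hinv'.key_eq z, ?_, ?_, ?_, hm3⟩
      · intro z hz hzK _
        rw [eb, eτ, hb3]
        split_ifs with h1
        · by_cases hzx : z = x'
          · rw [hzx]
          · have h2 := hinv'.stored z hz hzK hzx
            rw [h1] at h2
            change σ2.nat .bucket (σ2.nat deg x' 0) 0 = z + 1 at h2
            omega
        · exact hinv'.stored z hz hzK (fun h2 => h1 (by rw [h2]))
      · intro i hi
        rw [eb, hb3] at hi
        rw [eb, eτ, hb3]
        split_ifs at hi ⊢ with h1
        · exact ⟨x', hxH', hxK', hxN'.ne, rfl, h1.symm⟩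
        · obtain ⟨z, hz, hzK, hzx, hzi, hzd⟩ := hinv'.bucket_mem i hi
          exact ⟨z, hz, hzK, (hinv'.forest.lt z hz).ne, hzi, hzd⟩
      · intro i hi
        rw [eb, hb3] at hi
        split_ifs at hi with h1
        · rw [h1]; exact hm2
        · exact (hinv'.lt_max i hi).trans_le hm1
    have ed3 : σ3.nat deg (σ3.nat fx 0 0) 0 = (heapData σ2).deg x' := rfl
    have em3 : σ3.nat maxRank 0 0 = σ2.nat maxRank 0 0 := rfl
    constructor
    · intro hlt
      simp only [BExp.holds, NExp.eval_get, NExp.eval_zero, NExp.eval_add, NExp.eval_one,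
        ed3, em3] at hlt
      rw [runs_setN]
      set σ4 := Store.setNat _ maxRank _ _ _ with hσ4
      have e4 : heapData σ4 = heapData σ2 := by
        rw [← e3]
        exact heapData_congr (by rfl) (by rfl) (by rfl) (by rfl) (by rfl)
      have em4 : σ4.nat maxRank 0 0 = (heapData σ2).deg x' + 1 := rfl
      refine ⟨K', main σ4 e4 hinv'.top rfl rfl (by omega) (by omega) ?_, ?_⟩
      · have := hinv'.forest.deg_le hinv'.links hxH'
        omega
      · rw [e4]
        simp only [BExp.time, NExp.time_get, NExp.time_zero, NExp.time_sub,
          NExp.time_one, NExp.time_add] at hk ⊢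
        omega
    · intro hlt
      simp only [BExp.holds, NExp.eval_get, NExp.eval_zero, NExp.eval_add, NExp.eval_one,
        ed3, em3] at hlt
      rw [runs_skip]
      refine ⟨K', main σ3 e3 hinv'.top rfl rfl le_rfl (by omega) hinv'.max_le, ?_⟩
      rw [e3]
      simp only [BExp.time, NExp.time_get, NExp.time_zero, NExp.time_sub,
        NExp.time_one, NExp.time_add] at hk ⊢
      omega

/-- The invariant of the loop that restores the roots and finds the minimum. -/
structure CollectInv (N : ℕ) (H : Finset ℕ) (M : ℕ) (key : ℕ → ℝ) (i k : ℕ) (σ : Store) :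
    Prop where
  inv : ∃ K, FindInv N H K N key σ ∧
    (σ.nat best 0 0 = 0 ∧ (∀ x ∈ K, (heapData σ).hpar x ≠ N) ∨
      ∃ r ∈ K, σ.nat best 0 0 = r + 1 ∧ ∀ x ∈ K, (heapData σ).hpar x = N → key r ≤ key x)
  empty : ∀ j < i, σ.nat .bucket j 0 = 0
  max : σ.nat maxRank 0 0 = M
  paid : (M - i) * 2000 + (heapData σ).deg N * 1000 ≤ k

theorem collect_paid_step {M i k d : ℕ} (hk : (M - i) * 2000 + d * 1000 ≤ k) (hi : i < M) :
    (M - (i + 1)) * 2000 + d * 1000 ≤ k - 2000 ∧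
    (M - (i + 1)) * 2000 + (d + 1) * 1000 ≤ k - 1000 := by
  omega

theorem collect_step {N : ℕ} {H : Finset ℕ} {M : ℕ} {key : ℕ → ℝ} {i k : ℕ} {σ : Store}
    (h : CollectInv N H M key i k σ) (hi : σ.nat fr 0 0 = i) (hiM : i < M) :
    Runs (when (.neN (bucket.ix fr.val) 0) (block [
    fx.put (bucket.ix fr.val - 1),
    bucket.put1 fr.val 0,
    attach n.val fx.val,
    .ite (.eqN best.val 0) (best.put (fx.val + 1))
      (when (.ltR (RVar.key.ix fx.val) (RVar.key.ix (best.val - 1))) (best.put (fx.val + 1)))]))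
    σ (fun τ t => ∃ k', CollectInv N H M key (i + 1) k' τ ∧ t + k' + 50 ≤ k) := by
  obtain ⟨⟨K, hinv, hbest⟩, hemp, hM, hk⟩ := h
  rw [when, runs_ite]
  simp only [BExp.holds, NExp.eval_get, NExp.eval_zero, hi]
  constructor
  swap
  · intro hb
    rw [not_not] at hb
    rw [runs_skip]
    refine ⟨k - 2000, ⟨⟨K, hinv, hbest⟩, ?_, hM, ?_⟩, ?_⟩
    · intro j hj
      rcases Nat.lt_succ_iff_lt_or_eq.1 hj with h1 | h1
      · exact hemp j h1
      · rw [h1, hb]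
    · exact (collect_paid_step hk hiM).1
    · simp only [BExp.time, NExp.time_get, NExp.time_zero]
      omega
  intro hb
  obtain ⟨x, hx, hxK, hxN, hxi, hxd⟩ := hinv.bucket_mem i hb
  have hxp := hinv.root hx hxK
  rw [runs_block_cons, runs_setN, runs_block_cons, runs_setN, runs_block_cons]
  set σ1 := Store.setNat _ .bucket _ _ _ with hσ1
  have e1 : heapData σ1 = heapData σ := heapData_congr (by rfl) (by rfl) (by rfl) (by rfl) (by rfl)
  have ex1 : σ1.nat fx 0 0 = x := by
    change σ.nat .bucket (σ.nat fr 0 0) 0 - 1 = x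
    rw [hi, hxi]; rfl
  have en1 : σ1.nat n 0 0 = N := hinv.top
  have hb1 : ∀ j, σ1.nat .bucket j 0 = if j = i then 0 else σ.nat .bucket j 0 := by
    intro j
    simp [hσ1, hi]
  refine (attach_runs σ1 n fx (by decide) (by decide)).mono_frame ?_
  rintro σ2 t2 ⟨e2, ht2⟩ f2
  rw [e1, en1, ex1] at e2
  have ex2 : σ2.nat fx 0 0 = x := by rw [f2.1 fx rfl, ex1]
  have ebest2 : σ2.nat best 0 0 = σ.nat best 0 0 := by rw [f2.1 best rfl]; rfl
  have ek2 : ∀ z, σ2.real .key z 0 = key z := fun z => by rw [f2.2 .key rfl]; exact hinv.key_eq z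
  have hb2 : ∀ j, σ2.nat .bucket j 0 = if j = i then 0 else σ.nat .bucket j 0 := by
    intro j; rw [f2.1 .bucket rfl, hb1]
  have ehp : (heapData σ2).hpar = (heapData σ).hpar := by
    rw [e2]
    simp only [HeapData.attach, ← hxp, Function.update_eq_self]
  have hdz : ∀ z ∈ H, (heapData σ2).deg z = (heapData σ).deg z := by
    intro z hz
    rw [e2]
    simp only [HeapData.attach, Function.update_of_ne (hinv.forest.lt z hz).ne]
  have hinv2 : FindInv N H (insert x K) N key σ2 := by
    refine ⟨by rw [f2.1 n rfl, en1], ?_, ?_, by rw [ehp]; exact hinv.order, ek2, ?_, ?_, ?_, ?_⟩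
    · rw [e2]; exact hinv.links.attach hxK
    · rw [e2]
      have := hinv.forest.attachRoot (hinv.forest.lt x hx) hxK
      rwa [Finset.insert_eq_of_mem hx] at this
    · intro z hz hzK _
      have hzx : z ≠ x := fun h1 => hzK (h1 ▸ Finset.mem_insert_self _ _)
      have h1 := hinv.stored z hz (fun h1 => hzK (Finset.mem_insert_of_mem h1))
        (hinv.forest.lt z hz).ne
      rw [hdz z hz, hb2, if_neg, h1]
      intro h2
      rw [h2, hxi] at h1
      omega
    · intro j hj
      rw [hb2] at hj ⊢
      split_ifs at hj ⊢ with h1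
      · exact absurd rfl hj
      · obtain ⟨z, hz, hzK, hzN, hzj, hzd⟩ := hinv.bucket_mem j hj
        refine ⟨z, hz, ?_, hzN, hzj, by rw [hdz z hz, hzd]⟩
        have : z ≠ x := by
          rintro rfl
          exact h1 (by rw [← hzd, hxd])
        simp [this, hzK]
    · intro j hj
      rw [hb2] at hj
      rw [f2.1 maxRank rfl]
      split_ifs at hj with h1
      · exact absurd rfl hj
      · exact hinv.lt_max j hj
    · rw [f2.1 maxRank rfl]; exact hinv.max_le
  have hdegN : (heapData σ2).deg N = (heapData σ).deg N + 1 := by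
    rw [e2]; simp [HeapData.attach]
  have main : ∀ τ : Store, heapData τ = heapData σ2 → τ.nat n = σ2.nat n →
      τ.nat .bucket = σ2.nat .bucket → τ.nat maxRank = σ2.nat maxRank →
      τ.real .key = σ2.real .key →
      (∃ r ∈ insert x K, τ.nat best 0 0 = r + 1 ∧ ∀ z ∈ insert x K,
        (heapData σ).hpar z = N → key r ≤ key z) →
      CollectInv N H M key (i + 1) (k - 1000) τ := by
    intro τ eτ en eb em ek hbest'
    refine ⟨⟨insert x K, ?_, .inr ?_⟩, ?_, ?_, ?_⟩
    · refine ⟨by rw [en]; exact hinv2.top, by rw [eτ]; exact hinv2.links,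
        by rw [eτ]; exact hinv2.forest, by rw [eτ]; exact hinv2.order,
        by rw [ek]; exact hinv2.key_eq, by rw [eτ, eb]; exact hinv2.stored,
        by rw [eτ, eb]; exact hinv2.bucket_mem, by rw [eb, em]; exact hinv2.lt_max,
        by rw [em]; exact hinv2.max_le⟩
    · rw [eτ, ehp]; exact hbest'
    · intro j hj
      rw [eb, hb2]
      split_ifs with h1
      · rfl
      · exact hemp j (by omega)
    · rw [em, f2.1 maxRank rfl]; exact hM
    · rw [eτ, hdegN]
      exact (collect_paid_step hk hiM).2
  rw [runs_block_single, runs_ite]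
  simp only [BExp.holds, NExp.eval_get, NExp.eval_zero, ebest2]
  constructor
  · intro h0
    rw [runs_setN]
    set σ3 := Store.setNat _ best _ _ _ with hσ3
    refine ⟨k - 1000, main σ3 (heapData_congr rfl rfl rfl rfl rfl) rfl rfl rfl rfl
      ⟨x, Finset.mem_insert_self _ _, ?_, ?_⟩, ?_⟩
    · change σ2.nat fx 0 0 + 1 = _
      rw [ex2]
    · intro z hz hzN
      rcases Finset.mem_insert.1 hz with rfl | hz
      · exact le_rfl
      · rcases hbest with ⟨-, h1⟩ | ⟨r, -, h1, -⟩
        · exact absurd hzN (h1 z hz)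
        · omega
    · simp only [BExp.time, NExp.time_get, NExp.time_zero, NExp.time_sub,
          NExp.time_one, NExp.time_add]
      clear hbest
      omega
  · intro h0
    obtain ⟨r, hrK, hr, hrmin⟩ : ∃ r ∈ K, σ.nat best 0 0 = r + 1 ∧ ∀ x ∈ K,
        (heapData σ).hpar x = N → key r ≤ key x := by
      rcases hbest with ⟨h1, -⟩ | h1
      · exact absurd h1 h0
      · exact h1
    rw [when, runs_ite]
    simp only [BExp.holds, RExp.eval_get, NExp.eval_get, NExp.eval_zero, NExp.eval_sub,
      NExp.eval_one, ebest2, hr, ex2, ek2, Nat.add_sub_cancel]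
    constructor
    · intro hlt
      rw [runs_setN]
      set σ3 := Store.setNat _ best _ _ _ with hσ3
      refine ⟨k - 1000, main σ3 (heapData_congr rfl rfl rfl rfl rfl) rfl rfl rfl rfl
        ⟨x, Finset.mem_insert_self _ _, ?_, ?_⟩, ?_⟩
      · change σ2.nat fx 0 0 + 1 = _
        rw [ex2]
      · intro z hz hzN
        rcases Finset.mem_insert.1 hz with rfl | hz
        · exact le_rfl
        · exact hlt.le.trans (hrmin z hz hzN)
      · simp only [BExp.time, RExp.time_get, NExp.time_get, NExp.time_zero, NExp.time_sub,
          NExp.time_one, NExp.time_add]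
        clear hbest
        omega
    · intro hlt
      rw [runs_skip]
      refine ⟨k - 1000, main σ2 rfl rfl rfl rfl rfl
        ⟨r, Finset.mem_insert_of_mem hrK, ?_, ?_⟩, ?_⟩
      · rw [ebest2, hr]
      · intro z hz hzN
        rcases Finset.mem_insert.1 hz with rfl | hz
        · exact not_lt.1 hlt
        · exact hrmin z hz hzN
      · simp only [BExp.time, RExp.time_get, NExp.time_get, NExp.time_zero, NExp.time_sub,
          NExp.time_one]
        clear hbest
        omega

theorem heapFindMin_runs {N : ℕ} {H : Finset ℕ} {σ : Store} (h : Heap N H σ) :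
    Runs heapFindMin σ (fun τ t => Heap N H τ ∧
      (τ.nat best 0 0 = 0 ∧ H = ∅ ∨ ∃ r ∈ H, τ.nat best 0 0 = r + 1 ∧
        ∀ x ∈ H, σ.real .key r 0 ≤ σ.real .key x 0) ∧
      t + 1000 * pot τ ≤ 1000 * pot σ + 10000 * (Nat.log 2 N + 1)) := by
  obtain ⟨hN, ⟨hl, hf, hord⟩, hb, hi⟩ := h
  set kf : ℕ → ℝ := fun x => σ.real .key x 0 with hkf
  rw [heapFindMin, runs_block_cons, runs_setN, runs_block_cons]
  set σ1 := Store.setNat _ maxRank _ _ _ with hσ1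
  have e1 : heapData σ1 = heapData σ := heapData_congr (by rfl) (by rfl) (by rfl) (by rfl) (by rfl)
  have hinv1 : FindInv N H H N kf σ1 := by
    refine ⟨hN, by rwa [e1], by rwa [e1], by rwa [e1], fun _ => rfl, ?_, ?_, ?_, Nat.zero_le _⟩
    · intro y hy hy'
      exact absurd hy hy'
    · intro i hi'
      exact absurd (hb i) hi'
    · intro i hi'
      exact absurd (hb i) hi'
  refine (Runs.loop (fun k σ' => ∃ K, FindInv N H K N kf σ' ∧
    600 * (heapData σ').deg N + 300 * (H \ K).card ≤ k) ?_
    (k := 600 * (heapData σ).deg N) (σ := σ1) ?_).mono_frame ?_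
  · rintro k σ' ⟨K, hinv, hk⟩ hb'
    simp only [BExp.holds, NExp.eval_get, NExp.eval_zero, hinv.top] at hb'
    refine (consolidate_step hinv hb').mono ?_
    rintro τ t ⟨K', h1, h2⟩
    refine ⟨_, ⟨K', h1, le_rfl⟩, ?_⟩
    simp only [BExp.time, NExp.time_get, NExp.time_zero]
    omega
  · exact ⟨H, hinv1, by rw [e1]; simp⟩
  rintro σ2 t2 ⟨k', ⟨K, hinv2, hk2⟩, hb2, hk2'⟩ f2
  simp only [BExp.holds, NExp.eval_get, NExp.eval_zero, hinv2.top, not_lt, Nat.le_zero] at hb2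
  change (heapData σ2).deg N = 0 at hb2
  rw [runs_block_cons, runs_setN, runs_block_single]
  set σ3 := Store.setNat _ best _ _ _ with hσ3
  have hnoroot : ∀ x ∈ K, (heapData σ2).hpar x ≠ N := by
    intro x hx hxN
    have := hinv2.links.pos_lt x hx
    rw [hxN, hb2] at this
    exact Nat.not_lt_zero _ this
  set M := σ2.nat maxRank 0 0 with hM
  refine (Runs.forUpTo (A := fr) (e := maxRank.val) M (fun i k σ' => CollectInv N H M kf i k σ') (k := 2000 * M) ?_ rfl
    (fun i k σ' h => h.max) ?_).mono_frame ?_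
  · refine ⟨⟨K, ?_, .inl ⟨rfl, hnoroot⟩⟩, fun j hj => absurd hj (Nat.not_lt_zero _), rfl, ?_⟩
    · exact ⟨hinv2.top, hinv2.links, hinv2.forest, hinv2.order, hinv2.key_eq, hinv2.stored,
        hinv2.bucket_mem, hinv2.lt_max, hinv2.max_le⟩
    · change (M - 0) * 2000 + (heapData σ2).deg N * 1000 ≤ _
      omega
  · intro i k σ' hiM hinv hi'
    refine (collect_step hinv hi' hiM).mono ?_
    rintro τ t ⟨k', ⟨⟨K', hinv', hbest'⟩, h2, h3, h4⟩, hk⟩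
    refine ⟨k', ⟨⟨K', ?_, hbest'⟩, h2, h3, h4⟩, ?_⟩
    · exact ⟨hinv'.top, hinv'.links, hinv'.forest, hinv'.order, hinv'.key_eq, hinv'.stored,
        hinv'.bucket_mem, hinv'.lt_max, hinv'.max_le⟩
    · simp only [NExp.time_get, NExp.time_zero]
      omega
  · rintro τ t ⟨k4, ⟨⟨K', hinv, hbest⟩, hemp, hmax, hk4⟩, hk4'⟩ f4
    have hb4 : ∀ i, τ.nat .bucket i 0 = 0 := by
      intro i
      by_contra h1
      have := hinv.lt_max i h1
      exact h1 (hemp i (by omega))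
    have hKH : K' = H := by
      refine Finset.Subset.antisymm hinv.forest.sub fun y hy => ?_
      by_contra hyK
      have := hinv.stored y hy hyK (hinv.forest.lt y hy).ne
      rw [hb4] at this
      omega
    subst hKH
    have hmark : (heapData τ).mark = (heapData σ).mark := by
      funext x
      change τ.nat mark x 0 = σ.nat mark x 0
      rw [f4.1 mark rfl]
      change σ2.nat mark x 0 = _
      rw [f2.1 mark rfl]
      rfl
    have ekey : ∀ y, τ.real .key y 0 = kf y := hinv.key_eq
    refine ⟨⟨hinv.top, ⟨hinv.links, hinv.forest, ?_⟩, hb4, ?_⟩, ?_, ?_⟩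
    · intro y hy hyN
      rw [ekey, ekey]
      exact hinv.order y hy hyN
    · intro x
      rw [f4.1 inHeap rfl]
      change σ2.nat inHeap x 0 = _
      rw [f2.1 inHeap rfl]
      exact hi x
    · rcases hbest with ⟨h1, h2⟩ | ⟨r, hr, h1, h2⟩
      · left
        refine ⟨h1, ?_⟩
        by_contra h3
        obtain ⟨r, hr, hrN, -⟩ := hinv.forest.exists_root hinv.order (Finset.nonempty_iff_ne_empty.2 h3)
        exact h2 r hr hrN
      · right
        refine ⟨r, hr, h1, fun x hx => ?_⟩
        obtain ⟨r', hr', hrN', hmin⟩ := hinv.forest.exists_root hinv.order ⟨x, hx⟩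
        exact (h2 r' hr' hrN').trans (hmin x hx)
    · have h5 := hinv2.max_le
      simp only [pot, HeapData.potential, hmark, hinv.top, hN]
      simp only [BExp.time, NExp.time_get, NExp.time_zero] at hk2' hk4' ⊢
      omega


namespace ParamGraph

/-! ## Walks and parent trees -/

variable {n m : ℕ} {G : ParamGraph n m}

theorem isWalk_append {u v : Fin n} {p q : List (Fin m)} :
    G.IsWalk u (p ++ q) v ↔ ∃ w, G.IsWalk u p w ∧ G.IsWalk w q v := by
  induction p generalizing u with
  | nil => simp [IsWalk]
  | cons e p ih => simp [IsWalk, ih, and_assoc]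

theorem isWalk_singleton {u v : Fin n} {e : Fin m} :
    G.IsWalk u [e] v ↔ G.src e = u ∧ G.tgt e = v := by
  simp [IsWalk]

theorem isWalk_concat {u v : Fin n} {p : List (Fin m)} {e : Fin m} :
    G.IsWalk u (p ++ [e]) v ↔ G.IsWalk u p (G.src e) ∧ G.tgt e = v := by
  rw [isWalk_append]
  constructor
  · rintro ⟨w, h1, h2⟩
    obtain ⟨rfl, h3⟩ := isWalk_singleton.1 h2
    exact ⟨h1, h3⟩
  · rintro ⟨h1, h2⟩
    exact ⟨_, h1, isWalk_singleton.2 ⟨rfl, h2⟩⟩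

theorem IsWalk.unique {u v w : Fin n} {p : List (Fin m)} (h : G.IsWalk u p v)
    (h' : G.IsWalk u p w) : v = w := by
  induction p generalizing u with
  | nil => exact Eq.trans (Eq.symm h) h'
  | cons e p ih => exact ih h.2 h'.2

@[simp] theorem pathCost_append (p q : List (Fin m)) :
    G.pathCost (p ++ q) = G.pathCost p + G.pathCost q := by
  simp [pathCost]

@[simp] theorem pathParam_append (p q : List (Fin m)) :
    G.pathParam (p ++ q) = G.pathParam p + G.pathParam q := by
  simp [pathParam]

@[simp] theorem pathParam_nil : G.pathParam [] = 0 := rfl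
@[simp] theorem pathCost_nil : G.pathCost [] = 0 := rfl
@[simp] theorem pathCost_singleton (e : Fin m) : G.pathCost [e] = G.cost e := by simp [pathCost]
@[simp] theorem pathParam_singleton (e : Fin m) :
    G.pathParam [e] = if e ∈ G.param then 1 else 0 := by
  simp [pathParam, List.countP_singleton]

@[simp] theorem costAt_nil (r : ℝ) : G.costAt r [] = 0 := by simp [costAt]

theorem costAt_append (r : ℝ) (p q : List (Fin m)) :
    G.costAt r (p ++ q) = G.costAt r p + G.costAt r q := by
  simp only [costAt, pathCost_append, pathParam_append, Nat.cast_add]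
  ring

theorem pathParam_le_length (p : List (Fin m)) : G.pathParam p ≤ p.length :=
  List.countP_le_length

theorem noLonger_bot {p q : List (Fin m)} : G.NoLonger ⊥ p q ↔
    G.pathParam p < G.pathParam q ∨
      (G.pathParam p = G.pathParam q ∧ G.pathCost p ≤ G.pathCost q) := Iff.rfl

theorem noLonger_top {p q : List (Fin m)} : G.NoLonger ⊤ p q ↔
    G.pathParam q < G.pathParam p ∨
      (G.pathParam p = G.pathParam q ∧ G.pathCost p ≤ G.pathCost q) := Iff.rfl

theorem noLonger_coe {r : ℝ} {p q : List (Fin m)} :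
    G.NoLonger r p q ↔ G.costAt r p ≤ G.costAt r q := Iff.rfl

theorem NoLonger.refl (x : EReal) (p : List (Fin m)) : G.NoLonger x p p := by
  induction x using EReal.rec with
  | bot => exact .inr ⟨rfl, le_rfl⟩
  | coe r => exact le_rfl
  | top => exact .inr ⟨rfl, le_rfl⟩

theorem NoLonger.trans {x : EReal} {p q s : List (Fin m)} (h : G.NoLonger x p q)
    (h' : G.NoLonger x q s) : G.NoLonger x p s := by
  induction x using EReal.rec with
  | bot =>
    rw [noLonger_bot] at *
    rcases h with h | ⟨h1, h2⟩ <;> rcases h' with h' | ⟨h1', h2'⟩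
    · left; omega
    · left; omega
    · left; omega
    · right; exact ⟨by omega, h2.trans h2'⟩
  | coe r => exact le_trans h h'
  | top =>
    rw [noLonger_top] at *
    rcases h with h | ⟨h1, h2⟩ <;> rcases h' with h' | ⟨h1', h2'⟩
    · left; omega
    · left; omega
    · left; omega
    · right; exact ⟨by omega, h2.trans h2'⟩

theorem NoLonger.append_right {x : EReal} {p q : List (Fin m)} (h : G.NoLonger x p q)
    (s : List (Fin m)) : G.NoLonger x (p ++ s) (q ++ s) := by
  induction x using EReal.rec with
  | bot =>
    rw [noLonger_bot] at *
    simp only [pathCost_append, pathParam_append]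
    rcases h with h | ⟨h1, h2⟩
    · left; omega
    · right; exact ⟨by omega, by linarith⟩
  | coe r =>
    rw [noLonger_coe] at *
    rw [costAt_append, costAt_append]
    linarith
  | top =>
    rw [noLonger_top] at *
    simp only [pathCost_append, pathParam_append]
    rcases h with h | ⟨h1, h2⟩
    · left; omega
    · right; exact ⟨by omega, by linarith⟩

/-- The parent edges `par` (edge `e` is represented by `e + 1`) form a tree with vertex set `R`
directed away from the source, and `t v` is the path to `v` in this tree. -/
structure ParentTree (G : ParamGraph n m) (R : Set (Fin n)) (par : Fin n → ℕ)
    (t : Fin n → List (Fin m)) : Prop where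
  source_mem : G.source ∈ R
  source_par : par G.source = 0
  source_path : t G.source = []
  parent : ∀ v ∈ R, v ≠ G.source →
    ∃ e : Fin m, par v = e + 1 ∧ G.tgt e = v ∧ G.src e ∈ R ∧ t v = t (G.src e) ++ [e]

namespace ParentTree

variable {R : Set (Fin n)} {par : Fin n → ℕ} {t : Fin n → List (Fin m)}

theorem isWalk (h : G.ParentTree R par t) {v : Fin n} (hv : v ∈ R) :
    G.IsWalk G.source (t v) v := by
  induction hl : (t v).length using Nat.strong_induction_on generalizing v with
  | _ l ih =>
    by_cases hs : v = G.source
    · rw [hs, h.source_path]; exact rfl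
    · obtain ⟨e, -, he, hR, ht⟩ := h.parent v hv hs
      rw [ht, isWalk_concat]
      exact ⟨ih _ (by rw [← hl, ht]; simp) hR rfl, he⟩

theorem of_parent (h : G.ParentTree R par t) {e : Fin m} (he : G.tgt e ∈ R)
    (hp : par (G.tgt e) = e + 1) : G.src e ∈ R ∧ t (G.tgt e) = t (G.src e) ++ [e] := by
  by_cases hs : G.tgt e = G.source
  · rw [hs, h.source_par] at hp
    omega
  · obtain ⟨e', h1, -, h3, h4⟩ := h.parent _ he hs
    obtain rfl : e' = e := Fin.ext (by omega)
    exact ⟨h3, h4⟩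

theorem eq_of_isWalk (h : G.ParentTree R par t) {v w : Fin n} (hv : v ∈ R) {a b : List (Fin m)}
    (hab : t v = a ++ b) (hw : G.IsWalk G.source a w) : w ∈ R ∧ t w = a := by
  induction b using List.reverseRecOn generalizing v with
  | nil =>
    rw [List.append_nil] at hab
    have := h.isWalk hv
    rw [hab] at this
    obtain rfl := this.unique hw
    exact ⟨hv, hab⟩
  | append_singleton b e ih =>
    have hs : v ≠ G.source := by
      rintro rfl
      rw [h.source_path] at hab
      simp at hab
    obtain ⟨e', -, -, hR, ht⟩ := h.parent v hv hs
    rw [ht, ← List.append_assoc] at hab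
    exact ih hR (List.append_inj' hab rfl).1

theorem exists_prefix (h : G.ParentTree R par t) {v : Fin n} (hv : v ∈ R) {a b : List (Fin m)}
    (hab : t v = a ++ b) : ∃ w ∈ R, t w = a ∧ G.IsWalk G.source a w ∧ G.IsWalk w b v := by
  have := h.isWalk hv
  rw [hab, isWalk_append] at this
  obtain ⟨w, h1, h2⟩ := this
  obtain ⟨h3, h4⟩ := h.eq_of_isWalk hv hab h1
  exact ⟨w, h3, h4, h1, h2⟩

theorem length_lt (h : G.ParentTree R par t) {v : Fin n} (hv : v ∈ R) : (t v).length < n := by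
  have hex : ∀ i : Fin ((t v).length + 1), ∃ w, t w = (t v).take i := fun i => by
    obtain ⟨w, -, hw, -⟩ := h.exists_prefix hv (List.take_append_drop i (t v)).symm
    exact ⟨w, hw⟩
  choose f hf using hex
  have hinj : Function.Injective f := by
    intro i j hij
    have h1 := congrArg List.length (hf i)
    have h2 := congrArg List.length (hf j)
    rw [hij] at h1
    simp only [List.length_take] at h1 h2
    have := i.2
    have := j.2
    exact Fin.ext (by omega)
  have := Fintype.card_le_of_injective f hinj
  simp only [Fintype.card_fin] at this
  omega

theorem mem_parent (h : G.ParentTree R par t) {v : Fin n} (hv : v ∈ R) {e : Fin m}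
    (he : e ∈ t v) : G.tgt e ∈ R ∧ par (G.tgt e) = e + 1 ∧ t (G.tgt e) <+: t v := by
  obtain ⟨a, b, hab⟩ := List.append_of_mem he
  have hab' : t v = (a ++ [e]) ++ b := by simp [hab]
  obtain ⟨w, hw, htw, hwa, -⟩ := h.exists_prefix hv hab'
  obtain rfl := (isWalk_concat.1 hwa).2
  have hs : G.tgt e ≠ G.source := by
    intro hs
    rw [hs, h.source_path] at htw
    simp at htw
  obtain ⟨e', h1, -, -, h4⟩ := h.parent _ hw hs
  rw [h4] at htw
  obtain rfl : e' = e := by simpa using (List.append_inj' htw rfl).2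
  exact ⟨hw, h1, by rw [h4, htw, hab']; exact List.prefix_append _ _⟩

theorem not_mem_src (h : G.ParentTree R par t) {e : Fin m} (he : G.src e ∈ R) :
    e ∉ t (G.src e) := by
  intro hmem
  obtain ⟨a, b, hab⟩ := List.append_of_mem hmem
  have hw := h.isWalk he
  rw [hab, isWalk_append] at hw
  obtain ⟨w, h1, h2⟩ := hw
  obtain rfl : G.src e = w := h2.1
  have h3 := (h.eq_of_isWalk he hab h1).2
  rw [h3] at hab
  simpa using congrArg List.length hab

theorem nodup (h : G.ParentTree R par t) {v : Fin n} (hv : v ∈ R) : (t v).Nodup := by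
  induction hl : (t v).length using Nat.strong_induction_on generalizing v with
  | _ l ih =>
    by_cases hs : v = G.source
    · rw [hs, h.source_path]; exact List.nodup_nil
    · obtain ⟨e, -, he, hR, ht⟩ := h.parent v hv hs
      rw [ht, ← List.concat_eq_append]
      exact (ih _ (by rw [← hl, ht]; simp) hR rfl).concat (h.not_mem_src hR)

theorem nodup_concat (h : G.ParentTree R par t) {e : Fin m} (he : G.src e ∈ R) :
    (t (G.src e) ++ [e]).Nodup := by
  rw [← List.concat_eq_append]
  exact (h.nodup he).concat (h.not_mem_src he)

theorem injOn (h : G.ParentTree R par t) {v w : Fin n} (hv : v ∈ R) (hw : w ∈ R)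
    (hvw : t v = t w) : v = w := by
  have h1 := h.isWalk hv
  rw [hvw] at h1
  exact h1.unique (h.isWalk hw)

end ParentTree

open Classical in
/-- The paths after `p` has become the path into `v`. -/
noncomputable def rehang (R : Set (Fin n)) (t : Fin n → List (Fin m)) (v : Fin n)
    (p : List (Fin m)) (w : Fin n) : List (Fin m) :=
  if w = v then p
  else if v ∈ R ∧ t v <+: t w then p ++ (t w).drop (t v).length else t w

theorem rehang_self (R : Set (Fin n)) (t : Fin n → List (Fin m)) (v : Fin n) (p : List (Fin m)) :
    rehang R t v p v = p := if_pos rfl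

theorem rehang_of_not {R : Set (Fin n)} {t : Fin n → List (Fin m)} {v w : Fin n}
    {p : List (Fin m)} (hwv : w ≠ v) (h : ¬ (v ∈ R ∧ t v <+: t w)) : rehang R t v p w = t w := by
  rw [rehang, if_neg hwv, if_neg h]

theorem rehang_of_prefix {R : Set (Fin n)} {t : Fin n → List (Fin m)} {v w : Fin n}
    {p s : List (Fin m)} (hv : v ∈ R) (h : t w = t v ++ s) (hwv : w = v → s = []) :
    rehang R t v p w = p ++ s := by
  by_cases hw : w = v
  · rw [hwv hw, hw, rehang_self, List.append_nil]
  · rw [rehang, if_neg hw, if_pos ⟨hv, h ▸ List.prefix_append _ _⟩, h, List.drop_left]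

namespace ParentTree

variable {R : Set (Fin n)} {par : Fin n → ℕ} {t : Fin n → List (Fin m)}

theorem hang (h : G.ParentTree R par t) {e : Fin m} (he : G.src e ∈ R)
    (hs : G.tgt e ≠ G.source) (hnot : ¬ (G.tgt e ∈ R ∧ t (G.tgt e) <+: t (G.src e))) :
    G.ParentTree (insert (G.tgt e) R) (Function.update par (G.tgt e) (e + 1))
      (rehang R t (G.tgt e) (t (G.src e) ++ [e])) := by
  set v := G.tgt e with hv
  set p := t (G.src e) ++ [e] with hp
  have hsv : G.src e ≠ v := by
    intro h1
    exact hnot ⟨h1 ▸ he, by rw [h1]⟩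
  have hne : v ∈ R → t v ≠ [] := by
    intro hvR h1
    have := h.isWalk hvR
    rw [h1] at this
    exact hs (Eq.symm this)
  refine ⟨Set.mem_insert_of_mem _ h.source_mem, ?_, ?_, ?_⟩
  · rw [Function.update_of_ne hs.symm, h.source_par]
  · rw [rehang_of_not hs.symm, h.source_path]
    rintro ⟨h1, h2⟩
    rw [h.source_path, List.prefix_nil] at h2
    exact hne h1 h2
  · intro w hw hws
    by_cases hwv : w = v
    · refine ⟨e, by rw [hwv, Function.update_self], by rw [hwv], Set.mem_insert_of_mem _ he, ?_⟩
      rw [hwv, rehang_self, rehang_of_not hsv hnot]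
    · have hwR : w ∈ R := by
        rcases hw with h1 | h1
        · exact absurd h1 hwv
        · exact h1
      obtain ⟨e', h1, h2, h3, h4⟩ := h.parent w hwR hws
      refine ⟨e', by rw [Function.update_of_ne hwv, h1], h2, Set.mem_insert_of_mem _ h3, ?_⟩
      have hiff : v ∈ R → (t v <+: t w ↔ t v <+: t (G.src e')) := by
        intro hvR
        rw [h4, List.prefix_concat_iff, ← h4]
        constructor
        · rintro (h5 | h5)
          · exact absurd (h.injOn hvR hwR h5).symm hwv
          · exact h5
        · exact .inr
      by_cases hc : v ∈ R ∧ t v <+: t (G.src e')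
      · obtain ⟨hvR, s, hs'⟩ := hc
        have hs0 : G.src e' = v → s = [] := by
          intro h5
          rw [h5] at hs'
          simpa using hs'
        have hw' : t w = t v ++ (s ++ [e']) := by rw [h4, ← hs', List.append_assoc]
        rw [rehang_of_prefix hvR hw' (fun h5 => absurd h5 hwv),
          rehang_of_prefix hvR hs'.symm hs0]
        simp
      · have hsrc : G.src e' ≠ v := by
          intro h5
          exact hc ⟨h5 ▸ h3, by rw [h5]⟩
        rw [rehang_of_not hwv, rehang_of_not hsrc hc, h4]
        rintro ⟨h5, h6⟩
        exact hc ⟨h5, (hiff h5).1 h6⟩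

end ParentTree

/-- The set of the parent edges. -/
def parentEdges (G : ParamGraph n m) (par : Fin n → ℕ) : Finset (Fin m) :=
  Finset.univ.filter (fun e => par (G.tgt e) = e + 1)

theorem mem_parentEdges {par : Fin n → ℕ} {e : Fin m} :
    e ∈ G.parentEdges par ↔ par (G.tgt e) = e + 1 := by
  simp [parentEdges]

section Univ

variable {par : Fin n → ℕ} {t : Fin n → List (Fin m)}

theorem ParentTree.isTreePath_iff (h : G.ParentTree Set.univ par t) {v : Fin n}
    {p : List (Fin m)} : G.IsTreePath (G.parentEdges par) v p ↔ p = t v := by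
  constructor
  · rintro ⟨hw, hT⟩
    induction p using List.reverseRecOn generalizing v with
    | nil =>
      obtain rfl : G.source = v := hw
      exact h.source_path.symm
    | append_singleton p e ih =>
      obtain ⟨h1, rfl⟩ := isWalk_concat.1 hw
      rw [(h.of_parent (Set.mem_univ _) (mem_parentEdges.1 (hT e (by simp)))).2,
        ← ih h1 fun f hf => hT f (by simp [hf])]
  · rintro rfl
    exact ⟨h.isWalk (Set.mem_univ _),
      fun e he => mem_parentEdges.2 (h.mem_parent (Set.mem_univ _) he).2.1⟩

theorem ParentTree.isTree (h : G.ParentTree Set.univ par t) : G.IsTree (G.parentEdges par) :=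
  fun v => ⟨t v, h.isTreePath_iff.2 rfl, fun _ hp => h.isTreePath_iff.1 hp⟩

/-- No path `t v` can be shortened in `G_x` by replacing its last edge. -/
def EdgeOK (G : ParamGraph n m) (x : EReal) (t : Fin n → List (Fin m)) : Prop :=
  ∀ e, G.NoLonger x (t (G.tgt e)) (t (G.src e) ++ [e])

theorem EdgeOK.noLonger {x : EReal} (ho : G.EdgeOK x t) (hs : t G.source = []) {v : Fin n}
    {q : List (Fin m)} (hq : G.IsWalk G.source q v) : G.NoLonger x (t v) q := by
  induction q using List.reverseRecOn generalizing v with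
  | nil =>
    obtain rfl : G.source = v := hq
    rw [hs]
    exact .refl _ _
  | append_singleton q e ih =>
    obtain ⟨h1, rfl⟩ := isWalk_concat.1 hq
    exact (ho e).trans ((ih h1).append_right [e])

theorem ParentTree.isShortestPathTree (h : G.ParentTree Set.univ par t) {x : EReal}
    (ho : G.EdgeOK x t) : G.IsShortestPathTree x (G.parentEdges par) :=
  ⟨h.isTree, fun v p hp q hq => by
    rw [h.isTreePath_iff.1 hp]
    exact ho.noLonger h.source_path hq⟩

/-- The number of parameterized edges by which the path to the head of `e` grows, if its last
edge is replaced by `e`, is positive. -/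
def Gains (G : ParamGraph n m) (t : Fin n → List (Fin m)) (e : Fin m) : Prop :=
  G.pathParam (t (G.tgt e)) < G.pathParam (t (G.src e) ++ [e])

/-- The key of an edge. -/
noncomputable def ratio (G : ParamGraph n m) (t : Fin n → List (Fin m)) (e : Fin m) : ℝ :=
  (G.pathCost (t (G.src e) ++ [e]) - G.pathCost (t (G.tgt e))) /
    ((G.pathParam (t (G.src e) ++ [e]) : ℝ) - G.pathParam (t (G.tgt e)))

theorem Gains.pos {e : Fin m} (h : G.Gains t e) :
    0 < (G.pathParam (t (G.src e) ++ [e]) : ℝ) - G.pathParam (t (G.tgt e)) := by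
  have : (G.pathParam (t (G.tgt e)) : ℝ) < G.pathParam (t (G.src e) ++ [e]) := by
    exact_mod_cast h
  linarith

theorem Gains.noLonger_iff {e : Fin m} (h : G.Gains t e) {r : ℝ} :
    G.NoLonger r (t (G.tgt e)) (t (G.src e) ++ [e]) ↔ r ≤ G.ratio t e := by
  rw [noLonger_coe, ratio, le_div_iff₀ h.pos, costAt, costAt]
  constructor <;> intro h' <;> linarith

theorem Gains.costAt_eq {e : Fin m} (h : G.Gains t e) :
    G.costAt (G.ratio t e) (t (G.src e) ++ [e]) = G.costAt (G.ratio t e) (t (G.tgt e)) := by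
  have h1 : G.ratio t e * ((G.pathParam (t (G.src e) ++ [e]) : ℝ) - G.pathParam (t (G.tgt e))) =
      G.pathCost (t (G.src e) ++ [e]) - G.pathCost (t (G.tgt e)) := by
    rw [ratio, div_mul_cancel₀ _ h.pos.ne']
  simp only [costAt]
  linarith

theorem EdgeOK.of_le {lam x : EReal} (ho : G.EdgeOK lam t) (hlam : lam ≠ ⊤) (hx : lam ≤ x)
    (hmin : ∀ e, G.Gains t e → x ≤ (G.ratio t e : EReal)) : G.EdgeOK x t := by
  intro e
  by_cases hg : G.Gains t e
  · have h1 := hmin e hg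
    induction x using EReal.rec with
    | bot =>
      obtain rfl : lam = ⊥ := le_bot_iff.1 hx
      exact ho e
    | coe r => exact hg.noLonger_iff.2 (EReal.coe_le_coe_iff.1 h1)
    | top => exact absurd (top_le_iff.1 h1) (EReal.coe_ne_top _)
  · have hg' : G.pathParam (t (G.src e) ++ [e]) ≤ G.pathParam (t (G.tgt e)) := not_lt.1 hg
    have h1 := ho e
    have hlt : G.pathParam (t (G.src e) ++ [e]) < G.pathParam (t (G.tgt e)) ∨
        (G.pathParam (t (G.tgt e)) = G.pathParam (t (G.src e) ++ [e]) ∧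
          G.pathCost (t (G.tgt e)) ≤ G.pathCost (t (G.src e) ++ [e])) := by
      rcases hg'.lt_or_eq with h2 | h2
      · exact .inl h2
      · refine .inr ⟨h2.symm, ?_⟩
        induction lam using EReal.rec with
        | bot =>
          rcases noLonger_bot.1 h1 with h3 | h3
          · omega
          · exact h3.2
        | coe s =>
          rw [noLonger_coe, costAt, costAt, h2] at h1
          linarith
        | top => exact absurd rfl hlam
    induction x using EReal.rec with
    | bot =>
      obtain rfl : lam = ⊥ := le_bot_iff.1 hx
      exact h1
    | coe r =>
      rw [noLonger_coe, costAt, costAt]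
      rcases hlt with h2 | ⟨h2, h3⟩
      · induction lam using EReal.rec with
        | bot =>
          rcases noLonger_bot.1 h1 with h3 | h3 <;> omega
        | coe s =>
          rw [noLonger_coe, costAt, costAt] at h1
          have h4 : s ≤ r := EReal.coe_le_coe_iff.1 hx
          have h5 : (G.pathParam (t (G.src e) ++ [e]) : ℝ) ≤ G.pathParam (t (G.tgt e)) := by
            exact_mod_cast h2.le
          nlinarith
        | top => exact absurd rfl hlam
      · rw [h2]
        linarith
    | top => exact noLonger_top.2 hlt

/-! ## Negative cycles -/

theorem le_add_costAt {D : Fin n → ℝ} {r : ℝ}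
    (hD : ∀ e, D (G.tgt e) ≤ D (G.src e) + G.costAt r [e]) {u v : Fin n} {p : List (Fin m)}
    (hp : G.IsWalk u p v) : D v ≤ D u + G.costAt r p := by
  induction p using List.reverseRecOn generalizing v with
  | nil =>
    obtain rfl : u = v := hp
    simp
  | append_singleton p e ih =>
    obtain ⟨h1, rfl⟩ := isWalk_concat.1 hp
    have := ih h1
    have := hD e
    rw [costAt_append]
    linarith

theorem noNegCycle_of_potential {D : Fin n → ℝ} {r : ℝ}
    (hD : ∀ e, D (G.tgt e) ≤ D (G.src e) + G.costAt r [e]) : G.NoNegCycle r := by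
  intro v p hp
  have := le_add_costAt hD hp
  linarith

theorem EdgeOK.noNegCycle {r : ℝ} (ho : G.EdgeOK r t) : G.NoNegCycle r := by
  refine noNegCycle_of_potential (D := fun v => G.costAt r (t v)) fun e => ?_
  rw [← costAt_append]
  exact ho e

theorem lambdaStar_eq_coe {r : ℝ} (h : G.NoNegCycle r) (h' : ∀ r', r < r' → ¬ G.NoNegCycle r') :
    G.lambdaStar = r := by
  refine IsLUB.sSup_eq ⟨?_, fun b hb => hb ⟨r, h, rfl⟩⟩
  rintro _ ⟨r', hr', rfl⟩
  exact EReal.coe_le_coe_iff.2 (not_lt.1 fun hlt => h' r' hlt hr')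

theorem lambdaStar_eq_top {s : ℝ} (h : ∀ r, s ≤ r → G.NoNegCycle r) : G.lambdaStar = ⊤ := by
  rw [EReal.eq_top_iff_forall_lt]
  intro y
  refine lt_of_lt_of_le (EReal.coe_lt_coe_iff.2 (lt_of_le_of_lt (le_max_left y s)
    (lt_add_one _))) (le_sSup ⟨max y s + 1, h _ ?_, rfl⟩)
  linarith [le_max_right y s]

theorem lambdaStar_eq_bot (h : ∀ r, ¬ G.NoNegCycle r) : G.lambdaStar = ⊥ := by
  have : {r : ℝ | G.NoNegCycle r} = ∅ := Set.eq_empty_of_forall_notMem h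
  rw [lambdaStar, this, Set.image_empty, sSup_empty]

theorem exists_repeated {α : Type*} {p : List α} (h : ¬ p.Nodup) :
    ∃ (a : List α) (e : α) (b c : List α), p = a ++ e :: (b ++ e :: c) := by
  induction p with
  | nil => exact absurd List.nodup_nil h
  | cons x p ih =>
    by_cases hx : x ∈ p
    · obtain ⟨b, c, rfl⟩ := List.append_of_mem hx
      exact ⟨[], x, b, c, rfl⟩
    · obtain ⟨a, e, b, c, rfl⟩ := ih fun hp => h (List.nodup_cons.2 ⟨hx, hp⟩)
      exact ⟨x :: a, e, b, c, rfl⟩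

theorem exists_nodup_negCycle {r : ℝ} {v : Fin n} {p : List (Fin m)} (hp : G.IsWalk v p v)
    (hneg : G.costAt r p < 0) : ∃ (w : Fin n) (q : List (Fin m)), G.IsWalk w q w ∧
      G.costAt r q < 0 ∧ q.Nodup := by
  induction hl : p.length using Nat.strong_induction_on generalizing v p with
  | _ l ih =>
    by_cases hn : p.Nodup
    · exact ⟨v, p, hp, hneg, hn⟩
    · obtain ⟨a, e, b, c, rfl⟩ := exists_repeated hn
      have hassoc : a ++ e :: (b ++ e :: c) = a ++ ((e :: b) ++ (e :: c)) := by simp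
      rw [hassoc] at hp hneg hl
      obtain ⟨w, hw1, hw2⟩ := isWalk_append.1 hp
      obtain ⟨x, hx1, hx2⟩ := isWalk_append.1 hw2
      obtain rfl : G.src e = w := hx1.1
      obtain rfl : G.src e = x := hx2.1
      rw [costAt_append, costAt_append] at hneg
      by_cases h1 : G.costAt r (e :: b) < 0
      · exact ih (e :: b).length (by rw [← hl]; simp; omega) hx1 h1 rfl
      · refine ih (a ++ e :: c).length (by rw [← hl]; simp) (v := v)
          (isWalk_append.2 ⟨_, hw1, hx2⟩) ?_ rfl
        rw [costAt_append]
        linarith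

theorem pathCost_eq_sum {p : List (Fin m)} (hp : p.Nodup) :
    G.pathCost p = ∑ e, if e ∈ p then G.cost e else 0 := by
  rw [pathCost, ← List.sum_toFinset _ hp, Finset.sum_ite, Finset.sum_const_zero, add_zero]
  refine Finset.sum_congr ?_ fun _ _ => rfl
  ext e
  simp

theorem pathCost_sub_le {p q : List (Fin m)} (hp : p.Nodup) (hq : q.Nodup) :
    G.pathCost p - G.pathCost q ≤ ∑ e, |G.cost e| := by
  rw [pathCost_eq_sum hp, pathCost_eq_sum hq, ← Finset.sum_sub_distrib]
  refine Finset.sum_le_sum fun e _ => ?_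
  have h1 := le_abs_self (G.cost e)
  have h2 := neg_abs_le (G.cost e)
  have h3 := abs_nonneg (G.cost e)
  split_ifs <;> linarith

/-- A number that exceeds the absolute value of the cost of each simple path. -/
noncomputable def bigCost (G : ParamGraph n m) : ℝ := 1 + ∑ e, |G.cost e|

theorem not_noNegCycle_of_bigCost (h : ¬ G.NoNegCycle (-G.bigCost)) (r : ℝ) :
    ¬ G.NoNegCycle r := by
  simp only [NoNegCycle, not_forall, not_le] at h
  obtain ⟨v, p, hp, hneg⟩ := h
  obtain ⟨w, q, hq, hneg, hn⟩ := exists_nodup_negCycle hp hneg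
  intro hno
  have h1 := hno w q hq
  have h2 := G.pathCost_sub_le List.nodup_nil hn
  rw [pathCost_nil] at h2
  rw [costAt] at h1 hneg
  have h0 : G.pathParam q = 0 := by
    by_contra h0
    have : (1 : ℝ) ≤ G.pathParam q := by exact_mod_cast Nat.one_le_iff_ne_zero.2 h0
    have h3 : G.bigCost = 1 + ∑ e, |G.cost e| := rfl
    have h4 : 0 ≤ ∑ e, |G.cost e| := Finset.sum_nonneg fun _ _ => abs_nonneg _
    nlinarith
  rw [h0] at h1 hneg
  simp only [Nat.cast_zero, mul_zero, sub_zero] at h1 hneg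
  linarith

theorem ParentTree.edgeOK_bot (h : G.ParentTree Set.univ par t)
    (ho : G.EdgeOK ((-G.bigCost : ℝ) : EReal) t) : G.EdgeOK ⊥ t := by
  intro e
  have h1 := noLonger_coe.1 (ho e)
  have h2 := G.pathCost_sub_le (h.nodup_concat (e := e) (Set.mem_univ _))
    (h.nodup (v := G.tgt e) (Set.mem_univ _))
  rw [costAt, costAt] at h1
  rw [noLonger_bot]
  set P := t (G.src e) ++ [e]
  set Q := t (G.tgt e)
  rcases lt_trichotomy (G.pathParam Q) (G.pathParam P) with h3 | h3 | h3
  · exact .inl h3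
  · refine .inr ⟨h3, ?_⟩
    rw [h3] at h1
    linarith
  · exfalso
    have h4 : (G.pathParam P : ℝ) + 1 ≤ G.pathParam Q := by exact_mod_cast h3
    have h5 : G.bigCost = 1 + ∑ e, |G.cost e| := rfl
    have h6 : 0 ≤ ∑ e, |G.cost e| := Finset.sum_nonneg fun _ _ => abs_nonneg _
    nlinarith

/-! ## Pivots -/

theorem ParentTree.isPivotPath (h : G.ParentTree Set.univ par t) {e : Fin m} (hg : G.Gains t e)
    (ho : G.EdgeOK (G.ratio t e : ℝ) t) :
    G.IsPivotPath (G.parentEdges par) (G.ratio t e) (G.tgt e) (t (G.src e) ++ [e]) := by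
  have hprefix : ∀ a b, t (G.src e) ++ [e] = a ++ b → b ≠ [] →
      ∃ b', b = b' ++ [e] ∧ t (G.src e) = a ++ b' := by
    intro a b hab hb
    obtain ⟨b', f, rfl⟩ : ∃ b' f, b = b' ++ [f] := ⟨_, _, (List.dropLast_concat_getLast hb).symm⟩
    rw [← List.append_assoc] at hab
    obtain ⟨h1, h2⟩ := List.append_inj' hab rfl
    obtain rfl : e = f := by simpa using h2
    exact ⟨b', rfl, h1⟩
  refine ⟨h.isShortestPathTree ho, isWalk_concat.2 ⟨h.isWalk (Set.mem_univ _), rfl⟩, ?_, ?_, ?_, ?_⟩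
  · intro q hq
    have := noLonger_coe.1 (ho.noLonger h.source_path hq)
    rw [noLonger_coe, hg.costAt_eq]
    exact this
  · intro q hq
    rw [h.isTreePath_iff.1 hq]
    exact hg
  · intro a b w hab hb hw q hq
    obtain ⟨b', -, h1⟩ := hprefix a b hab hb
    rw [h.isTreePath_iff.1 hq, (h.eq_of_isWalk (Set.mem_univ _) h1 hw).2]
  · rintro a b c w hab hb hw ⟨-, hp⟩
    have hwalk : G.IsWalk G.source (a ++ b ++ c) (G.tgt e) := by
      rw [← hab]; exact isWalk_concat.2 ⟨h.isWalk (Set.mem_univ _), rfl⟩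
    obtain ⟨y, hy, hyc⟩ := isWalk_append.1 hwalk
    obtain ⟨x, hx, hxb⟩ := isWalk_append.1 hy
    have hxw : x = w := by
      cases b with
      | nil => exact absurd rfl hb
      | cons f b => exact hxb.1.symm.trans hw.1
    subst hxw
    obtain rfl := hw.unique hxb
    by_cases hc : c = []
    · subst hc
      obtain rfl : x = G.tgt e := hyc
      rw [List.append_nil] at hab
      obtain ⟨b', -, h1⟩ := hprefix a b hab hb
      have h2 := (h.eq_of_isWalk (Set.mem_univ _) h1 hx).2
      have h3 : G.pathParam (t (G.tgt e)) < G.pathParam (t (G.src e) ++ [e]) := hg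
      rw [hab, h2, pathParam_append, hp] at h3
      omega
    · obtain ⟨c', -, h1⟩ := hprefix (a ++ b) c hab hc
      have h2 := (h.eq_of_isWalk (Set.mem_univ _) h1 hy).2
      have h3 := (h.eq_of_isWalk (Set.mem_univ _) (by rw [h1, List.append_assoc]) hx).2
      rw [h2] at h3
      exact hb (by simpa using h3)

theorem ParentTree.pivot_eq (h : G.ParentTree Set.univ par t) {e : Fin m}
    (hnot : ¬ t (G.tgt e) <+: t (G.src e)) :
    G.pivot (G.parentEdges par) (t (G.src e) ++ [e]) =
      G.parentEdges (Function.update par (G.tgt e) (e + 1)) := by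
  have hmem := fun f hf => h.mem_parent (v := G.src e) (e := f) (Set.mem_univ _) hf
  ext f
  rw [mem_parentEdges]
  simp only [pivot, Finset.mem_union, Finset.mem_filter, mem_parentEdges, List.mem_toFinset,
    List.mem_map, List.mem_append, List.mem_singleton, not_exists, not_and]
  by_cases hf : G.tgt f = G.tgt e
  · rw [hf, Function.update_self]
    constructor
    · rintro (⟨-, h2⟩ | h1 | h1)
      · exact absurd rfl (h2 e (.inr rfl))
      · have := (hmem f h1).2.2
        rw [hf] at this
        exact absurd this hnot
      · rw [h1]
    · intro h1
      exact .inr (.inr (Fin.ext (by omega)))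
  · rw [Function.update_of_ne hf]
    constructor
    · rintro (⟨h1, -⟩ | h1 | h1)
      · exact h1
      · exact (hmem f h1).2.1
      · exact absurd (by rw [h1]) hf
    · intro h1
      by_cases h2 : ∃ g ∈ t (G.src e), G.tgt g = G.tgt f
      · obtain ⟨g, hg, hgf⟩ := h2
        have h3 := (hmem g hg).2.1
        rw [hgf] at h3
        obtain rfl : f = g := Fin.ext (by omega)
        exact .inr (.inl hg)
      · refine .inl ⟨h1, ?_⟩
        rintro g (hg | rfl) hgf
        · exact h2 ⟨g, hg, hgf⟩
        · exact hf hgf.symm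

theorem ParentTree.not_isTree_pivot (h : G.ParentTree Set.univ par t) {e : Fin m}
    (hg : G.Gains t e) (hpre : t (G.tgt e) <+: t (G.src e)) :
    ¬ G.IsTree (G.pivot (G.parentEdges par) (t (G.src e) ++ [e])) := by
  intro hT
  have h1 : G.IsTreePath (G.pivot (G.parentEdges par) (t (G.src e) ++ [e])) (G.tgt e)
      (t (G.src e) ++ [e]) :=
    ⟨isWalk_concat.2 ⟨h.isWalk (Set.mem_univ _), rfl⟩, fun f hf =>
      Finset.mem_union_right _ (List.mem_toFinset.2 hf)⟩
  have h2 : G.IsTreePath (G.pivot (G.parentEdges par) (t (G.src e) ++ [e])) (G.tgt e)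
      (t (G.tgt e)) :=
    ⟨h.isWalk (Set.mem_univ _), fun f hf => Finset.mem_union_right _
      (List.mem_toFinset.2 (List.mem_append_left _ (hpre.subset hf)))⟩
  have h3 : G.pathParam (t (G.tgt e)) < G.pathParam (t (G.src e) ++ [e]) := hg
  rw [(hT _).unique h1 h2] at h3
  exact lt_irrefl _ h3

theorem ParentTree.not_noNegCycle (h : G.ParentTree Set.univ par t) {e : Fin m}
    (hg : G.Gains t e) (hpre : t (G.tgt e) <+: t (G.src e)) {r : ℝ} (hr : G.ratio t e < r) :
    ¬ G.NoNegCycle r := by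
  obtain ⟨b, hb⟩ := hpre
  intro hno
  obtain ⟨w, -, h1, -, h3⟩ := h.exists_prefix (v := G.src e) (Set.mem_univ _) hb.symm
  obtain rfl := h.injOn (Set.mem_univ _) (Set.mem_univ _) h1
  have h4 := hno (G.tgt e) (b ++ [e]) (isWalk_concat.2 ⟨h3, rfl⟩)
  have h5 : G.costAt r (t (G.src e) ++ [e]) =
      G.costAt r (t (G.tgt e)) + G.costAt r (b ++ [e]) := by
    rw [← hb, List.append_assoc, costAt_append]
  have h6 : G.NoLonger r (t (G.tgt e)) (t (G.src e) ++ [e]) := by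
    rw [noLonger_coe]
    linarith
  exact absurd (hg.noLonger_iff.1 h6) (not_le.2 hr)

open Classical in
theorem pathCost_rehang (v w : Fin n) (p : List (Fin m)) :
    G.pathCost (rehang Set.univ t v p w) =
      if t v <+: t w then G.pathCost (t w) + (G.pathCost p - G.pathCost (t v))
      else G.pathCost (t w) := by
  split_ifs with hpre
  · obtain ⟨s, hs⟩ := hpre
    rw [rehang_of_prefix (s := s) (Set.mem_univ _) hs.symm]
    · rw [← hs, pathCost_append, pathCost_append]
      ring
    · rintro rfl
      simpa using hs
  · rw [rehang_of_not]
    · rintro rfl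
      exact hpre (List.prefix_refl _)
    · exact fun h1 => hpre h1.2

open Classical in
theorem pathParam_rehang (v w : Fin n) {p : List (Fin m)} (hp : G.pathParam (t v) ≤ G.pathParam p) :
    G.pathParam (rehang Set.univ t v p w) =
      if t v <+: t w then G.pathParam (t w) + (G.pathParam p - G.pathParam (t v))
      else G.pathParam (t w) := by
  split_ifs with hpre
  · obtain ⟨s, hs⟩ := hpre
    rw [rehang_of_prefix (s := s) (Set.mem_univ _) hs.symm]
    · rw [← hs, pathParam_append, pathParam_append]
      omega
    · rintro rfl
      simpa using hs
  · rw [rehang_of_not]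
    · rintro rfl
      exact hpre (List.prefix_refl _)
    · exact fun h1 => hpre h1.2

theorem Gains.edgeOK_rehang {e : Fin m} (hg : G.Gains t e)
    (ho : G.EdgeOK (G.ratio t e : ℝ) t) :
    G.EdgeOK (G.ratio t e : ℝ) (ParamGraph.rehang Set.univ t (G.tgt e) (t (G.src e) ++ [e])) := by
  classical
  set t' := ParamGraph.rehang Set.univ t (G.tgt e) (t (G.src e) ++ [e])
  have hc := hg.costAt_eq
  have h1 : ∀ w, G.costAt (G.ratio t e) (t' w) = G.costAt (G.ratio t e) (t w) := by
    intro w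
    have h2 := G.pathCost_rehang (t := t) (G.tgt e) w (t (G.src e) ++ [e])
    have h3 := G.pathParam_rehang (t := t) (G.tgt e) w (p := t (G.src e) ++ [e]) hg.le
    rw [costAt, costAt] at hc ⊢
    rw [h2, h3]
    split_ifs
    · push_cast [hg.le]
      linarith
    · rfl
  intro f
  have := noLonger_coe.1 (ho f)
  rw [noLonger_coe, costAt_append, h1, h1, ← costAt_append]
  exact this

end Univ

end ParamGraph


namespace ParamGraph

/-! ## The Bellman-Ford algorithm: labels -/

/-- The labels of the vertices in the Bellman-Ford algorithm. -/
@[ext]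
structure Labels (n : ℕ) where
  reach : Set (Fin n)
  cst : Fin n → ℝ
  cnt : Fin n → ℕ
  par : Fin n → ℕ

namespace Labels

variable {n m : ℕ} {G : ParamGraph n m} {B : ℝ} {L : Labels n}

/-- The tentative distances in `G_{-B}`. -/
def dist (L : Labels n) (B : ℝ) (v : Fin n) : ℝ := L.cst v + B * L.cnt v

/-- The edge `e` allows to decrease the tentative distance of its head. -/
def Relaxable (G : ParamGraph n m) (B : ℝ) (L : Labels n) (e : Fin m) : Prop :=
  G.src e ∈ L.reach ∧ (G.tgt e ∉ L.reach ∨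
    L.dist B (G.src e) + G.costAt (-B) [e] < L.dist B (G.tgt e))

/-- The labels after the edge `e` has become the parent edge of its head. -/
noncomputable def relax (G : ParamGraph n m) (L : Labels n) (e : Fin m) : Labels n where
  reach := insert (G.tgt e) L.reach
  cst := Function.update L.cst (G.tgt e) (L.cst (G.src e) + G.cost e)
  cnt := Function.update L.cnt (G.tgt e) (L.cnt (G.src e) + if e ∈ G.param then 1 else 0)
  par := Function.update L.par (G.tgt e) (e + 1)

theorem costAt_neg_singleton (e : Fin m) :
    G.costAt (-B) [e] = G.cost e + B * ((if e ∈ G.param then 1 else 0 : ℕ) : ℝ) := by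
  rw [costAt, pathCost_singleton, pathParam_singleton]
  ring

theorem dist_relax (e : Fin m) (v : Fin n) : (L.relax G e).dist B v =
    if v = G.tgt e then L.dist B (G.src e) + G.costAt (-B) [e] else L.dist B v := by
  by_cases h : v = G.tgt e
  · rw [if_pos h, costAt_neg_singleton]
    simp only [dist, relax, h, Function.update_self, Nat.cast_add]
    ring
  · simp only [dist, relax, if_neg h, Function.update_of_ne h]

theorem dist_relax_le {e : Fin m} (he : L.Relaxable G B e) {v : Fin n} (hv : v ∈ L.reach) :
    (L.relax G e).dist B v ≤ L.dist B v := by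
  rw [dist_relax]
  split_ifs with h
  · rcases he.2 with h1 | h1
    · exact absurd (h ▸ hv) h1
    · rw [h]; exact h1.le
  · exact le_rfl

/-- The parent edges form a tree with vertex set `L.reach`; the label of a vertex comes from the
label of its parent, which may have decreased in the meantime. -/
def IsTentative (G : ParamGraph n m) (B : ℝ) (L : Labels n) (t : Fin n → List (Fin m)) : Prop :=
  G.ParentTree L.reach L.par t ∧ L.cst G.source = 0 ∧ L.cnt G.source = 0 ∧
    ∀ e, G.tgt e ∈ L.reach → L.par (G.tgt e) = e + 1 →
      (L.cst (G.tgt e) = L.cst (G.src e) + G.cost e ∧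
        L.cnt (G.tgt e) = L.cnt (G.src e) + if e ∈ G.param then 1 else 0) ∨
      L.dist B (G.src e) + G.costAt (-B) [e] < L.dist B (G.tgt e)

variable {t : Fin n → List (Fin m)}

theorem IsTentative.dist_ge (h : L.IsTentative G B t) {e : Fin m} (he : G.tgt e ∈ L.reach)
    (hp : L.par (G.tgt e) = e + 1) :
    L.dist B (G.src e) + G.costAt (-B) [e] ≤ L.dist B (G.tgt e) := by
  rcases h.2.2.2 e he hp with ⟨h1, h2⟩ | h1
  · rw [dist, dist, h1, h2, costAt_neg_singleton]
    push_cast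
    linarith
  · exact h1.le

theorem IsTentative.dist_prefix (h : L.IsTentative G B t) {u v : Fin n} (hu : u ∈ L.reach)
    (hv : v ∈ L.reach) {b : List (Fin m)} (hb : t u = t v ++ b) :
    L.dist B v + G.costAt (-B) b ≤ L.dist B u := by
  induction b using List.reverseRecOn generalizing u with
  | nil =>
    rw [List.append_nil] at hb
    rw [h.1.injOn hu hv hb]
    simp
  | append_singleton b e ih =>
    have hs : u ≠ G.source := by
      rintro rfl
      rw [h.1.source_path] at hb
      simp at hb
    obtain ⟨e', h1, rfl, h3, h4⟩ := h.1.parent u hu hs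
    rw [h4, ← List.append_assoc] at hb
    obtain ⟨h5, h6⟩ := List.append_inj' hb rfl
    obtain rfl : e' = e := by simpa using h6
    have h7 := ih h3 h5
    have h8 := h.dist_ge hu h1
    rw [costAt_append]
    linarith

theorem IsTentative.costAt_le (h : L.IsTentative G B t) {v : Fin n} (hv : v ∈ L.reach) :
    G.costAt (-B) (t v) ≤ L.dist B v := by
  have h1 := h.dist_prefix hv h.1.source_mem (b := t v) (by rw [h.1.source_path]; rfl)
  have h2 : L.dist B G.source = 0 := by simp [dist, h.2.1, h.2.2.1]
  linarith

theorem IsTentative.source_ne (h : L.IsTentative G B t) (hno : G.NoNegCycle (-B)) {e : Fin m}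
    (he : L.Relaxable G B e) : G.tgt e ≠ G.source := by
  intro hs
  have h1 : L.dist B G.source = 0 := by simp [dist, h.2.1, h.2.2.1]
  rcases he.2 with h2 | h2
  · exact h2 (hs ▸ h.1.source_mem)
  · rw [hs, h1] at h2
    have h3 := hno G.source (t (G.src e) ++ [e]) (isWalk_concat.2 ⟨h.1.isWalk he.1, hs⟩)
    have h4 := h.costAt_le he.1
    rw [costAt_append] at h3
    linarith

theorem IsTentative.not_prefix (h : L.IsTentative G B t) (hno : G.NoNegCycle (-B)) {e : Fin m}
    (he : L.Relaxable G B e) : ¬ (G.tgt e ∈ L.reach ∧ t (G.tgt e) <+: t (G.src e)) := by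
  rintro ⟨h1, b, hb⟩
  rcases he.2 with h2 | h2
  · exact h2 h1
  · obtain ⟨w, hw, hwt, -, hwb⟩ := h.1.exists_prefix he.1 hb.symm
    obtain rfl := h.1.injOn hw h1 hwt
    have h3 := hno (G.tgt e) (b ++ [e]) (isWalk_concat.2 ⟨hwb, rfl⟩)
    have h4 := h.dist_prefix he.1 h1 hb.symm
    rw [costAt_append] at h3
    linarith

theorem IsTentative.relax (h : L.IsTentative G B t) (hno : G.NoNegCycle (-B)) {e : Fin m}
    (he : L.Relaxable G B e) : (L.relax G e).IsTentative G B
      (rehang L.reach t (G.tgt e) (t (G.src e) ++ [e])) := by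
  have hs := h.source_ne hno he
  have hnot := h.not_prefix hno he
  refine ⟨h.1.hang he.1 hs hnot, ?_, ?_, ?_⟩
  · simp [Labels.relax, hs.symm, h.2.1]
  · simp [Labels.relax, hs.symm, h.2.2.1]
  · intro f hf hp
    have hsrc : G.src e ≠ G.tgt e := by
      intro h1
      exact hnot ⟨h1 ▸ he.1, by rw [h1]⟩
    by_cases hfe : G.tgt f = G.tgt e
    · have : (f : ℕ) + 1 = e + 1 := by
        rw [← hp, hfe]; simp [Labels.relax]
      obtain rfl : f = e := Fin.ext (by omega)
      left
      simp [Labels.relax, hsrc]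
    · have hfR : G.tgt f ∈ L.reach := by
        rcases hf with h1 | h1
        · exact absurd h1 hfe
        · exact h1
      have hpf : L.par (G.tgt f) = f + 1 := by
        rw [← hp]; simp [Labels.relax, hfe]
      have hsR := (h.1.of_parent hfR hpf).1
      have h1 := h.2.2.2 f hfR hpf
      rw [dist_relax (v := G.tgt f), if_neg hfe]
      by_cases hfs : G.src f = G.tgt e
      · right
        rw [dist_relax, if_pos hfs]
        have h2 := h.dist_ge hfR hpf
        rcases he.2 with h3 | h3
        · exact absurd (hfs ▸ hsR) h3
        · rw [hfs] at h2
          linarith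
      · rw [dist_relax, if_neg hfs]
        simpa [Labels.relax, hfe, hfs] using h1

/-- The tentative distances are at most the costs of all walks with at most `k` edges. -/
def Dominates (G : ParamGraph n m) (B : ℝ) (L : Labels n) (k : ℕ) : Prop :=
  ∀ v q, G.IsWalk G.source q v → q.length ≤ k → v ∈ L.reach ∧ L.dist B v ≤ G.costAt (-B) q

/-- The tentative distances are at most the costs of all walks with at most `k` edges that are
followed by an edge with number less than `i`. -/
def DominatesEdges (G : ParamGraph n m) (B : ℝ) (L : Labels n) (k i : ℕ) : Prop :=
  ∀ (e : Fin m) (q : List (Fin m)), (e : ℕ) < i → G.IsWalk G.source q (G.src e) →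
    q.length ≤ k → G.tgt e ∈ L.reach ∧ L.dist B (G.tgt e) ≤ G.costAt (-B) (q ++ [e])

theorem Dominates.relax {k : ℕ} (h : L.Dominates G B k) {e : Fin m} (he : L.Relaxable G B e) :
    (L.relax G e).Dominates G B k := fun v q hq hk =>
  ⟨Set.mem_insert_of_mem _ (h v q hq hk).1,
    (dist_relax_le he (h v q hq hk).1).trans (h v q hq hk).2⟩

theorem DominatesEdges.relax {k : ℕ} {e : Fin m} (h : L.DominatesEdges G B k e)
    (hd : L.Dominates G B k) (he : L.Relaxable G B e) :
    (L.relax G e).DominatesEdges G B k (e + 1) := by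
  intro f q hf hq hk
  by_cases hfe : f = e
  · subst hfe
    refine ⟨Set.mem_insert _ _, ?_⟩
    rw [dist_relax, if_pos rfl, costAt_append]
    linarith [(hd _ q hq hk).2]
  · have hlt : (f : ℕ) < e := by
      have : (f : ℕ) ≠ e := fun h1 => hfe (Fin.ext h1)
      omega
    have h1 := h f q hlt hq hk
    exact ⟨Set.mem_insert_of_mem _ h1.1, (dist_relax_le he h1.1).trans h1.2⟩

theorem DominatesEdges.of_not {k : ℕ} {e : Fin m} (h : L.DominatesEdges G B k e)
    (hd : L.Dominates G B k) (he : ¬ L.Relaxable G B e) : L.DominatesEdges G B k (e + 1) := by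
  intro f q hf hq hk
  by_cases hfe : f = e
  · subst hfe
    have h1 := hd _ q hq hk
    simp only [Relaxable, not_and, not_or, not_not, not_lt] at he
    obtain ⟨h2, h3⟩ := he h1.1
    refine ⟨h2, ?_⟩
    rw [costAt_append]
    linarith
  · have hlt : (f : ℕ) < e := by
      have : (f : ℕ) ≠ e := fun h1 => hfe (Fin.ext h1)
      omega
    exact h f q hlt hq hk

theorem DominatesEdges.succ {k : ℕ} (h : L.DominatesEdges G B k m) (hd : L.Dominates G B k) :
    L.Dominates G B (k + 1) := by
  intro v q hq hk
  rcases List.eq_nil_or_concat q with rfl | ⟨q, e, rfl⟩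
  · exact hd v [] hq (Nat.zero_le _)
  · rw [List.concat_eq_append] at *
    obtain ⟨h1, rfl⟩ := isWalk_concat.1 hq
    exact h e q e.2 h1 (by simpa using hk)

theorem IsTentative.not_relaxable (h : L.IsTentative G B t) (hno : G.NoNegCycle (-B))
    (hd : L.Dominates G B (n - 1)) (e : Fin m) : ¬ L.Relaxable G B e := by
  intro he
  have h1 := h.relax hno he
  have h2 := h1.1.length_lt (v := G.tgt e) (Set.mem_insert _ _)
  rw [rehang_self] at h2
  have h3 := hd (G.tgt e) (t (G.src e) ++ [e]) (isWalk_concat.2 ⟨h.1.isWalk he.1, rfl⟩)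
    (by omega)
  have h4 := h.costAt_le he.1
  rw [costAt_append] at h3
  rcases he.2 with h5 | h5
  · exact h5 h3.1
  · linarith [h3.2]

theorem reach_eq_univ (hG : G.AllReachable) (hs : G.source ∈ L.reach)
    (hR : ∀ e, ¬ L.Relaxable G B e) : L.reach = Set.univ := by
  refine Set.eq_univ_of_forall fun v => ?_
  obtain ⟨p, hp⟩ := hG v
  induction p using List.reverseRecOn generalizing v with
  | nil =>
    obtain rfl : G.source = v := hp
    exact hs
  | append_singleton p e ih =>
    obtain ⟨h1, rfl⟩ := isWalk_concat.1 hp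
    by_contra h2
    exact hR e ⟨ih _ h1, .inl h2⟩

theorem dist_le (hu : L.reach = Set.univ) (hR : ∀ e, ¬ L.Relaxable G B e) (e : Fin m) :
    L.dist B (G.tgt e) ≤ L.dist B (G.src e) + G.costAt (-B) [e] := by
  by_contra h
  exact hR e ⟨hu ▸ Set.mem_univ _, .inr (not_le.1 h)⟩

theorem IsTentative.labels_eq (h : L.IsTentative G B t) (hu : L.reach = Set.univ)
    (hR : ∀ e, ¬ L.Relaxable G B e) (v : Fin n) :
    L.cst v = G.pathCost (t v) ∧ L.cnt v = G.pathParam (t v) := by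
  induction hl : (t v).length using Nat.strong_induction_on generalizing v with
  | _ l ih =>
    by_cases hs : v = G.source
    · rw [hs, h.1.source_path, h.2.1, h.2.2.1]
      simp
    · obtain ⟨e, h1, rfl, h3, h4⟩ := h.1.parent v (hu ▸ Set.mem_univ _) hs
      obtain ⟨h5, h6⟩ := ih (t (G.src e)).length (by rw [← hl, h4]; simp) _ rfl
      have h7 := dist_le hu hR e
      rcases h.2.2.2 e (hu ▸ Set.mem_univ _) h1 with ⟨h8, h9⟩ | h8
      · rw [h8, h9, h4, h5, h6, pathCost_append, pathParam_append]
        simp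
      · linarith

theorem IsTentative.edgeOK (h : L.IsTentative G B t) (hu : L.reach = Set.univ)
    (hR : ∀ e, ¬ L.Relaxable G B e) : G.EdgeOK ((-B : ℝ) : EReal) t := by
  intro e
  have h1 := dist_le hu hR e
  have h2 : ∀ v, L.dist B v = G.costAt (-B) (t v) := fun v => by
    rw [dist, (h.labels_eq hu hR v).1, (h.labels_eq hu hR v).2, costAt]
    ring
  rw [noLonger_coe, costAt_append, ← h2, ← h2]
  exact h1

end Labels

end ParamGraph


variable {n m : ℕ} {G : ParamGraph n m}

/-! ## Input and incidence lists -/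

/-- The memory holds the graph `G`. -/
structure Input (G : ParamGraph n m) (σ : Store) : Prop where
  n_eq : σ.nat .n 0 0 = n
  m_eq : σ.nat .m 0 0 = m
  s_eq : σ.nat .s 0 0 = G.source
  src_eq : ∀ e : Fin m, σ.nat .src e 0 = G.src e
  tgt_eq : ∀ e : Fin m, σ.nat .tgt e 0 = G.tgt e
  isP_eq : ∀ e : Fin m, σ.nat .isP e 0 = if e ∈ G.param then 1 else 0
  cost_eq : ∀ e : Fin m, σ.real .cost e 0 = G.cost e

theorem input_load (G : ParamGraph n m) : Input G G.load := by
  constructor <;> simp [ParamGraph.load]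

theorem Input.congr {σ τ : Store} (h : Input G σ) (h1 : τ.nat .n = σ.nat .n)
    (h2 : τ.nat .m = σ.nat .m) (h3 : τ.nat .s = σ.nat .s) (h4 : τ.nat .src = σ.nat .src)
    (h5 : τ.nat .tgt = σ.nat .tgt) (h6 : τ.nat .isP = σ.nat .isP)
    (h7 : τ.real .cost = σ.real .cost) : Input G τ :=
  ⟨by rw [h1, h.n_eq], by rw [h2, h.m_eq], by rw [h3, h.s_eq], fun e => by rw [h4, h.src_eq],
    fun e => by rw [h5, h.tgt_eq], fun e => by rw [h6, h.isP_eq], fun e => by rw [h7, h.cost_eq]⟩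

theorem Input.frame {p : Stmt} {σ τ : Store} (h : Input G σ) (f : Frame p σ τ)
    (hn : (p.writesN .n || p.writesN .m || p.writesN .s || p.writesN .src || p.writesN .tgt ||
      p.writesN .isP || p.writesR .cost) = false) : Input G τ := by
  simp only [Bool.or_eq_false_iff] at hn
  obtain ⟨⟨⟨⟨⟨⟨h1, h2⟩, h3⟩, h4⟩, h5⟩, h6⟩, h7⟩ := hn
  exact h.congr (f.1 _ h1) (f.1 _ h2) (f.1 _ h3) (f.1 _ h4) (f.1 _ h5) (f.1 _ h6) (f.2 _ h7)

/-- The edges of the list `l` are linked by `next`, and `h` points to the first one. -/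
def Chain (next : ℕ → ℕ) : ℕ → List (Fin m) → Prop
  | h, [] => h = 0
  | h, e :: l => h = e + 1 ∧ Chain next (next e) l

theorem Chain.congr {next next' : ℕ → ℕ} {l : List (Fin m)} {h : ℕ} (hc : Chain next h l)
    (he : ∀ e ∈ l, next' e = next e) : Chain next' h l := by
  induction l generalizing h with
  | nil => exact hc
  | cons e l ih =>
    refine ⟨hc.1, ?_⟩
    rw [he e List.mem_cons_self]
    exact ih hc.2 fun f hf => he f (List.mem_cons_of_mem _ hf)

/-- The lists of the edges `e < k` with a given end `f e`. -/
def IncLists (f : Fin m → Fin n) (next head : ℕ → ℕ) (k : ℕ) : Prop :=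
  ∀ v : Fin n, ∃ l : List (Fin m), Chain next (head v) l ∧ l.Nodup ∧
    ∀ e, e ∈ l ↔ f e = v ∧ (e : ℕ) < k

theorem IncLists.push {f : Fin m → Fin n} {next head : ℕ → ℕ} {e : Fin m}
    (h : IncLists f next head e) :
    IncLists f (Function.update next e (head (f e))) (Function.update head (f e) (e + 1))
      (e + 1) := by
  intro v
  obtain ⟨l, h1, h2, h3⟩ := h v
  have hel : e ∉ l := fun h4 => lt_irrefl _ ((h3 e).1 h4).2
  have h4 : Chain (Function.update next e (head (f e))) (head v) l := by
    refine h1.congr fun g hg => ?_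
    have : (g : ℕ) ≠ e := fun h5 => hel (Fin.ext h5 ▸ hg)
    rw [Function.update_of_ne this]
  by_cases hv : f e = v
  · subst hv
    refine ⟨e :: l, ?_, List.nodup_cons.2 ⟨hel, h2⟩, fun g => ?_⟩
    · rw [Function.update_self]
      exact ⟨rfl, by rwa [Function.update_self]⟩
    · rw [List.mem_cons, h3, Nat.lt_succ_iff_lt_or_eq, and_or_left, or_comm]
      refine or_congr Iff.rfl ⟨?_, fun h5 => Fin.ext h5.2⟩
      rintro rfl
      exact ⟨rfl, rfl⟩
  · refine ⟨l, ?_, h2, fun g => ?_⟩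
    · have : (v : ℕ) ≠ f e := fun h5 => hv (Fin.ext h5.symm)
      rwa [Function.update_of_ne this]
    · rw [h3]
      refine and_congr_right fun h5 => ?_
      have : (g : ℕ) ≠ e := fun h6 => hv (by rw [← h5, Fin.ext h6])
      omega

/-- The incidence lists of the edges `e < k` are stored in the memory. -/
def Adj (G : ParamGraph n m) (k : ℕ) (σ : Store) : Prop :=
  IncLists G.src (fun i => σ.nat .outNext i 0) (fun i => σ.nat .outHead i 0) k ∧
  IncLists G.tgt (fun i => σ.nat .inNext i 0) (fun i => σ.nat .inHead i 0) k

theorem Adj.frame {p : Stmt} {σ τ : Store} {k : ℕ} (h : Adj G k σ) (f : Frame p σ τ)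
    (hn : (p.writesN .outNext || p.writesN .outHead || p.writesN .inNext ||
      p.writesN .inHead) = false) : Adj G k τ := by
  simp only [Bool.or_eq_false_iff] at hn
  obtain ⟨⟨⟨h1, h2⟩, h3⟩, h4⟩ := hn
  rw [Adj, f.1 _ h1, f.1 _ h2, f.1 _ h3, f.1 _ h4]
  exact h

theorem buildLists_runs {σ : Store} (h : Input G σ) (h1 : ∀ i, σ.nat .outHead i 0 = 0)
    (h2 : ∀ i, σ.nat .inHead i 0 = 0) :
    Runs buildLists σ (fun τ t => Adj G m τ ∧ t ≤ 100 * m + 100) := by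
  refine (Runs.forUpTo (A := .ie) (e := NVar.m.val) m (fun i k σ => Input G σ ∧ Adj G i σ ∧
    100 * (m - i) ≤ k) (k := 100 * m) ?_ rfl (fun i k σ h => h.1.m_eq) ?_).mono ?_
  · refine ⟨h.congr rfl rfl rfl rfl rfl rfl rfl, ⟨fun v => ⟨[], h1 v, List.nodup_nil, ?_⟩,
      fun v => ⟨[], h2 v, List.nodup_nil, ?_⟩⟩, by omega⟩ <;> simp
  · rintro i k σ him ⟨hI, hA, hk⟩ hi
    obtain ⟨e, rfl⟩ : ∃ e : Fin m, i = e := ⟨⟨i, him⟩, rfl⟩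
    simp only [runs_block_cons, runs_block_single, runs_setN]
    simp only [Store.nat_setNat, NExp.eval_get, NExp.eval_add, NExp.eval_zero, NExp.eval_one, hi,
      hI.src_eq, hI.tgt_eq, reduceCtorEq, false_and, if_false]
    refine ⟨100 * (m - (e + 1)), ⟨hI.congr rfl rfl rfl rfl rfl rfl rfl, ⟨?_, ?_⟩, le_rfl⟩, ?_⟩
    · convert hA.1.push using 1 <;> funext i <;> simp [Function.update_apply]
    · convert hA.2.push using 1 <;> funext i <;> simp [Function.update_apply]
    · simp only [NExp.time_get, NExp.time_zero, NExp.time_one, NExp.time_add]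
      omega
  · rintro τ t ⟨k', ⟨-, hA, -⟩, hk⟩
    simp only [NExp.time_get, NExp.time_zero] at hk
    exact ⟨hA, by omega⟩

theorem computeBig_runs {σ : Store} (h : Input G σ) :
    Runs computeBig σ (fun τ t => τ.real .big 0 0 = G.bigCost ∧ t ≤ 100 * m + 100) := by
  rw [computeBig, runs_block_cons, runs_setR, runs_block_single]
  refine (Runs.forUpTo (A := .ie) (e := NVar.m.val) m (fun i k τ => Input G τ ∧
    τ.real .big 0 0 = 1 + ∑ j ∈ Finset.range i, |σ.real .cost j 0| ∧
    τ.real .cost = σ.real .cost ∧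
    100 * (m - i) ≤ k) (k := 100 * m) ?_ rfl (fun i k σ h => h.1.m_eq) ?_).mono ?_
  · refine ⟨h.congr rfl rfl rfl rfl rfl rfl rfl, ?_, ?_, by omega⟩
    · simp
    · rfl
  · rintro i k τ him ⟨hI, hB, hc, hk⟩ hi
    rw [runs_ite]
    simp only [BExp.holds, RExp.eval_get, RExp.eval_ofN, NExp.eval_get, NExp.eval_zero, hi,
      Nat.cast_zero, runs_setR]
    refine ⟨fun hneg => ?_, fun hneg => ?_⟩
    · refine ⟨100 * (m - (i + 1)), ⟨hI.congr rfl rfl rfl rfl rfl rfl rfl, ?_, ?_, le_rfl⟩, ?_⟩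
      · rw [Finset.sum_range_succ, ← add_assoc, ← hB, abs_of_neg (by rwa [← hc])]
        simp [hi, hc]
        ring
      · rw [← hc]; rfl
      · simp only [BExp.time, RExp.time_get, RExp.time_sub, RExp.time_ofN, NExp.time_get,
          NExp.time_zero]
        omega
    · refine ⟨100 * (m - (i + 1)), ⟨hI.congr rfl rfl rfl rfl rfl rfl rfl, ?_, ?_, le_rfl⟩, ?_⟩
      · rw [Finset.sum_range_succ, ← add_assoc, ← hB, abs_of_nonneg (by rw [← hc]; exact not_lt.1 hneg)]
        simp [hi, hc]
      · rw [← hc]; rfl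
      · simp only [BExp.time, RExp.time_get, RExp.time_add, RExp.time_ofN, NExp.time_get,
          NExp.time_zero]
        omega
  · rintro τ t ⟨k', ⟨hI, hB, -, -⟩, hk⟩
    simp only [RExp.time_ofN, NExp.time_get, NExp.time_zero, NExp.time_one] at hk ⊢
    refine ⟨?_, by omega⟩
    rw [hB, ParamGraph.bigCost, Finset.sum_range]
    simp only [h.cost_eq]

/-! ## The Bellman-Ford algorithm: execution -/

open ParamGraph (Labels)

/-- The labels stored in the memory. -/
def labels (n : ℕ) (σ : Store) : Labels n where
  reach := {v | σ.nat .reach v 0 = 1}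
  cst := fun v => σ.real .cst v 0
  cnt := fun v => σ.nat .cnt v 0
  par := fun v => σ.nat .par v 0

/-- What holds throughout the Bellman-Ford algorithm. -/
structure Scan (G : ParamGraph n m) (σ : Store) : Prop where
  input : Input G σ
  big : σ.real .big 0 0 = G.bigCost
  reach_le : ∀ v : Fin n, σ.nat .reach v 0 ≤ 1
  source : G.source ∈ (labels n σ).reach

theorem Scan.congr {σ τ : Store} (h : Scan G σ) (hI : Input G τ) (h1 : τ.real .big = σ.real .big)
    (h2 : τ.nat .reach = σ.nat .reach) : Scan G τ :=
  ⟨hI, by rw [h1, h.big], by rw [h2]; exact h.reach_le, by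
    have := h.source
    simp only [labels, Set.mem_ofPred_eq] at this ⊢
    rw [h2, this]⟩

/-- What holds after the edges `e < i` have been scanned in round `r`. -/
structure RoundInv (G : ParamGraph n m) (r i : ℕ) (σ : Store) : Prop where
  scan : Scan G σ
  chg_le : σ.nat .chg 0 0 ≤ 1
  quiet : σ.nat .chg 0 0 = 0 →
    ∀ e : Fin m, (e : ℕ) < i → ¬ (labels n σ).Relaxable G G.bigCost e
  good : G.NoNegCycle (-G.bigCost) → (∃ t, (labels n σ).IsTentative G G.bigCost t) ∧
    (labels n σ).Dominates G G.bigCost r ∧ (labels n σ).DominatesEdges G G.bigCost r i ∧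
    (r = n - 1 → σ.nat .chg 0 0 = 0)

theorem relax_runs {r : ℕ} {e : Fin m} {σ : Store} (h : RoundInv G r e σ)
    (he : σ.nat .ie 0 0 = e) :
    Runs (when
      (.and (.eqN (NVar.reach.ix (NVar.src.ix NVar.ie.val)) 1)
        (.or (.eqN (NVar.reach.ix (NVar.tgt.ix NVar.ie.val)) 0)
          (.ltR (RVar.cst.ix (NVar.src.ix NVar.ie.val) + RVar.cost.ix NVar.ie.val
              + RVar.big.val * .ofN (NVar.cnt.ix (NVar.src.ix NVar.ie.val) + NVar.isP.ix NVar.ie.val))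
            (RVar.cst.ix (NVar.tgt.ix NVar.ie.val) +
              RVar.big.val * .ofN (NVar.cnt.ix (NVar.tgt.ix NVar.ie.val))))))
      (block [
        RVar.cst.put1 (NVar.tgt.ix NVar.ie.val)
          (RVar.cst.ix (NVar.src.ix NVar.ie.val) + RVar.cost.ix NVar.ie.val),
        NVar.cnt.put1 (NVar.tgt.ix NVar.ie.val)
          (NVar.cnt.ix (NVar.src.ix NVar.ie.val) + NVar.isP.ix NVar.ie.val),
        NVar.par.put1 (NVar.tgt.ix NVar.ie.val) (NVar.ie.val + 1),
        NVar.reach.put1 (NVar.tgt.ix NVar.ie.val) 1,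
        NVar.chg.put 1])) σ (fun τ t => RoundInv G r (e + 1) τ ∧ t ≤ 300) := by
  obtain ⟨hS, hchg, hq, hg⟩ := h
  have hI := hS.input
  set L := labels n σ with hL
  have hcond : (σ.nat .reach (G.src e) 0 = 1 ∧ (σ.nat .reach (G.tgt e) 0 = 0 ∨
      σ.real .cst (G.src e) 0 + G.cost e +
        G.bigCost * ((σ.nat .cnt (G.src e) 0 + if e ∈ G.param then 1 else 0 : ℕ) : ℝ) <
      σ.real .cst (G.tgt e) 0 + G.bigCost * (σ.nat .cnt (G.tgt e) 0 : ℝ))) ↔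
      L.Relaxable G G.bigCost e := by
    rw [Labels.Relaxable, Labels.costAt_neg_singleton]
    refine and_congr Iff.rfl (or_congr ?_ ?_)
    · have := hS.reach_le (G.tgt e)
      simp only [hL, labels, Set.mem_ofPred_eq]
      omega
    · simp only [hL, labels, Labels.dist]
      push_cast
      constructor <;> intro h <;> linarith
  have hhold : BExp.holds σ (.and (.eqN (NVar.reach.ix (NVar.src.ix NVar.ie.val)) 1)
        (.or (.eqN (NVar.reach.ix (NVar.tgt.ix NVar.ie.val)) 0)
          (.ltR (RVar.cst.ix (NVar.src.ix NVar.ie.val) + RVar.cost.ix NVar.ie.val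
              + RVar.big.val * .ofN (NVar.cnt.ix (NVar.src.ix NVar.ie.val) + NVar.isP.ix NVar.ie.val))
            (RVar.cst.ix (NVar.tgt.ix NVar.ie.val) +
              RVar.big.val * .ofN (NVar.cnt.ix (NVar.tgt.ix NVar.ie.val)))))) ↔
      L.Relaxable G G.bigCost e := by
    rw [← hcond]
    simp only [BExp.holds, RExp.eval_get, RExp.eval_ofN, RExp.eval_add, RExp.eval_mul,
      NExp.eval_get, NExp.eval_zero, NExp.eval_one, NExp.eval_add, he, hI.src_eq, hI.tgt_eq,
      hI.isP_eq, hI.cost_eq, hS.big]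
  rw [when, runs_ite]
  constructor
  · intro hb
    have hrel := hhold.1 hb
    simp only [runs_block_cons, runs_block_single, runs_setN, runs_setR]
    set τ := Store.setNat _ .chg _ _ _ with hτ
    have hIτ : Input G τ := hI.congr rfl rfl rfl rfl rfl rfl rfl
    have heτ : τ.nat .ie 0 0 = e := he
    have hbig : τ.real .big = σ.real .big := rfl
    have hreach : ∀ v : Fin n, τ.nat .reach v 0 = if v = G.tgt e then 1 else σ.nat .reach v 0 := by
      intro v
      simp [hτ, he, hI.tgt_eq, Fin.ext_iff]
    have hlab : labels n τ = L.relax G e := by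
      ext v
      · simp only [labels, Labels.relax, hreach, hL, Set.mem_ofPred_eq, Set.mem_insert_iff]
        split_ifs with h1 <;> simp [h1]
      · simp [hτ, hL, labels, Labels.relax, Function.update_apply, he, hI.tgt_eq, hI.src_eq,
          hI.cost_eq, Fin.ext_iff]
      · simp [hτ, hL, labels, Labels.relax, Function.update_apply, he, hI.tgt_eq, hI.src_eq,
          hI.isP_eq, Fin.ext_iff]
      · simp [hτ, hL, labels, Labels.relax, Function.update_apply, he, hI.tgt_eq, hI.src_eq,
          Fin.ext_iff]
    have hchgτ : τ.nat .chg 0 0 = 1 := by simp [hτ]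
    refine ⟨⟨⟨hIτ, by rw [hbig, hS.big], ?_, ?_⟩, hchgτ.le, ?_, ?_⟩, ?_⟩
    · intro v
      rw [hreach]
      split_ifs
      · exact le_rfl
      · exact hS.reach_le v
    · rw [hlab]
      exact Set.mem_insert_of_mem _ hS.source
    · rw [hchgτ]
      exact fun h => absurd h one_ne_zero
    · intro hno
      obtain ⟨⟨t, ht⟩, hd, hde, hlast⟩ := hg hno
      rw [hlab]
      refine ⟨⟨_, ht.relax hno hrel⟩, hd.relax hrel, hde.relax hd hrel, fun hr => ?_⟩
      subst hr
      exact absurd hrel (ht.not_relaxable hno hd e)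
    · simp only [BExp.time, RExp.time_get, RExp.time_ofN, RExp.time_add, RExp.time_mul,
        NExp.time_get, NExp.time_zero, NExp.time_one, NExp.time_add]
      omega
  · intro hb
    have hrel : ¬ L.Relaxable G G.bigCost e := fun h => hb (hhold.2 h)
    rw [runs_skip]
    refine ⟨⟨hS, hchg, ?_, ?_⟩, ?_⟩
    · intro h0 f hf
      by_cases hfe : f = e
      · rw [hfe]; exact hrel
      · have : (f : ℕ) ≠ e := fun h1 => hfe (Fin.ext h1)
        exact hq h0 f (by omega)
    · intro hno
      obtain ⟨ht, hd, hde, hlast⟩ := hg hno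
      exact ⟨ht, hd, hde.of_not hd hrel, hlast⟩
    · simp only [BExp.time, RExp.time_get, RExp.time_ofN, RExp.time_add, RExp.time_mul,
        NExp.time_get, NExp.time_zero, NExp.time_one, NExp.time_add]
      omega

/-- What holds after `i` rounds. -/
structure RoundsInv (G : ParamGraph n m) (i : ℕ) (σ : Store) : Prop where
  scan : Scan G σ
  chg_le : 0 < i → σ.nat .chg 0 0 ≤ 1
  quiet : 0 < i → σ.nat .chg 0 0 = 0 →
    ∀ e : Fin m, ¬ (labels n σ).Relaxable G G.bigCost e
  good : G.NoNegCycle (-G.bigCost) → (∃ t, (labels n σ).IsTentative G G.bigCost t) ∧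
    (labels n σ).Dominates G G.bigCost i ∧ (i = n → σ.nat .chg 0 0 = 0)

theorem bellmanFord_runs {σ : Store} (hI : Input G σ) (hbig : σ.real .big 0 0 = G.bigCost)
    (hreach : ∀ i, σ.nat .reach i 0 = 0) (hcst : ∀ i, σ.real .cst i 0 = 0)
    (hcnt : ∀ i, σ.nat .cnt i 0 = 0) (hpar : ∀ i, σ.nat .par i 0 = 0) :
    Runs bellmanFord σ (fun τ t => RoundsInv G n τ ∧ t ≤ n * (400 * m + 200) + 100) := by
  rw [bellmanFord, runs_block_cons, runs_setN, runs_block_single]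
  set σ0 := Store.setNat _ .reach _ _ _ with hσ0
  have hI0 : Input G σ0 := hI.congr rfl rfl rfl rfl rfl rfl rfl
  have hr0 : ∀ v : Fin n, σ0.nat .reach v 0 = if v = G.source then 1 else 0 := by
    intro v
    simp [hσ0, hI.s_eq, Fin.ext_iff, hreach]
  have hS0 : Scan G σ0 := by
    refine ⟨hI0, hbig, fun v => ?_, ?_⟩
    · rw [hr0]; split_ifs <;> omega
    · simp [labels, hr0]
  refine (Runs.forUpTo (A := .round) (e := NVar.n.val) n
    (fun i k σ => RoundsInv G i σ ∧ (400 * m + 200) * (n - i) ≤ k)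
    (k := (400 * m + 200) * n) ?_ rfl (fun i k σ h => h.1.scan.input.n_eq) ?_).mono ?_
  · refine ⟨⟨⟨hI.congr rfl rfl rfl rfl rfl rfl rfl, hS0.big, hS0.reach_le, hS0.source⟩,
      fun h => absurd h (lt_irrefl _),
      fun h => absurd h (lt_irrefl _), fun hno => ⟨⟨fun _ => [], ?_⟩, ?_, ?_⟩⟩, by simp⟩
    · have hlab : labels n (σ0.setNat .round 0 0 0) = ⟨{G.source}, fun _ => 0, fun _ => 0,
          fun _ => 0⟩ := by
        have hc : ∀ i, (σ0.setNat .round 0 0 0).nat .cnt i 0 = 0 := hcnt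
        have hp : ∀ i, (σ0.setNat .round 0 0 0).nat .par i 0 = 0 := hpar
        have hc' : ∀ i, (σ0.setNat .round 0 0 0).real .cst i 0 = 0 := hcst
        ext v
        · simp [labels, hr0]
        · simp only [labels, hc']
        · simp only [labels, hc]
        · simp only [labels, hp]
      rw [hlab]
      refine ⟨⟨rfl, rfl, rfl, fun v hv hvs => absurd hv hvs⟩, rfl, rfl, fun e _ h => ?_⟩
      simp at h
    · intro v q hq hl
      obtain rfl : q = [] := List.length_eq_zero_iff.1 (Nat.le_zero.1 hl)
      obtain rfl : G.source = v := hq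
      refine ⟨hS0.source, ?_⟩
      have hc : ∀ i, (σ0.setNat .round 0 0 0).nat .cnt i 0 = 0 := hcnt
      have hc' : ∀ i, (σ0.setNat .round 0 0 0).real .cst i 0 = 0 := hcst
      simp [labels, Labels.dist, hc', show ∀ i, σ0.nat .cnt i 0 = 0 from hcnt]
    · intro h0
      have := G.source.2
      omega
  · rintro i k σ hin ⟨⟨hS, -, -, hg⟩, hk⟩ hi
    rw [runs_block_cons, runs_setN, runs_block_single]
    refine (Runs.forUpTo (A := .ie) (e := NVar.m.val) m
      (fun j k σ => RoundInv G i j σ ∧ 400 * (m - j) ≤ k) (k := 400 * m) ?_ rfl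
      (fun i k σ h => h.1.scan.input.m_eq) ?_).mono ?_
    · refine ⟨⟨⟨hS.input.congr rfl rfl rfl rfl rfl rfl rfl, hS.big, hS.reach_le, hS.source⟩,
        ?_, ?_, fun hno => ⟨(hg hno).1, (hg hno).2.1, ?_, fun _ => rfl⟩⟩, by simp⟩
      · change (0 : ℕ) ≤ 1
        exact zero_le_one
      · exact fun _ e he => absurd he (Nat.not_lt_zero _)
      · exact fun e q he => absurd he (Nat.not_lt_zero _)
    · rintro j k' σ' hjm ⟨hinv, hk'⟩ hj
      obtain ⟨e, rfl⟩ : ∃ e : Fin m, j = e := ⟨⟨j, hjm⟩, rfl⟩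
      refine (relax_runs hinv hj).mono ?_
      rintro τ t ⟨hinv', ht⟩
      refine ⟨400 * (m - (e + 1)), ⟨⟨hinv'.scan.congr
        (hinv'.scan.input.congr rfl rfl rfl rfl rfl rfl rfl) rfl rfl, hinv'.chg_le, hinv'.quiet,
        hinv'.good⟩, le_rfl⟩, ?_⟩
      simp only [NExp.time_get, NExp.time_zero]
      omega
    · rintro τ t ⟨k', ⟨hinv, -⟩, ht⟩
      refine ⟨(400 * m + 200) * (n - (i + 1)), ⟨⟨hinv.scan.congr
        (hinv.scan.input.congr rfl rfl rfl rfl rfl rfl rfl) rfl rfl, fun _ => hinv.chg_le,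
        fun _ h0 e => hinv.quiet h0 e e.2, fun hno => ?_⟩, le_rfl⟩, ?_⟩
      · obtain ⟨h1, h2, h3, h4⟩ := hinv.good hno
        exact ⟨h1, h3.succ h2, fun h5 => h4 (by omega)⟩
      · have : n - i = n - (i + 1) + 1 := by omega
        rw [this, Nat.mul_succ] at hk
        simp only [NExp.time_get, NExp.time_zero] at ht ⊢
        omega
  · rintro τ t ⟨k', ⟨hinv, -⟩, ht⟩
    refine ⟨hinv, ?_⟩
    rw [Nat.mul_comm]
    simp only [NExp.time_get, NExp.time_zero, NExp.time_one] at ht ⊢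
    omega

theorem RoundsInv.chg_eq_one {σ : Store} (h : RoundsInv G n σ) (hG : G.AllReachable)
    (hno : ¬ G.NoNegCycle (-G.bigCost)) : σ.nat .chg 0 0 = 1 := by
  have hn : 0 < n := (Nat.zero_le _).trans_lt G.source.2
  have h1 := h.chg_le hn
  have h2 : σ.nat .chg 0 0 ≠ 0 := by
    intro h0
    have h3 := h.quiet hn h0
    have h4 := Labels.reach_eq_univ hG h.scan.source h3
    exact hno (ParamGraph.noNegCycle_of_potential (Labels.dist_le h4 h3))
  omega

theorem RoundsInv.exists_tree {σ : Store} (h : RoundsInv G n σ) (hG : G.AllReachable)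
    (hno : G.NoNegCycle (-G.bigCost)) : σ.nat .chg 0 0 = 0 ∧ ∃ t : Fin n → List (Fin m),
      G.ParentTree Set.univ (fun v => σ.nat .par v 0) t ∧ G.EdgeOK ⊥ t ∧
      ∀ v : Fin n, σ.real .cst v 0 = G.pathCost (t v) ∧ σ.nat .cnt v 0 = G.pathParam (t v) := by
  have hn : 0 < n := (Nat.zero_le _).trans_lt G.source.2
  obtain ⟨⟨t, ht⟩, -, hl⟩ := h.good hno
  have h0 := hl rfl
  have h3 := h.quiet hn h0
  have h4 := Labels.reach_eq_univ hG h.scan.source h3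
  have h5 : G.ParentTree Set.univ (fun v => σ.nat .par v 0) t := by
    rw [← h4]; exact ht.1
  exact ⟨h0, t, h5, h5.edgeOK_bot (ht.edgeOK h4 h3), ht.labels_eq h4 h3⟩


variable {n m : ℕ} {G : ParamGraph n m}

/-! ## Vertex keys -/

theorem pot_congr {σ τ : Store} (h0 : τ.nat .n = σ.nat .n) (h1 : τ.nat .hpar = σ.nat .hpar)
    (h2 : τ.nat .deg = σ.nat .deg) (h3 : τ.nat .hpos = σ.nat .hpos)
    (h4 : τ.nat .mark = σ.nat .mark) (h5 : τ.nat .child = σ.nat .child) : pot τ = pot σ := by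
  rw [pot, pot, heapData_congr h1 h2 h3 h4 h5, h0]

theorem Heap.congr {N : ℕ} {H : Finset ℕ} {σ τ : Store} (h : Heap N H σ)
    (h0 : τ.nat .n = σ.nat .n) (h1 : τ.nat .hpar = σ.nat .hpar)
    (h2 : τ.nat .deg = σ.nat .deg) (h3 : τ.nat .hpos = σ.nat .hpos)
    (h4 : τ.nat .mark = σ.nat .mark) (h5 : τ.nat .child = σ.nat .child)
    (h6 : τ.nat .bucket = σ.nat .bucket) (h7 : τ.nat .inHeap = σ.nat .inHeap)
    (h8 : τ.real .key = σ.real .key) : Heap N H τ :=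
  ⟨by rw [h0, h.top], by rw [heapData_congr h1 h2 h3 h4 h5, h8]; exact h.isHeap,
    by rw [h6]; exact h.bucket, by rw [h7]; exact h.inHeap⟩

/-- The arrays of the heap are not written by `p`. -/
def Stmt.keepsHeap (p : Stmt) : Bool :=
  !(p.writesN .n || p.writesN .hpar || p.writesN .deg || p.writesN .hpos || p.writesN .mark ||
    p.writesN .child || p.writesN .bucket || p.writesN .inHeap || p.writesR .key)

theorem Heap.frame {N : ℕ} {H : Finset ℕ} {p : Stmt} {σ τ : Store} (h : Heap N H σ)
    (f : Frame p σ τ) (hp : p.keepsHeap = true) : Heap N H τ ∧ pot τ = pot σ := by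
  simp only [Stmt.keepsHeap, Bool.not_eq_true', Bool.or_eq_false_iff] at hp
  obtain ⟨⟨⟨⟨⟨⟨⟨⟨h0, h1⟩, h2⟩, h3⟩, h4⟩, h5⟩, h6⟩, h7⟩, h8⟩ := hp
  exact ⟨h.congr (f.1 _ h0) (f.1 _ h1) (f.1 _ h2) (f.1 _ h3) (f.1 _ h4) (f.1 _ h5) (f.1 _ h6)
    (f.1 _ h7) (f.2 _ h8), pot_congr (f.1 _ h0) (f.1 _ h1) (f.1 _ h2) (f.1 _ h3) (f.1 _ h4)
    (f.1 _ h5)⟩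

/-- The memory holds the costs of the paths `t v` and their numbers of parameterized edges. -/
structure Paths (G : ParamGraph n m) (t : Fin n → List (Fin m)) (σ : Store) : Prop where
  input : Input G σ
  cst_eq : ∀ v : Fin n, σ.real .cst v 0 = G.pathCost (t v)
  cnt_eq : ∀ v : Fin n, σ.nat .cnt v 0 = G.pathParam (t v)

theorem Paths.frame {t : Fin n → List (Fin m)} {p : Stmt} {σ τ : Store} (h : Paths G t σ)
    (f : Frame p σ τ)
    (hn : (p.writesN .n || p.writesN .m || p.writesN .s || p.writesN .src || p.writesN .tgt ||
      p.writesN .isP || p.writesR .cost) = false) (hn' : (p.writesN .cnt || p.writesR .cst) = false) :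
    Paths G t τ := by
  simp only [Bool.or_eq_false_iff] at hn'
  exact ⟨h.input.frame f hn, by rw [f.2 _ hn'.2]; exact h.cst_eq,
    by rw [f.1 _ hn'.1]; exact h.cnt_eq⟩

/-- The heap contains the vertices `H`, the key of each vertex in `V ∩ H` is at least the key of
the edge that is stored for it, and for each edge in `F` the key of its head is at most the key of
the edge. -/
structure Keys (G : ParamGraph n m) (t : Fin n → List (Fin m)) (V : Set (Fin n))
    (F : Set (Fin m)) (H : Finset ℕ) (σ : Store) : Prop where
  heap : Heap n H σ
  edge : ∀ v : Fin n, (v : ℕ) ∈ H → v ∈ V → ∃ e : Fin m, σ.nat .vEdge v 0 = e ∧ G.tgt e = v ∧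
    G.Gains t e ∧ G.ratio t e ≤ σ.real .key v 0
  le : ∀ e ∈ F, G.Gains t e → (G.tgt e : ℕ) ∈ H ∧ σ.real .key (G.tgt e) 0 ≤ G.ratio t e

theorem Keys.mono {t : Fin n → List (Fin m)} {V V' : Set (Fin n)} {F F' : Set (Fin m)}
    {H : Finset ℕ} {σ : Store} (h : Keys G t V F H σ) (hV : V' ⊆ V) (hF : F' ⊆ F) :
    Keys G t V' F' H σ :=
  ⟨h.heap, fun v hv hv' => h.edge v hv (hV hv'), fun e he => h.le e (hF he)⟩

theorem Keys.congr {t : Fin n → List (Fin m)} {V : Set (Fin n)} {F : Set (Fin m)}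
    {H : Finset ℕ} {σ τ : Store} (h : Keys G t V F H σ) (hH : Heap n H τ)
    (h1 : τ.nat .vEdge = σ.nat .vEdge) (h2 : τ.real .key = σ.real .key) : Keys G t V F H τ :=
  ⟨hH, by rw [h1, h2]; exact h.edge, by rw [h2]; exact h.le⟩

theorem Keys.insert {t : Fin n → List (Fin m)} {V : Set (Fin n)} {F : Set (Fin m)}
    {H : Finset ℕ} {σ τ : Store} {e : Fin m} (h : Keys G t V F H σ) (hg : G.Gains t e)
    (hH : Heap n (insert (G.tgt e : ℕ) H) τ)
    (hkey : ∀ y, τ.real .key y 0 = if y = G.tgt e then G.ratio t e else σ.real .key y 0)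
    (hv : ∀ y, τ.nat .vEdge y 0 = if y = G.tgt e then (e : ℕ) else σ.nat .vEdge y 0)
    (hle : (G.tgt e : ℕ) ∈ H → G.ratio t e ≤ σ.real .key (G.tgt e) 0) :
    Keys G t V (insert e F) (insert (G.tgt e : ℕ) H) τ := by
  refine ⟨hH, fun v hvH hvV => ?_, ?_⟩
  · rw [hkey, hv]
    split_ifs with h1
    · exact ⟨e, rfl, (Fin.ext h1).symm, hg, le_rfl⟩
    · exact h.edge v (Finset.mem_of_mem_insert_of_ne hvH h1) hvV
  · rintro f (rfl | hf) hgf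
    · exact ⟨Finset.mem_insert_self _ _, by rw [hkey, if_pos rfl]⟩
    · obtain ⟨h1, h2⟩ := h.le f hf hgf
      refine ⟨Finset.mem_insert_of_mem h1, ?_⟩
      rw [hkey]
      split_ifs with h3
      · have h4 : G.tgt f = G.tgt e := Fin.ext h3
        rw [h4] at h1 h2
        exact (hle h1).trans h2
      · exact h2

theorem improveKey_runs {t : Fin n → List (Fin m)} {V : Set (Fin n)} {F : Set (Fin m)}
    {H : Finset ℕ} {σ : Store} {e : Fin m} (hP : Paths G t σ) (hK : Keys G t V F H σ)
    (he : σ.nat .ke 0 0 = e) :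
    Runs improveKey σ (fun τ s => (∃ H', Keys G t V (insert e F) H' τ) ∧
      s + 1000 * pot τ ≤ 1000 * pot σ + 8000) := by
  have hI := hP.input
  have hcond : σ.nat .cnt (G.tgt e) 0 < σ.nat .cnt (G.src e) 0 + (if e ∈ G.param then 1 else 0) ↔
      G.Gains t e := by
    rw [hP.cnt_eq, hP.cnt_eq, ParamGraph.Gains, ParamGraph.pathParam_append,
      ParamGraph.pathParam_singleton]
  rw [improveKey, when, runs_ite]
  simp only [BExp.holds, NExp.eval_get, NExp.eval_zero, NExp.eval_add, he, hI.src_eq, hI.tgt_eq,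
    hI.isP_eq, hcond]
  refine ⟨fun hg => ?_, fun hg => ?_⟩
  · rw [runs_block_cons, runs_setN, runs_block_cons, runs_setR, runs_block_single]
    set σ1 := Store.setReal _ .kap _ _ _ with hσ1
    have ekx : σ1.nat .kx 0 0 = G.tgt e := by
      simp [hσ1, he, hI.tgt_eq]
    have ekap : σ1.real .kap 0 0 = G.ratio t e := by
      have h1 : σ1.real .kap 0 0 = (σ.real .cst (G.src e) 0 + G.cost e - σ.real .cst (G.tgt e) 0) /
          ((σ.nat .cnt (G.src e) 0 + (if e ∈ G.param then 1 else 0) - σ.nat .cnt (G.tgt e) 0 : ℕ) : ℝ) := by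
        simp [hσ1, he, hI.tgt_eq, hI.src_eq, hI.isP_eq, hI.cost_eq]
      rw [h1, Nat.cast_sub (hcond.2 hg).le, hP.cst_eq, hP.cst_eq, hP.cnt_eq, hP.cnt_eq,
        ParamGraph.ratio, ParamGraph.pathParam_append, ParamGraph.pathParam_singleton,
        ParamGraph.pathCost_append, ParamGraph.pathCost_singleton]
    have hH1 : Heap n H σ1 := hK.heap.congr rfl rfl rfl rfl rfl rfl rfl rfl rfl
    have hK1 : Keys G t V F H σ1 := hK.congr hH1 rfl rfl
    have hp1 : pot σ1 = pot σ := rfl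
    rw [runs_ite]
    simp only [BExp.holds, NExp.eval_get, NExp.eval_zero, ekx, hH1.inHeap]
    refine ⟨fun hin => ?_, fun hin => ?_⟩
    · have hnot : (G.tgt e : ℕ) ∉ H := by
        intro h; simp [h] at hin
      rw [runs_block_cons, runs_setN, runs_block_single]
      set σ2 := Store.setNat _ .vEdge _ _ _ with hσ2
      have hv2 : ∀ y, σ2.nat .vEdge y 0 = if y = G.tgt e then (e : ℕ) else σ.nat .vEdge y 0 := by
        intro y
        simp [hσ2, hσ1, he, hI.tgt_eq]
      have hH2 : Heap n H σ2 := hH1.congr rfl rfl rfl rfl rfl rfl rfl rfl rfl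
      have ekx2 : σ2.nat .kx 0 0 = G.tgt e := ekx
      have ekap2 : σ2.real .kap 0 0 = G.ratio t e := ekap
      have hp2 : pot σ2 = pot σ := rfl
      refine (heapInsert_runs hH2 (by rw [ekx2]; exact (G.tgt e).2) (by rwa [ekx2])).mono_frame ?_
      rintro τ s ⟨h1, h2, h3⟩ f
      rw [ekx2] at h1 h2
      rw [ekap2] at h2
      refine ⟨⟨_, hK.insert hg h1 h2 (by rw [f.1 .vEdge rfl]; exact hv2) fun h => absurd h hnot⟩, ?_⟩
      simp only [BExp.time, RExp.time_get, RExp.time_ofN, RExp.time_add, RExp.time_sub,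
        RExp.time_div, NExp.time_get, NExp.time_zero, NExp.time_add, NExp.time_sub]
      omega
    · have hmem : (G.tgt e : ℕ) ∈ H := by
        by_contra h; simp [h] at hin
      rw [when, runs_ite]
      simp only [BExp.holds, RExp.eval_get, NExp.eval_get, NExp.eval_zero, ekx, ekap]
      refine ⟨fun hlt => ?_, fun hlt => ?_⟩
      · rw [runs_block_cons, runs_setN, runs_block_single]
        set σ2 := Store.setNat _ .vEdge _ _ _ with hσ2
        have hv2 : ∀ y, σ2.nat .vEdge y 0 = if y = G.tgt e then (e : ℕ) else σ.nat .vEdge y 0 := by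
          intro y
          simp [hσ2, hσ1, he, hI.tgt_eq]
        have hH2 : Heap n H σ2 := hH1.congr rfl rfl rfl rfl rfl rfl rfl rfl rfl
        have ekx2 : σ2.nat .kx 0 0 = G.tgt e := ekx
        have ekap2 : σ2.real .kap 0 0 = G.ratio t e := ekap
        have hp2 : pot σ2 = pot σ := rfl
        refine (heapDecrease_runs hH2 (by rwa [ekx2])
          (by rw [ekap2, ekx2]; exact hlt.le)).mono_frame ?_
        rintro τ s ⟨h1, h2, h3⟩ f
        rw [ekx2] at h2
        rw [ekap2] at h2
        refine ⟨⟨_, hK.insert hg (by rwa [Finset.insert_eq_of_mem hmem]) h2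
          (by rw [f.1 .vEdge rfl]; exact hv2) fun _ => hlt.le⟩, ?_⟩
        simp only [BExp.time, RExp.time_get, RExp.time_ofN, RExp.time_add, RExp.time_sub,
          RExp.time_div, NExp.time_get, NExp.time_zero, NExp.time_add, NExp.time_sub]
        omega
      · rw [runs_skip]
        refine ⟨⟨H, hK1.heap, hK1.edge, ?_⟩, ?_⟩
        · rintro f (rfl | hf) hgf
          · exact ⟨hmem, not_lt.1 hlt⟩
          · exact hK1.le f hf hgf
        · simp only [BExp.time, RExp.time_get, RExp.time_ofN, RExp.time_add, RExp.time_sub,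
            RExp.time_div, NExp.time_get, NExp.time_zero, NExp.time_add, NExp.time_sub]
          omega
  · rw [runs_skip]
    refine ⟨⟨H, hK.heap, hK.edge, ?_⟩, ?_⟩
    · rintro f (rfl | hf) hgf
      · exact absurd hgf hg
      · exact hK.le f hf hgf
    · simp only [BExp.time, NExp.time_get, NExp.time_zero, NExp.time_add]
      omega

/-- A loop that runs through a list. -/
theorem Runs.chain {p : Stmt} {next : ℕ → ℕ} (I : List (Fin m) → ℕ → Store → Prop)
    (hstep : ∀ e l k σ, I (e :: l) k σ → σ.nat .se 0 0 = e + 1 →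
      Runs p σ (fun τ t => ∃ k', I l k' τ ∧ τ.nat .se 0 0 = next e ∧ t + k' + 7 ≤ k))
    {l : List (Fin m)} {k : ℕ} {σ : Store} (h : I l k σ) (hl : Chain next (σ.nat .se 0 0) l) :
    Runs (.loop (.neN NVar.se.val 0) p) σ (fun τ t => ∃ k', I [] k' τ ∧ t + k' ≤ k + 7) := by
  refine (Runs.loop (fun k σ => ∃ l, I l k σ ∧ Chain next (σ.nat .se 0 0) l) ?_
    ⟨l, h, hl⟩).mono ?_
  · rintro k σ ⟨l, hI, hc⟩ hb
    simp only [BExp.holds, NExp.eval_get, NExp.eval_zero] at hb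
    cases l with
    | nil => exact absurd hc hb
    | cons e l =>
      refine (hstep e l k σ hI hc.1).mono ?_
      rintro τ t ⟨k', h1, h2, h3⟩
      refine ⟨k', ⟨l, h1, by rw [h2]; exact hc.2⟩, ?_⟩
      simp only [BExp.time, NExp.time_get, NExp.time_zero]
      omega
  · rintro τ t ⟨k', ⟨l, hI, hc⟩, hb, hk⟩
    simp only [BExp.holds, NExp.eval_get, NExp.eval_zero, not_not] at hb
    cases l with
    | nil =>
      refine ⟨k', hI, ?_⟩
      simp only [BExp.time, NExp.time_get, NExp.time_zero] at hk
      omega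
    | cons e l =>
      have := hc.1
      omega

theorem examine_runs {A : NVar} (hA : improveKey.writesN A = false) (hke : A ≠ .ke) (hse : A ≠ .se)
    {t : Fin n → List (Fin m)} {V : Set (Fin n)} {F : Set (Fin m)}
    {H : Finset ℕ} {σ : Store} {l : List (Fin m)} (hP : Paths G t σ) (hK : Keys G t V F H σ)
    (hl : Chain (fun i => σ.nat A i 0) (σ.nat .se 0 0) l) :
    Runs (.loop (.neN NVar.se.val 0) (block [
      NVar.ke.put (NVar.se.val - 1), improveKey, NVar.se.put (A.ix (NVar.se.val - 1))])) σ
      (fun τ s => (∃ H', Keys G t V (F ∪ {e | e ∈ l}) H' τ) ∧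
        s + 1000 * pot τ ≤ 1000 * pot σ + 9000 * l.length + 10) := by
  refine (Runs.chain (next := fun i => σ.nat A i 0) (fun rem k σ' => Paths G t σ' ∧
    σ'.nat A = σ.nat A ∧ (∃ H' F', Keys G t V F' H' σ' ∧ F ⊆ F' ∧ ∀ e ∈ l, e ∈ F' ∨ e ∈ rem) ∧
    9000 * rem.length + 1000 * pot σ' ≤ k) ?_
    ⟨hP, rfl, ⟨H, F, hK, Set.Subset.rfl, fun e he => Or.inr he⟩, le_rfl⟩ hl).mono ?_
  · rintro e rem k σ' ⟨hP', hA', ⟨H', F', hK', hFF, hrem⟩, hk⟩ he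
    rw [runs_block_cons, runs_setN, runs_block_cons]
    set σ1 := Store.setNat _ .ke _ _ _ with hσ1
    have hP1 : Paths G t σ1 :=
      ⟨hP'.input.congr rfl rfl rfl rfl rfl rfl rfl, hP'.cst_eq, hP'.cnt_eq⟩
    have hK1 : Keys G t V F' H' σ1 :=
      hK'.congr (hK'.heap.congr rfl rfl rfl rfl rfl rfl rfl rfl rfl) rfl rfl
    have hke1 : σ1.nat .ke 0 0 = e := by simp [hσ1, he]
    have hA1 : σ1.nat A = σ.nat A := by
      rw [← hA']
      funext i j
      simp [hσ1, hke]
    have hp1 : pot σ1 = pot σ' := rfl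
    refine (improveKey_runs hP1 hK1 hke1).mono_frame ?_
    rintro τ s ⟨⟨H'', hK2⟩, hs⟩ f
    have hP2 := hP1.frame f rfl rfl
    rw [runs_block_single, runs_setN]
    set τ1 := Store.setNat _ .se _ _ _ with hτ1
    have hse2 : τ.nat .se 0 0 = e + 1 := by rw [f.1 .se rfl]; exact he
    refine ⟨9000 * rem.length + 1000 * pot τ, ⟨⟨hP2.input.congr rfl rfl rfl rfl rfl rfl rfl,
      hP2.cst_eq, hP2.cnt_eq⟩, ?_, ⟨H'', insert e F', hK2.congr
      (hK2.heap.congr rfl rfl rfl rfl rfl rfl rfl rfl rfl) rfl rfl,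
      hFF.trans (Set.subset_insert _ _), ?_⟩, le_rfl⟩, ?_, ?_⟩
    · rw [← hA1, ← f.1 A hA]
      funext i j
      simp [hτ1, hse]
    · intro g hg
      rcases hrem g hg with h | h
      · exact Or.inl (Or.inr h)
      · rcases List.mem_cons.1 h with rfl | h
        · exact Or.inl (Or.inl rfl)
        · exact Or.inr h
    · rw [← hA1, ← f.1 A hA]
      simp [hτ1, hse2]
    · rw [List.length_cons] at hk
      simp only [NExp.time_get, NExp.time_zero, NExp.time_sub, NExp.time_one]
      omega
  · rintro τ s ⟨k', ⟨-, -, ⟨H', F', hK', hFF, hrem⟩, hk⟩, hs⟩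
    refine ⟨⟨H', hK'.mono Set.Subset.rfl ?_⟩, ?_⟩
    · rintro e (he | he)
      · exact hFF he
      · exact (hrem e he).resolve_right List.not_mem_nil
    · omega

theorem discard_runs {t : Fin n → List (Fin m)} {V : Set (Fin n)} {F : Set (Fin m)}
    {H : Finset ℕ} {σ : Store} {v : Fin n} (hK : Keys G t V F H σ) (hv : σ.nat .sw 0 0 = v)
    (hF : ∀ e ∈ F, G.tgt e ≠ v) :
    Runs (when (.eqN (NVar.inHeap.ix NVar.sw.val) 1) (heapDelete NVar.sw.val)) σ
      (fun τ s => (∃ H', Keys G t (insert v V) F H' τ) ∧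
        s + 1000 * pot τ ≤ 1000 * pot σ + 10000 * (Nat.log 2 n + 1) + 20) := by
  rw [when, runs_ite]
  simp only [BExp.holds, NExp.eval_get, NExp.eval_zero, NExp.eval_one, hv, hK.heap.inHeap]
  refine ⟨fun h => ?_, fun h => ?_⟩
  · have hmem : (v : ℕ) ∈ H := by
      by_contra h1; simp [h1] at h
    refine (heapDelete_runs hK.heap (by rwa [hv])).mono_frame ?_
    rintro τ s ⟨h1, h2⟩ f
    rw [hv] at h1
    refine ⟨⟨_, h1, fun w hw hw' => ?_, fun e he hg => ?_⟩, ?_⟩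
    · rw [f.1 .vEdge rfl, f.2 .key rfl]
      refine hK.edge w (Finset.mem_of_mem_erase hw) (hw'.resolve_left fun h3 => ?_)
      exact Finset.ne_of_mem_erase hw (congrArg _ h3)
    · rw [f.2 .key rfl]
      obtain ⟨h3, h4⟩ := hK.le e he hg
      exact ⟨Finset.mem_erase.2 ⟨fun h5 => hF e he (Fin.ext h5), h3⟩, h4⟩
    · simp only [BExp.time, NExp.time_get, NExp.time_zero, NExp.time_one]
      omega
  · have hmem : (v : ℕ) ∉ H := by
      intro h1; simp [h1] at h
    rw [runs_skip]
    refine ⟨⟨H, hK.heap, fun w hw hw' => hK.edge w hw (hw'.resolve_left ?_), hK.le⟩, ?_⟩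
    · rintro rfl
      exact hmem hw
    · simp only [BExp.time, NExp.time_get, NExp.time_zero, NExp.time_one]
      omega

/-- The time in which a vertex and its incident edges are processed, up to a constant. -/
def ParamGraph.effort (G : ParamGraph n m) (v : Fin n) : ℕ :=
  Nat.log 2 n + 1 + (Finset.univ.filter fun e => G.tgt e = v).card +
    (Finset.univ.filter fun e => G.src e = v).card

/-- The array `sub` holds the list `L` of vertices. -/
structure Listed (L : List (Fin n)) (σ : Store) : Prop where
  length_eq : σ.nat .subN 0 0 = L.length
  get_eq : ∀ (i : ℕ) (hi : i < L.length), σ.nat .sub i 0 = L[i]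

theorem IncLists.exists_chain {f : Fin m → Fin n} {next head : ℕ → ℕ}
    (h : IncLists f next head m) (v : Fin n) : ∃ l : List (Fin m), Chain next (head v) l ∧
      l.Nodup ∧ (∀ e, e ∈ l ↔ f e = v) ∧
      l.length = (Finset.univ.filter fun e => f e = v).card := by
  obtain ⟨l, h1, h2, h3⟩ := h v
  have h4 : ∀ e, e ∈ l ↔ f e = v := fun e => by rw [h3]; exact and_iff_left e.2
  refine ⟨l, h1, h2, h4, ?_⟩
  rw [← List.toFinset_card_of_nodup h2]
  congr 1
  ext e
  simp [h4]

theorem updateKeys_runs {t : Fin n → List (Fin m)} {H : Finset ℕ} {σ : Store} {L : List (Fin n)}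
    (hP : Paths G t σ) (hA : Adj G m σ) (hL : Listed L σ) (hnd : L.Nodup)
    (hK : Keys G t {v | v ∉ L} {e | G.tgt e ∉ L ∧ G.src e ∉ L} H σ) :
    Runs updateKeys σ (fun τ s => (∃ H', Keys G t Set.univ Set.univ H' τ) ∧
      s + 1000 * pot τ ≤ 1000 * pot σ + 20000 * (L.map G.effort).sum + 100) := by
  refine (Runs.forUpTo (A := .si) (e := NVar.subN.val) L.length (fun i k σ => Paths G t σ ∧
    Adj G m σ ∧ Listed L σ ∧ (∃ H, Keys G t {v | v ∉ L.drop i}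
      {e | G.tgt e ∉ L.drop i ∧ G.src e ∉ L.drop i} H σ) ∧
    20000 * ((L.drop i).map G.effort).sum + 1000 * pot σ ≤ k) ?_ rfl
    (fun i k σ h => h.2.2.1.length_eq) ?_
    (k := 20000 * (L.map G.effort).sum + 1000 * pot σ)).mono ?_
  · exact ⟨⟨hP.input.congr rfl rfl rfl rfl rfl rfl rfl, hP.cst_eq, hP.cnt_eq⟩, hA,
      ⟨hL.length_eq, hL.get_eq⟩, ⟨H, hK.congr
      (hK.heap.congr rfl rfl rfl rfl rfl rfl rfl rfl rfl) rfl rfl⟩, le_rfl⟩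
  · rintro i k σ hi ⟨hP, hA, hL, ⟨H, hK⟩, hk⟩ hsi
    set v := L[i] with hv
    have hdrop : L.drop i = v :: L.drop (i + 1) := List.drop_eq_getElem_cons hi
    have hvnot : v ∉ L.drop (i + 1) := by
      have := (hnd.sublist (List.drop_sublist i L))
      rw [hdrop] at this
      exact (List.nodup_cons.1 this).1
    rw [hdrop] at hK hk
    rw [runs_block_cons, runs_setN, runs_block_cons]
    set σ1 := Store.setNat _ .sw _ _ _ with hσ1
    have hsw1 : σ1.nat .sw 0 0 = v := by
      simp [hσ1, hsi, hL.get_eq i hi, hv]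
    have hP1 : Paths G t σ1 := ⟨hP.input.congr rfl rfl rfl rfl rfl rfl rfl, hP.cst_eq, hP.cnt_eq⟩
    have hp1 : pot σ1 = pot σ := rfl
    have hK1 : Keys G t {w | w ∉ v :: L.drop (i + 1)}
        {e | G.tgt e ∉ v :: L.drop (i + 1) ∧ G.src e ∉ v :: L.drop (i + 1)} H σ1 :=
      hK.congr (hK.heap.congr rfl rfl rfl rfl rfl rfl rfl rfl rfl) rfl rfl
    refine (discard_runs hK1 hsw1 fun e he h => he.1 (h ▸ List.mem_cons_self)).mono_frame ?_
    rintro σ2 s2 ⟨⟨H2, hK2⟩, hs2⟩ f2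
    have hP2 := hP1.frame f2 rfl rfl
    have hA2 : Adj G m σ2 := Adj.frame (σ := σ1) hA f2 rfl
    have hsw2 : σ2.nat .sw 0 0 = v := by rw [f2.1 .sw rfl, hsw1]
    obtain ⟨lin, hlin, -, hmin, hcin⟩ := hA2.2.exists_chain v
    obtain ⟨lout, hlout, -, hmout, hcout⟩ := hA2.1.exists_chain v
    rw [runs_block_cons, runs_setN, runs_block_cons]
    set σ3 := Store.setNat _ .se _ _ _ with hσ3
    have hP3 : Paths G t σ3 :=
      ⟨hP2.input.congr rfl rfl rfl rfl rfl rfl rfl, hP2.cst_eq, hP2.cnt_eq⟩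
    have hp3 : pot σ3 = pot σ2 := rfl
    have hsw3 : σ3.nat .sw 0 0 = v := hsw2
    have hse3 : σ3.nat .se 0 0 = σ2.nat .inHead v 0 := by simp [hσ3, hsw2]
    refine (examine_runs (A := .inNext) rfl (by decide) (by decide) hP3
      (hK2.congr (hK2.heap.congr rfl rfl rfl rfl rfl rfl rfl rfl rfl) rfl rfl)
      (by rw [hse3]; exact hlin)).mono_frame ?_
    rintro σ4 s4 ⟨⟨H4, hK4⟩, hs4⟩ f4
    have hP4 := hP3.frame f4 rfl rfl
    have hsw4 : σ4.nat .sw 0 0 = v := by rw [f4.1 .sw rfl, hsw3]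
    rw [runs_block_cons, runs_setN, runs_block_single]
    set σ5 := Store.setNat _ .se _ _ _ with hσ5
    have hP5 : Paths G t σ5 :=
      ⟨hP4.input.congr rfl rfl rfl rfl rfl rfl rfl, hP4.cst_eq, hP4.cnt_eq⟩
    have hp5 : pot σ5 = pot σ4 := rfl
    have hse5 : σ5.nat .se 0 0 = σ2.nat .outHead v 0 := by
      have : σ5.nat .se 0 0 = σ4.nat .outHead v 0 := by simp [hσ5, hsw4]
      rw [this, f4.1 .outHead rfl]
      rfl
    have hnext5 : (fun i => σ5.nat .outNext i 0) = fun i => σ2.nat .outNext i 0 := by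
      change (fun i => σ4.nat .outNext i 0) = _
      rw [f4.1 .outNext rfl]
      rfl
    refine (examine_runs (A := .outNext) rfl (by decide) (by decide) hP5
      (hK4.congr (hK4.heap.congr rfl rfl rfl rfl rfl rfl rfl rfl rfl) rfl rfl)
      (by rw [hse5, hnext5]; exact hlout)).mono_frame ?_
    rintro σ6 s6 ⟨⟨H6, hK6⟩, hs6⟩ f6
    have hP6 := hP5.frame f6 rfl rfl
    have hA4 : Adj G m σ4 := Adj.frame (σ := σ3) hA2 f4 rfl
    have hA6 : Adj G m σ6 := Adj.frame (σ := σ5) hA4 f6 rfl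
    have hL6 : Listed L σ6 := by
      constructor
      · rw [f6.1 .subN rfl]
        change σ4.nat .subN 0 0 = _
        rw [f4.1 .subN rfl]
        change σ2.nat .subN 0 0 = _
        rw [f2.1 .subN rfl]
        exact hL.length_eq
      · rw [f6.1 .sub rfl]
        change ∀ (i : ℕ) (hi : i < L.length), σ4.nat .sub i 0 = _
        rw [f4.1 .sub rfl]
        change ∀ (i : ℕ) (hi : i < L.length), σ2.nat .sub i 0 = _
        rw [f2.1 .sub rfl]
        exact hL.get_eq
    refine ⟨20000 * ((L.drop (i + 1)).map G.effort).sum + 1000 * pot σ6,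
      ⟨⟨hP6.input.congr rfl rfl rfl rfl rfl rfl rfl, hP6.cst_eq, hP6.cnt_eq⟩, hA6,
      ⟨hL6.length_eq, hL6.get_eq⟩, ⟨H6, (hK6.mono ?_ ?_).congr
      (hK6.heap.congr rfl rfl rfl rfl rfl rfl rfl rfl rfl) rfl rfl⟩, le_rfl⟩, ?_⟩
    · intro w hw
      by_cases hwv : w = v
      · exact Or.inl hwv
      · exact Or.inr fun h => hw ((List.mem_cons.1 h).resolve_left hwv)
    · rintro e ⟨h1, h2⟩
      by_cases h3 : G.tgt e = v
      · exact Or.inl (Or.inr ((hmin e).2 h3))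
      · by_cases h4 : G.src e = v
        · exact Or.inr ((hmout e).2 h4)
        · exact Or.inl (Or.inl ⟨fun h => h1 ((List.mem_cons.1 h).resolve_left h3),
            fun h => h2 ((List.mem_cons.1 h).resolve_left h4)⟩)
    · have heff : G.effort v = Nat.log 2 n + 1 + lin.length + lout.length := by
        rw [hcin, hcout]; rfl
      rw [List.map_cons, List.sum_cons, heff] at hk
      simp only [NExp.time_get, NExp.time_zero]
      omega
  · rintro τ s ⟨k', ⟨-, -, -, ⟨H, hK⟩, hk⟩, hs⟩
    rw [List.drop_length] at hK
    refine ⟨⟨H, hK.mono (fun v _ => List.not_mem_nil)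
      fun e _ => ⟨List.not_mem_nil, List.not_mem_nil⟩⟩, ?_⟩
    simp only [NExp.time_get, NExp.time_zero] at hs
    omega

theorem isHeap_empty {N : ℕ} {h : HeapData} {key : ℕ → ℝ} (hN : h.hpar N = N)
    (hdeg : ∀ x, h.deg x = 0) (hmark : ∀ x, h.mark x = 0) : HeapData.IsHeap N ∅ h key := by
  refine ⟨⟨by simp, by simp, ?_, ?_, ?_⟩, ⟨by simp, subset_rfl, hN, by simp, by simp,
    ⟨fun _ => 0, by simp⟩, fun x => by simp [hmark], by simp, fun x _ _ => ⟨hdeg x, hmark x⟩⟩,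
    by simp⟩ <;>
  · intro p i hi
    simp [hdeg] at hi

theorem initKeys_runs {t : Fin n → List (Fin m)} {σ : Store} (hP : Paths G t σ)
    (hdeg : ∀ x, σ.nat .deg x 0 = 0) (hmark : ∀ x, σ.nat .mark x 0 = 0)
    (hbucket : ∀ x, σ.nat .bucket x 0 = 0) (hin : ∀ x, σ.nat .inHeap x 0 = 0) :
    Runs initKeys σ (fun τ s => (∃ H, Keys G t Set.univ Set.univ H τ) ∧
      (∀ v : Fin n, τ.nat .par0 v 0 = σ.nat .par v 0) ∧
      s + 1000 * pot τ ≤ 100 * n + 9000 * m + 100) := by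
  rw [initKeys, runs_block_cons]
  refine (Runs.forUpTo (A := .ie) (e := NVar.n.val) n (fun i k τ => Paths G t τ ∧
    τ.nat .par = σ.nat .par ∧ (∀ j, j < i → τ.nat .par0 j 0 = σ.nat .par j 0) ∧
    100 * (n - i) ≤ k) (k := 100 * n) ?_ rfl (fun i k σ h => h.1.input.n_eq) ?_).mono_frame ?_
  · exact ⟨⟨hP.input.congr rfl rfl rfl rfl rfl rfl rfl, hP.cst_eq, hP.cnt_eq⟩, rfl,
      fun j hj => absurd hj (Nat.not_lt_zero _), by omega⟩
  · rintro i k τ hi ⟨hP, hpar, hpar0, hk⟩ hie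
    rw [runs_setN]
    refine ⟨100 * (n - (i + 1)), ⟨⟨hP.input.congr rfl rfl rfl rfl rfl rfl rfl, hP.cst_eq,
      hP.cnt_eq⟩, hpar, fun j hj => ?_, le_rfl⟩, ?_⟩
    · rcases Nat.lt_succ_iff_lt_or_eq.1 hj with h | rfl
      · simp [hie, h.ne, hpar0 j h]
      · simp [hie, hpar]
    · simp only [NExp.time_get, NExp.time_zero]
      omega
  · rintro σ1 s1 ⟨k1, ⟨hP1, -, hpar1, hk1⟩, hs1⟩ f1
    rw [runs_block_cons, runs_setN, runs_block_single]
    set σ2 := Store.setNat _ .hpar _ _ _ with hσ2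
    have hP2 : Paths G t σ2 :=
      ⟨hP1.input.congr rfl rfl rfl rfl rfl rfl rfl, hP1.cst_eq, hP1.cnt_eq⟩
    have hdeg2 : ∀ x, σ2.nat .deg x 0 = 0 := by
      intro x
      change σ1.nat .deg x 0 = 0
      rw [f1.1 .deg rfl, hdeg]
    have hmark2 : ∀ x, σ2.nat .mark x 0 = 0 := by
      intro x
      change σ1.nat .mark x 0 = 0
      rw [f1.1 .mark rfl, hmark]
    have hH2 : Heap n ∅ σ2 := by
      refine ⟨hP2.input.n_eq, isHeap_empty ?_ hdeg2 hmark2, fun x => ?_, fun x => ?_⟩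
      · simp [heapData, hσ2, hP1.input.n_eq]
      · change σ1.nat .bucket x 0 = 0
        rw [f1.1 .bucket rfl, hbucket]
      · change σ1.nat .inHeap x 0 = _
        rw [f1.1 .inHeap rfl, hin]
        simp
    have hpot2 : pot σ2 = 0 := by
      simp [pot, HeapData.potential, heapData, hdeg2, hmark2]
    refine (Runs.forUpTo (A := .ke) (e := NVar.m.val) m (fun i k σ => Paths G t σ ∧
      (∃ H, Keys G t Set.univ {e | (e : ℕ) < i} H σ) ∧
      9000 * (m - i) + 1000 * pot σ ≤ k) (k := 9000 * m) ?_ rfl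
      (fun i k σ h => h.1.input.m_eq) ?_).mono_frame ?_
    · refine ⟨⟨hP2.input.congr rfl rfl rfl rfl rfl rfl rfl, hP2.cst_eq, hP2.cnt_eq⟩,
        ⟨∅, hH2.congr rfl rfl rfl rfl rfl rfl rfl rfl rfl, fun v hv => absurd hv (Finset.notMem_empty _),
        fun e he => absurd he (Nat.not_lt_zero _)⟩, ?_⟩
      have : pot (σ2.setNat .ke 0 0 0) = 0 := hpot2
      omega
    · rintro i k σ' hi ⟨hP', ⟨H, hK⟩, hk⟩ hke
      obtain ⟨e, rfl⟩ : ∃ e : Fin m, i = e := ⟨⟨i, hi⟩, rfl⟩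
      refine (improveKey_runs hP' hK hke).mono_frame ?_
      rintro τ s ⟨⟨H', hK'⟩, hs⟩ f
      have hP'' := hP'.frame f rfl rfl
      refine ⟨9000 * (m - (e + 1)) + 1000 * pot τ,
        ⟨⟨hP''.input.congr rfl rfl rfl rfl rfl rfl rfl, hP''.cst_eq, hP''.cnt_eq⟩,
        ⟨H', (hK'.mono Set.Subset.rfl fun f hf => ?_).congr
          (hK'.heap.congr rfl rfl rfl rfl rfl rfl rfl rfl rfl) rfl rfl⟩, le_rfl⟩, ?_⟩
      · rcases Nat.lt_succ_iff_lt_or_eq.1 (show (f : ℕ) < e + 1 from hf) with h | h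
        · exact Or.inr h
        · exact Or.inl (Fin.ext h)
      · simp only [NExp.time_get, NExp.time_zero]
        omega
    · rintro τ s ⟨k', ⟨-, ⟨H, hK⟩, hk⟩, hs⟩ f
      refine ⟨⟨H, hK.mono Set.Subset.rfl fun e _ => e.2⟩, fun v => ?_, ?_⟩
      · rw [f.1 .par0 rfl]
        exact hpar1 v v.2
      · simp only [NExp.time_get, NExp.time_zero] at hs hs1 ⊢
        omega


variable {n m : ℕ} {G : ParamGraph n m}

/-! ## The subtree below a vertex -/

/-- The vertices in `L` have been found in the subtree with root `v`, after the edges in `E` have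
been scanned. -/
structure Search (G : ParamGraph n m) (par : Fin n → ℕ) (t : Fin n → List (Fin m)) (v : Fin n)
    (L : List (Fin n)) (E : Set (Fin m)) (σ : Store) : Prop where
  listed : Listed L σ
  nodup : L.Nodup
  root : v ∈ L
  prefix_of_mem : ∀ w ∈ L, t v <+: t w
  closed : ∀ e ∈ E, par (G.tgt e) = e + 1 → G.tgt e ∈ L
  parent : ∀ w ∈ L, w ≠ v → ∃ e ∈ E, par w = e + 1
  inSub : ∀ w : Fin n, σ.nat .inSub w 0 = if w ∈ L then 1 else 0

theorem Search.congr {par : Fin n → ℕ} {t : Fin n → List (Fin m)} {v : Fin n} {L : List (Fin n)}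
    {E : Set (Fin m)} {σ τ : Store} (h : Search G par t v L E σ) (h1 : τ.nat .sub = σ.nat .sub)
    (h2 : τ.nat .subN = σ.nat .subN) (h3 : τ.nat .inSub = σ.nat .inSub) :
    Search G par t v L E τ :=
  ⟨⟨by rw [h2]; exact h.listed.length_eq, by rw [h1]; exact h.listed.get_eq⟩, h.nodup, h.root,
    h.prefix_of_mem, h.closed, h.parent, by rw [h3]; exact h.inSub⟩

theorem scan_runs {par : Fin n → ℕ} {t : Fin n → List (Fin m)} {v : Fin n} {L : List (Fin n)}
    {E : Set (Fin m)} {σ : Store} {e : Fin m} (hI : Input G σ)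
    (hT : G.ParentTree Set.univ par t) (hpar : ∀ w : Fin n, σ.nat .par w 0 = par w)
    (hS : Search G par t v L E σ) (he : e ∉ E) (hsrc : G.src e ∈ L) (hse : σ.nat .se 0 0 = e + 1) :
    Runs (when (.eqN (NVar.par.ix (NVar.tgt.ix (NVar.se.val - 1))) NVar.se.val) (block [
        NVar.sub.put1 NVar.subN.val (NVar.tgt.ix (NVar.se.val - 1)),
        NVar.subN.put (NVar.subN.val + 1),
        NVar.inSub.put1 (NVar.tgt.ix (NVar.se.val - 1)) 1])) σ
      (fun τ s => (∃ Q, Search G par t v (L ++ Q) (insert e E) τ) ∧ s ≤ 100) := by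
  rw [when, runs_ite]
  simp only [BExp.holds, NExp.eval_get, NExp.eval_zero, NExp.eval_one, NExp.eval_sub, hse,
    Nat.add_sub_cancel, hI.tgt_eq, hpar]
  refine ⟨fun h => ?_, fun h => ?_⟩
  · have h1 := (hT.of_parent (Set.mem_univ _) h).2
    have h2 : t v <+: t (G.src e) := hS.prefix_of_mem _ hsrc
    have hnot : G.tgt e ∉ L := by
      intro h3
      by_cases h4 : G.tgt e = v
      · rw [← h4, h1] at h2
        have := h2.length_le
        simp at this
      · obtain ⟨f, hf, hpf⟩ := hS.parent _ h3 h4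
        have : f = e := Fin.ext (by omega)
        exact he (this ▸ hf)
    rw [runs_block_cons, runs_setN, runs_block_cons, runs_setN, runs_block_single, runs_setN]
    set τ := Store.setNat _ .inSub _ _ _ with hτ
    refine ⟨⟨[G.tgt e], ⟨⟨?_, ?_⟩, ?_, ?_, ?_, ?_, ?_, ?_⟩⟩, ?_⟩
    · simp [hτ, hS.listed.length_eq]
    · intro i hi
      rw [List.length_append, List.length_singleton] at hi
      have : τ.nat .sub i 0 = if i = L.length then (G.tgt e : ℕ) else σ.nat .sub i 0 := by
        simp [hτ, hS.listed.length_eq, hse, hI.tgt_eq]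
      rw [this]
      split_ifs with h3
      · subst h3
        simp
      · rw [hS.listed.get_eq i (by omega), List.getElem_append_left]
    · rw [List.nodup_append]
      refine ⟨hS.nodup, List.nodup_singleton _, ?_⟩
      rintro a ha b hb rfl
      exact hnot (List.mem_singleton.1 hb ▸ ha)
    · exact List.mem_append_left _ hS.root
    · intro w hw
      rcases List.mem_append.1 hw with hw | hw
      · exact hS.prefix_of_mem w hw
      · rw [List.mem_singleton.1 hw, h1]
        exact h2.trans (List.prefix_append _ _)
    · rintro f (rfl | hf) hpf
      · exact List.mem_append_right _ (List.mem_singleton_self _)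
      · exact List.mem_append_left _ (hS.closed f hf hpf)
    · intro w hw hwv
      rcases List.mem_append.1 hw with hw | hw
      · obtain ⟨f, hf, hpf⟩ := hS.parent w hw hwv
        exact ⟨f, Or.inr hf, hpf⟩
      · rw [List.mem_singleton.1 hw]
        exact ⟨e, Or.inl rfl, h⟩
    · intro w
      have : τ.nat .inSub w 0 = if w = G.tgt e then 1 else σ.nat .inSub w 0 := by
        simp [hτ, hse, hI.tgt_eq, Fin.ext_iff]
      rw [this, hS.inSub]
      by_cases h3 : w = G.tgt e <;> simp [h3]
    · simp only [BExp.time, NExp.time_get, NExp.time_zero, NExp.time_one, NExp.time_add,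
        NExp.time_sub]
      omega
  · rw [runs_skip]
    refine ⟨⟨[], ?_⟩, ?_⟩
    · rw [List.append_nil]
      refine ⟨hS.listed, hS.nodup, hS.root, hS.prefix_of_mem, ?_, fun w hw hwv => ?_, hS.inSub⟩
      · rintro f (rfl | hf) hpf
        · exact absurd hpf h
        · exact hS.closed f hf hpf
      · obtain ⟨f, hf, hpf⟩ := hS.parent w hw hwv
        exact ⟨f, Or.inr hf, hpf⟩
    · simp only [BExp.time, NExp.time_get, NExp.time_zero, NExp.time_one, NExp.time_sub]
      omega

theorem Search.mem_of_prefix {par : Fin n → ℕ} {t : Fin n → List (Fin m)} {v : Fin n}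
    {L : List (Fin n)} {σ : Store} (hT : G.ParentTree Set.univ par t)
    (hS : Search G par t v L {e | G.src e ∈ L} σ) {w : Fin n} (hw : t v <+: t w) : w ∈ L := by
  induction hk : (t w).length using Nat.strong_induction_on generalizing w with
  | _ k ih =>
    by_cases hwv : w = v
    · rw [hwv]; exact hS.root
    have hne : t v ≠ t w := fun h => hwv (hT.injOn (Set.mem_univ _) (Set.mem_univ _) h).symm
    have hws : w ≠ G.source := by
      rintro rfl
      rw [hT.source_path] at hw hne
      exact hne (List.prefix_nil.1 hw)
    obtain ⟨e, hpe, rfl, -, hte⟩ := hT.parent w (Set.mem_univ _) hws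
    rw [hte, List.prefix_concat_iff] at hw
    rw [hte] at hne hk
    have hmem := ih _ (by rw [← hk]; simp) (hw.resolve_left hne) rfl
    exact hS.closed e hmem hpe

theorem searchSubtree_runs {par : Fin n → ℕ} {t : Fin n → List (Fin m)} {v : Fin n} {σ : Store}
    (hI : Input G σ) (hA : Adj G m σ) (hT : G.ParentTree Set.univ par t)
    (hpar : ∀ w : Fin n, σ.nat .par w 0 = par w) (hv : σ.nat .pv 0 0 = v)
    (h0 : ∀ w : Fin n, σ.nat .inSub w 0 = 0) :
    Runs searchSubtree σ (fun τ s => ∃ L : List (Fin n), Listed L τ ∧ L.Nodup ∧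
      (∀ w, w ∈ L ↔ t v <+: t w) ∧ (∀ w : Fin n, τ.nat .inSub w 0 = if w ∈ L then 1 else 0) ∧
      s ≤ 300 * (L.map G.effort).sum + 100) := by
  classical
  rw [searchSubtree, runs_block_cons, runs_setN, runs_block_cons, runs_setN, runs_block_cons,
    runs_setN, runs_block_single, forUpTo, runs_block_cons, runs_setN, runs_block_single]
  set σ1 := Store.setNat _ .si _ _ _ with hσ1
  have hI1 : Input G σ1 := hI.congr rfl rfl rfl rfl rfl rfl rfl
  have hA1 : Adj G m σ1 := hA
  have hpar1 : ∀ w : Fin n, σ1.nat .par w 0 = par w := hpar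
  have hS1 : Search G par t v [v] {e | G.src e ∈ ([] : List (Fin n))} σ1 := by
    refine ⟨⟨by simp [hσ1], fun i hi => ?_⟩, List.nodup_singleton v, List.mem_singleton_self v,
      ?_, fun e he => absurd he List.not_mem_nil,
      fun w hw hwv => absurd (List.mem_singleton.1 hw) hwv, fun w => ?_⟩
    · obtain rfl : i = 0 := by simpa using hi
      simp [hσ1, hv]
    · intro w hw
      rw [List.mem_singleton.1 hw]
    · have : σ1.nat .inSub w 0 = if w = v then 1 else σ.nat .inSub w 0 := by
        simp [hσ1, hv, Fin.ext_iff]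
      rw [this, h0]
      simp
  set S : Finset (Fin n) := Finset.univ.filter fun w => t v <+: t w with hS
  refine (Runs.loop (fun k σ => Input G σ ∧ Adj G m σ ∧ (∀ w : Fin n, σ.nat .par w 0 = par w) ∧
    ∃ D Q : List (Fin n), σ.nat .si 0 0 = D.length ∧
      Search G par t v (D ++ Q) {e | G.src e ∈ D} σ ∧
      300 * ∑ w ∈ S.filter (· ∉ D), G.effort w ≤ k) ?_
      (k := 300 * ∑ w ∈ S, G.effort w)
      ⟨hI1, hA1, hpar1, [], [v], by simp [hσ1], hS1, by simp⟩).mono ?_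
  · rintro k σ ⟨hI, hA, hpar, D, Q, hsi, hS, hk⟩ hb
    simp only [BExp.holds, NExp.eval_get, NExp.eval_zero, hsi, hS.listed.length_eq,
      List.length_append] at hb
    cases Q with
    | nil => simp at hb
    | cons w Q =>
    have hwS : w ∈ S := Finset.mem_filter.2 ⟨Finset.mem_univ _,
      hS.prefix_of_mem w (List.mem_append_right _ List.mem_cons_self)⟩
    have hwD : w ∉ D := fun h =>
      (List.nodup_append.1 hS.nodup).2.2 w h w List.mem_cons_self rfl
    have hsum : ∑ w ∈ S.filter (· ∉ D), G.effort w =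
        G.effort w + ∑ u ∈ S.filter (· ∉ D ++ [w]), G.effort u := by
      rw [← Finset.add_sum_erase _ _ (Finset.mem_filter.2 ⟨hwS, hwD⟩)]
      congr 1
      refine Finset.sum_congr ?_ fun _ _ => rfl
      ext u
      simp only [Finset.mem_erase, Finset.mem_filter, List.mem_append, List.mem_singleton]
      tauto
    rw [hsum] at hk
    rw [runs_block_cons, runs_block_cons, runs_setN, runs_block_cons, runs_setN, runs_block_single]
    set σ2 := Store.setNat _ .se _ _ _ with hσ2
    have hI2 : Input G σ2 := hI.congr rfl rfl rfl rfl rfl rfl rfl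
    have hpar2 : ∀ w : Fin n, σ2.nat .par w 0 = par w := hpar
    have hS2 : Search G par t v (D ++ w :: Q) {e | G.src e ∈ D} σ2 := hS.congr rfl rfl rfl
    obtain ⟨l, hl, hlnd, hmem, hcard⟩ := hA.1.exists_chain w
    have hsub : σ.nat .sub D.length 0 = w := by
      rw [hS.listed.get_eq _ (by simp)]
      simp
    have hse2 : σ2.nat .se 0 0 = σ.nat .outHead w 0 := by
      simp [hσ2, hsi, hsub]
    have hl' : Chain (fun i => σ2.nat .outNext i 0) (σ2.nat .se 0 0) l := by
      rw [hse2]; exact hl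
    have hln : ∀ e ∈ l, G.src e = w := fun e he => (hmem e).1 he
    refine (Runs.chain (next := fun i => σ2.nat .outNext i 0) (fun rem k τ => Input G τ ∧
      (∀ w : Fin n, τ.nat .par w 0 = par w) ∧ τ.nat .outNext = σ2.nat .outNext ∧
      (∃ Q' E, Search G par t v (D ++ w :: Q') E τ ∧ rem.Nodup ∧ (∀ e ∈ rem, e ∉ E ∧ G.src e = w) ∧
        ∀ e, e ∈ E ∨ e ∈ rem ↔ G.src e ∈ D ++ [w]) ∧
      200 * rem.length ≤ k) ?_ (k := 200 * l.length) ⟨hI2, hpar2, rfl, ⟨Q, _, hS2, ?_, ?_, ?_⟩,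
        le_rfl⟩ hl').mono_frame ?_
    · rintro e rem k σ3 ⟨hI3, hpar3, hnext3, ⟨Q', E, hS3, hnd, hrem, hE⟩, hk3⟩ hse3
      rw [runs_block_cons]
      refine (scan_runs hI3 hT hpar3 hS3 (hrem e List.mem_cons_self).1
        (by rw [(hrem e List.mem_cons_self).2]; simp) hse3).mono_frame ?_
      rintro σ4 s4 ⟨⟨Q4, hS4⟩, hs4⟩ f4
      have hI4 := hI3.frame f4 rfl
      have hse4 : σ4.nat .se 0 0 = e + 1 := by rw [f4.1 .se rfl, hse3]
      rw [runs_block_single, runs_setN]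
      refine ⟨200 * rem.length, ⟨hI4.congr rfl rfl rfl rfl rfl rfl rfl, ?_, ?_,
        ⟨Q' ++ Q4, insert e E, ?_, (List.nodup_cons.1 hnd).2, fun f hf => ⟨?_, ?_⟩, fun f => ?_⟩,
        le_rfl⟩, ?_, ?_⟩
      · change ∀ w : Fin n, σ4.nat .par w 0 = par w
        rw [f4.1 .par rfl]
        exact hpar3
      · change σ4.nat .outNext = _
        rw [f4.1 .outNext rfl, hnext3]
      · have : D ++ w :: (Q' ++ Q4) = (D ++ w :: Q') ++ Q4 := by simp
        rw [this]
        exact hS4.congr rfl rfl rfl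
      · rintro (rfl | h)
        · exact (List.nodup_cons.1 hnd).1 hf
        · exact (hrem f (List.mem_cons_of_mem _ hf)).1 h
      · exact (hrem f (List.mem_cons_of_mem _ hf)).2
      · rw [← hE f, List.mem_cons, Set.mem_insert_iff]
        tauto
      · simp [hse4, f4.1 .outNext rfl, hnext3]
      · rw [List.length_cons] at hk3
        simp only [NExp.time_get, NExp.time_zero, NExp.time_one, NExp.time_sub]
        omega
    · exact hlnd
    · intro e he
      refine ⟨fun h => hwD ?_, hln e he⟩
      rw [← hln e he]
      exact h
    · intro e
      rw [hmem, List.mem_append, List.mem_singleton]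
      rfl
    · rintro σ3 s3 ⟨k3, ⟨hI3, hpar3, hnext3, ⟨Q', E, hS3, -, -, hE⟩, hk3⟩, hs3⟩ f3
      rw [runs_block_single, runs_setN]
      have hsi3 : σ3.nat .si 0 0 = D.length := by rw [f3.1 .si rfl]; exact hsi
      have hA3 : Adj G m σ3 := Adj.frame (σ := σ2) hA f3 rfl
      refine ⟨300 * ∑ u ∈ S.filter (· ∉ D ++ [w]), G.effort u,
        ⟨hI3.congr rfl rfl rfl rfl rfl rfl rfl, hA3, hpar3, D ++ [w], Q', ?_, ?_,
        le_rfl⟩, ?_⟩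
      · simp [hsi3]
      · have h1 : (D ++ [w]) ++ Q' = D ++ w :: Q' := by simp
        have h2 : {e | G.src e ∈ D ++ [w]} = E := by
          ext e
          rw [Set.mem_ofPred_eq, ← hE e]
          simp
        rw [h1, h2]
        exact hS3.congr rfl rfl rfl
      · have heff : Nat.log 2 n + 1 + l.length ≤ G.effort w := by
          rw [ParamGraph.effort, hcard]; omega
        simp only [BExp.time, NExp.time_get, NExp.time_zero, NExp.time_one, NExp.time_add]
        omega
  · rintro τ s ⟨k', ⟨-, -, -, D, Q, hsi, hS', hk⟩, hb, hs⟩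
    simp only [BExp.holds, NExp.eval_get, NExp.eval_zero, hsi, hS'.listed.length_eq,
      List.length_append] at hb
    obtain rfl : Q = [] := List.length_eq_zero_iff.1 (by omega)
    rw [List.append_nil] at hS'
    have hD : ∀ w, w ∈ D ↔ t v <+: t w := fun w => ⟨hS'.prefix_of_mem w, hS'.mem_of_prefix hT⟩
    refine ⟨D, hS'.listed, hS'.nodup, hD, hS'.inSub, ?_⟩
    have hsum : ∑ w ∈ S, G.effort w = (D.map G.effort).sum := by
      rw [← List.sum_toFinset _ hS'.nodup]
      refine Finset.sum_congr ?_ fun _ _ => rfl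
      ext w
      simp [hS, hD]
    rw [← hsum]
    simp only [BExp.time, NExp.time_get, NExp.time_zero, NExp.time_one] at hs ⊢
    omega

theorem updatePaths_runs {t : Fin n → List (Fin m)} {e : Fin m} {σ : Store}
    {L : List (Fin n)} (hP : Paths G t σ) (hL : Listed L σ) (hnd : L.Nodup)
    (hmem : ∀ w, w ∈ L ↔ t (G.tgt e) <+: t w)
    (hin : ∀ w : Fin n, σ.nat .inSub w 0 = if w ∈ L then 1 else 0)
    (hv : σ.nat .pv 0 0 = G.tgt e) (he : σ.nat .pe 0 0 = e) (hg : G.Gains t e) :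
    Runs updatePaths σ (fun τ s =>
      Paths G (ParamGraph.rehang Set.univ t (G.tgt e) (t (G.src e) ++ [e])) τ ∧
      (∀ w : Fin n, τ.nat .inSub w 0 = 0) ∧
      (∀ w : Fin n, τ.nat .par w 0 =
        Function.update (fun w : Fin n => σ.nat .par w 0) (G.tgt e) (e + 1) w) ∧
      s ≤ 200 * L.length + 200) := by
  have hI := hP.input
  rw [updatePaths, runs_block_cons, runs_setR, runs_block_cons, runs_setN, runs_block_cons,
    runs_setN, runs_block_single]
  set σ1 := Store.setNat _ .par _ _ _ with hσ1
  have hI1 : Input G σ1 := hI.congr rfl rfl rfl rfl rfl rfl rfl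
  have hdC : σ1.real .dC 0 0 = G.pathCost (t (G.src e) ++ [e]) - G.pathCost (t (G.tgt e)) := by
    have : σ1.real .dC 0 0 =
        σ.real .cst (G.src e) 0 + G.cost e - σ.real .cst (G.tgt e) 0 := by
      simp [hσ1, hv, he, hI.src_eq, hI.cost_eq]
    rw [this, hP.cst_eq, hP.cst_eq, ParamGraph.pathCost_append, ParamGraph.pathCost_singleton]
  have hdN : σ1.nat .dN 0 0 = G.pathParam (t (G.src e) ++ [e]) - G.pathParam (t (G.tgt e)) := by
    have : σ1.nat .dN 0 0 = σ.nat .cnt (G.src e) 0 + (if e ∈ G.param then 1 else 0) -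
        σ.nat .cnt (G.tgt e) 0 := by
      simp [hσ1, hv, he, hI.src_eq, hI.isP_eq]
    rw [this, hP.cnt_eq, hP.cnt_eq, ParamGraph.pathParam_append, ParamGraph.pathParam_singleton]
  have hpar1 : ∀ w : Fin n, σ1.nat .par w 0 =
      Function.update (fun w : Fin n => σ.nat .par w 0) (G.tgt e) (e + 1) w := by
    intro w
    simp [hσ1, hv, he, Function.update_apply, Fin.ext_iff]
  have hcst1 : ∀ w : Fin n, σ1.real .cst w 0 = G.pathCost (t w) := hP.cst_eq
  have hcnt1 : ∀ w : Fin n, σ1.nat .cnt w 0 = G.pathParam (t w) := hP.cnt_eq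
  have hin1 : ∀ w : Fin n, σ1.nat .inSub w 0 = if w ∈ L then 1 else 0 := hin
  refine (Runs.forUpTo (A := .si) (e := NVar.subN.val) L.length (fun i k τ => Input G τ ∧
    Listed L τ ∧ τ.real .dC = σ1.real .dC ∧ τ.nat .dN = σ1.nat .dN ∧ τ.nat .par = σ1.nat .par ∧
    (∀ w : Fin n, τ.real .cst w 0 =
      if w ∈ L.take i then G.pathCost (t w) + σ1.real .dC 0 0 else G.pathCost (t w)) ∧
    (∀ w : Fin n, τ.nat .cnt w 0 =
      if w ∈ L.take i then G.pathParam (t w) + σ1.nat .dN 0 0 else G.pathParam (t w)) ∧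
    (∀ w : Fin n, w ∈ L.take i ∨ w ∉ L → τ.nat .inSub w 0 = 0) ∧
    100 * (L.length - i) ≤ k) (k := 100 * L.length) ?_ rfl
    (fun i k σ h => h.2.1.length_eq) ?_).mono ?_
  · refine ⟨hI1.congr rfl rfl rfl rfl rfl rfl rfl, ⟨hL.length_eq, hL.get_eq⟩, rfl, rfl, rfl,
      fun w => ?_, fun w => ?_, fun w hw => ?_, by simp⟩
    · simpa using hcst1 w
    · simpa using hcnt1 w
    · have h1 : w ∉ L := by simpa using hw
      have := hin1 w
      rw [if_neg h1] at this
      exact this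
  · rintro i k τ hi ⟨hI, hL, hdC, hdN, hpar, hcst, hcnt, hin, hk⟩ hsi
    set u := L[i] with hu
    have hnot : u ∉ L.take i := by
      intro h
      have h1 := List.take_append_drop i L
      rw [List.drop_eq_getElem_cons hi] at h1
      rw [← h1] at hnd
      exact (List.nodup_append.1 hnd).2.2 u h u List.mem_cons_self rfl
    have htake : ∀ w, w ∈ L.take (i + 1) ↔ w ∈ L.take i ∨ w = u := by
      intro w
      rw [List.take_add_one, List.getElem?_eq_getElem hi, Option.toList_some, List.mem_append,
        List.mem_singleton]
    rw [runs_block_cons, runs_setR, runs_block_cons, runs_setN, runs_block_single, runs_setN]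
    set τ1 := Store.setNat _ .inSub _ _ _ with hτ1
    refine ⟨100 * (L.length - (i + 1)), ⟨hI.congr rfl rfl rfl rfl rfl rfl rfl,
      ⟨hL.length_eq, hL.get_eq⟩, hdC, hdN, hpar, fun w => ?_, fun w => ?_, fun w hw => ?_, le_rfl⟩,
      ?_⟩
    · have : (τ1.setNat .si 0 0 (i + 1)).real .cst w 0 =
          if w = u then τ.real .cst u 0 + τ.real .dC 0 0 else τ.real .cst w 0 := by
        simp [hτ1, hsi, hL.get_eq i hi, hu, Fin.ext_iff]
      rw [this, hcst, hcst, if_neg hnot, hdC]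
      simp only [htake]
      by_cases hw : w = u
      · subst hw; simp
      · simp [hw]
    · have : (τ1.setNat .si 0 0 (i + 1)).nat .cnt w 0 =
          if w = u then τ.nat .cnt u 0 + τ.nat .dN 0 0 else τ.nat .cnt w 0 := by
        simp [hτ1, hsi, hL.get_eq i hi, hu, Fin.ext_iff]
      rw [this, hcnt, hcnt, if_neg hnot, hdN]
      simp only [htake]
      by_cases hw : w = u
      · subst hw; simp
      · simp [hw]
    · have : (τ1.setNat .si 0 0 (i + 1)).nat .inSub w 0 =
          if w = u then 0 else τ.nat .inSub w 0 := by
        simp [hτ1, hsi, hL.get_eq i hi, hu, Fin.ext_iff]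
      rw [this]
      split_ifs with h1
      · rfl
      · rw [htake] at hw
        exact hin w (hw.imp_left fun h => h.resolve_right h1)
    · simp only [NExp.time_get, NExp.time_zero, RExp.time_get, RExp.time_add, NExp.time_add]
      omega
  · rintro τ s ⟨k', ⟨hI, hL, -, -, hpar, hcst, hcnt, hin, hk⟩, hs⟩
    rw [List.take_length] at hcst hcnt hin
    refine ⟨⟨hI, fun w => ?_, fun w => ?_⟩, fun w => hin w (em _), fun w => ?_, ?_⟩
    · rw [hcst, ParamGraph.pathCost_rehang, hdC]
      simp only [hmem]
    · rw [hcnt, ParamGraph.pathParam_rehang _ _ (le_of_lt hg), hdN]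
      simp only [hmem]
    · rw [hpar, hpar1]
    · simp only [NExp.time_get, NExp.time_zero, NExp.time_one, NExp.time_add, NExp.time_sub,
        RExp.time_get, RExp.time_add, RExp.time_sub] at hs ⊢
      omega


variable {n m : ℕ} {G : ParamGraph n m}

/-! ## The sequence of trees -/

namespace ParamGraph

variable {par : Fin n → ℕ} {t : Fin n → List (Fin m)}

/-- The first breakpoint is `-∞`, the later ones are the pivot points. -/
noncomputable def breakpointAt (r : ℕ → ℝ) (i : ℕ) : EReal := if i = 0 then ⊥ else (r (i - 1) : EReal)

theorem breakpointAt_succ (r : ℕ → ℝ) (i : ℕ) : breakpointAt r (i + 1) = (r i : EReal) := rfl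

theorem breakpointAt_ne_top (r : ℕ → ℝ) (i : ℕ) : breakpointAt r i ≠ ⊤ := by
  cases i with
  | zero => exact bot_ne_top
  | succ i => exact EReal.coe_ne_top _

theorem breakpointAt_congr {r r' : ℕ → ℝ} {k i : ℕ} (h : ∀ j, j < k → r' j = r j) (hi : i ≤ k) :
    breakpointAt r' i = breakpointAt r i := by
  cases i with
  | zero => rfl
  | succ i => rw [breakpointAt_succ, breakpointAt_succ, h i hi]

/-- After `k` pivots with pivot points `r 0, …, r (k - 1)`, the trees are `T 0, …, T k`, and the
last tree is given by `par` and `t`. -/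
structure History (G : ParamGraph n m) (k : ℕ) (T : ℕ → Finset (Fin m)) (r : ℕ → ℝ)
    (par : Fin n → ℕ) (t : Fin n → List (Fin m)) : Prop where
  parentTree : G.ParentTree Set.univ par t
  last : T k = G.parentEdges par
  edgeOK : G.EdgeOK (breakpointAt r k) t
  initial : G.IsShortestPathTree ⊥ (T 0)
  mono : ∀ i, i < k → breakpointAt r i ≤ r i
  tree : ∀ i, i < k → ∀ x : EReal, breakpointAt r i ≤ x → x ≤ r i → G.IsShortestPathTree x (T i)
  step : ∀ i, i < k → ∃ (v : Fin n) (p : List (Fin m)), G.IsPivotPath (T i) (r i) v p ∧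
    T (i + 1) = G.pivot (T i) p
  card_le : k ≤ ∑ v, G.pathParam (t v)
  changes : ∀ v, G.pathChanges k T v ≤ G.pathParam (t v)

theorem History.zero {T : ℕ → Finset (Fin m)} (r : ℕ → ℝ) (hT : G.ParentTree Set.univ par t)
    (h0 : T 0 = G.parentEdges par) (ho : G.EdgeOK ⊥ t) : G.History 0 T r par t := by
  refine ⟨hT, h0, ho, by rw [h0]; exact hT.isShortestPathTree ho,
    fun i hi => absurd hi (Nat.not_lt_zero _), fun i hi => absurd hi (Nat.not_lt_zero _),
    fun i hi => absurd hi (Nat.not_lt_zero _), Nat.zero_le _, fun v => ?_⟩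
  simp [pathChanges]

theorem History.congr {k : ℕ} {T T' : ℕ → Finset (Fin m)} {r r' : ℕ → ℝ}
    (h : G.History k T r par t) (hT : ∀ i, i ≤ k → T' i = T i) (hr : ∀ i, i < k → r' i = r i) :
    G.History k T' r' par t := by
  have hb : ∀ i, i ≤ k → breakpointAt r' i = breakpointAt r i := fun i hi =>
    breakpointAt_congr hr hi
  refine ⟨h.parentTree, by rw [hT k le_rfl, h.last], by rw [hb k le_rfl]; exact h.edgeOK,
    by rw [hT 0 (Nat.zero_le _)]; exact h.initial, fun i hi => ?_, fun i hi => ?_, fun i hi => ?_,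
    h.card_le, fun v => ?_⟩
  · rw [hb i hi.le, hr i hi]; exact h.mono i hi
  · rw [hb i hi.le, hr i hi, hT i hi.le]; exact h.tree i hi
  · rw [hr i hi, hT i hi.le, hT (i + 1) hi]; exact h.step i hi
  · have : G.pathChanges k T' v = G.pathChanges k T v := by
      rw [pathChanges, pathChanges]
      congr 1
      ext i
      refine and_congr_right fun hi => ?_
      rw [hT i hi.le, hT (i + 1) hi]
    rw [this]
    exact h.changes v

theorem History.le_ratio {k : ℕ} {T : ℕ → Finset (Fin m)} {r : ℕ → ℝ} (h : G.History k T r par t)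
    {e : Fin m} (hg : G.Gains t e) : breakpointAt r k ≤ (G.ratio t e : EReal) := by
  have h1 := h.edgeOK e
  cases k with
  | zero => exact bot_le
  | succ k =>
    rw [breakpointAt_succ] at h1 ⊢
    exact EReal.coe_le_coe_iff.2 (hg.noLonger_iff.1 h1)

theorem rehang_univ_of_not {v w : Fin n} {p : List (Fin m)} (h : ¬ t v <+: t w) :
    rehang Set.univ t v p w = t w :=
  rehang_of_not (fun hwv => h (hwv ▸ List.prefix_rfl)) fun h' => h h'.2

theorem Gains.pathParam_le_rehang {e : Fin m} (hg : G.Gains t e) (w : Fin n) :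
    G.pathParam (t w) + (if t (G.tgt e) <+: t w then 1 else 0) ≤
      G.pathParam (rehang Set.univ t (G.tgt e) (t (G.src e) ++ [e]) w) := by
  rw [pathParam_rehang _ _ (le_of_lt hg)]
  have : G.pathParam (t (G.tgt e)) < G.pathParam (t (G.src e) ++ [e]) := hg
  split_ifs <;> omega

theorem ParentTree.rehang (hT : G.ParentTree Set.univ par t) {e : Fin m}
    (hnot : ¬ t (G.tgt e) <+: t (G.src e)) :
    G.ParentTree Set.univ (Function.update par (G.tgt e) (e + 1))
      (rehang Set.univ t (G.tgt e) (t (G.src e) ++ [e])) := by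
  have hs : G.tgt e ≠ G.source := by
    intro h
    rw [h, hT.source_path] at hnot
    exact hnot List.nil_prefix
  have := hT.hang (Set.mem_univ _) hs fun h => hnot h.2
  rwa [Set.insert_eq_of_mem (Set.mem_univ _)] at this

theorem History.succ {k : ℕ} {T : ℕ → Finset (Fin m)} {r : ℕ → ℝ} (h : G.History k T r par t)
    {e : Fin m} (hg : G.Gains t e) (hmin : ∀ f, G.Gains t f → G.ratio t e ≤ G.ratio t f)
    (hnot : ¬ t (G.tgt e) <+: t (G.src e)) (hr : r k = G.ratio t e)
    (hTk : T (k + 1) = G.parentEdges (Function.update par (G.tgt e) (e + 1))) :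
    G.History (k + 1) T r (Function.update par (G.tgt e) (e + 1))
      (rehang Set.univ t (G.tgt e) (t (G.src e) ++ [e])) := by
  have hOK : ∀ x : EReal, breakpointAt r k ≤ x → x ≤ r k → G.EdgeOK x t := fun x hx hx' =>
    h.edgeOK.of_le (breakpointAt_ne_top r k) hx fun f hf =>
      hx'.trans (by rw [hr]; exact EReal.coe_le_coe_iff.2 (hmin f hf))
  have hle : breakpointAt r k ≤ r k := by rw [hr]; exact h.le_ratio hg
  have hOKr : G.EdgeOK (G.ratio t e : ℝ) t := by
    have := hOK _ hle le_rfl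
    rwa [hr] at this
  have hT' := h.parentTree.rehang hnot
  refine ⟨hT', hTk, ?_, h.initial, fun i hi => ?_, fun i hi => ?_, fun i hi => ?_, ?_,
    fun v => ?_⟩
  · rw [breakpointAt_succ, hr]
    exact hg.edgeOK_rehang hOKr
  · rcases Nat.lt_succ_iff_lt_or_eq.1 hi with hi | rfl
    · exact h.mono i hi
    · exact hle
  · rcases Nat.lt_succ_iff_lt_or_eq.1 hi with hi | rfl
    · exact h.tree i hi
    · intro x hx hx'
      rw [h.last]
      exact h.parentTree.isShortestPathTree (hOK x hx hx')
  · rcases Nat.lt_succ_iff_lt_or_eq.1 hi with hi | rfl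
    · exact h.step i hi
    · refine ⟨G.tgt e, t (G.src e) ++ [e], ?_, ?_⟩
      · rw [h.last, hr]
        exact h.parentTree.isPivotPath hg hOKr
      · rw [hTk, h.last, h.parentTree.pivot_eq hnot]
  · refine (Nat.succ_le_succ h.card_le).trans (Nat.succ_le_of_lt
      (Finset.sum_lt_sum (fun w _ => ?_) ⟨G.tgt e, Finset.mem_univ _, ?_⟩))
    · exact (Nat.le_add_right _ _).trans (hg.pathParam_le_rehang w)
    · have := hg.pathParam_le_rehang (G.tgt e)
      rwa [if_pos List.prefix_rfl] at this
  · have h1 := hg.pathParam_le_rehang v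
    have h2 := h.changes v
    have hfin : {i : ℕ | i < k ∧ ∃ p, G.IsTreePath (T i) v p ∧
        ¬ G.IsTreePath (T (i + 1)) v p}.Finite :=
      (Set.finite_lt_nat k).subset fun i hi => hi.1
    split_ifs at h1 with hv
    · refine le_trans ?_ ((Nat.succ_le_succ h2).trans h1)
      rw [pathChanges]
      refine (Set.ncard_le_ncard ?_ (hfin.insert k)).trans (Set.ncard_insert_le _ _)
      rintro i ⟨hi, hp⟩
      rcases Nat.lt_succ_iff_lt_or_eq.1 hi with hi | rfl
      · exact Or.inr ⟨hi, hp⟩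
      · exact Or.inl rfl
    · refine le_trans ?_ (h2.trans h1)
      rw [pathChanges]
      refine Set.ncard_le_ncard ?_ hfin
      rintro i ⟨hi, p, hp, hp'⟩
      rcases Nat.lt_succ_iff_lt_or_eq.1 hi with hi | rfl
      · exact ⟨hi, p, hp, hp'⟩
      · rw [h.last, h.parentTree.isTreePath_iff] at hp
        rw [hTk, hT'.isTreePath_iff, rehang_univ_of_not hv] at hp'
        exact absurd hp hp'

/-- The trees `T 0, …, T k` and the breakpoints are a solution with the required properties. -/
structure Solved (G : ParamGraph n m) (k : ℕ) (T : ℕ → Finset (Fin m)) (lam : ℕ → EReal) :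
    Prop where
  isSolution : G.IsSolution k T lam
  isPivotRun : G.IsPivotRun k T lam
  changes : ∀ v, G.pathChanges k T v ≤ n - 1
  card_le : k + 1 ≤ n ^ 2

theorem ParentTree.pathParam_lt (hT : G.ParentTree Set.univ par t) (v : Fin n) :
    G.pathParam (t v) < n :=
  (pathParam_le_length _).trans_lt (hT.length_lt (Set.mem_univ v))

theorem History.solved {k : ℕ} {T : ℕ → Finset (Fin m)} {r : ℕ → ℝ} (h : G.History k T r par t)
    {lam : ℕ → EReal} (hlam : ∀ i, i ≤ k → lam i = breakpointAt r i)
    (hlast : lam (k + 1) = G.lambdaStar) (hle : lam k ≤ lam (k + 1))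
    (hOK : ∀ x, lam k ≤ x → x ≤ lam (k + 1) → G.EdgeOK x t)
    (hfin : (lam (k + 1) = ⊤ ∧ ∀ r v p, ¬ G.IsPivotPath (T k) r v p) ∨
      ∃ (r : ℝ) (v : Fin n) (p : List (Fin m)),
        lam (k + 1) = r ∧ G.IsPivotPath (T k) r v p ∧ ¬ G.IsTree (G.pivot (T k) p)) :
    G.Solved k T lam := by
  refine ⟨⟨hlam 0 (Nat.zero_le _), hlast, fun i hi hik => ⟨r (i - 1), ?_⟩, fun i hi => ?_,
    fun i hi x hx hx' => ?_⟩, ⟨h.initial, fun i hi => ?_, hfin⟩, fun v => ?_, ?_⟩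
  · rw [hlam i hik, breakpointAt, if_neg (by omega)]
  · rcases hi.lt_or_eq with hi | rfl
    · rw [hlam i hi.le, hlam (i + 1) hi]
      exact h.mono i hi
    · exact hle
  · rcases hi.lt_or_eq with hi | rfl
    · rw [hlam i hi.le] at hx
      rw [hlam (i + 1) hi] at hx'
      exact h.tree i hi x hx hx'
    · rw [h.last]
      exact h.parentTree.isShortestPathTree (hOK x hx hx')
  · obtain ⟨v, p, h1, h2⟩ := h.step i hi
    exact ⟨r i, v, p, hlam (i + 1) hi, h1, h2⟩
  · have h1 := h.changes v
    have h2 := h.parentTree.pathParam_lt v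
    omega
  · have h1 : ∑ v, G.pathParam (t v) ≤ n * (n - 1) := by
      refine (Finset.sum_le_card_nsmul Finset.univ _ (n - 1) fun v _ => ?_).trans ?_
      · have := h.parentTree.pathParam_lt v
        omega
      · simp
    have hn : 0 < n := (Nat.zero_le _).trans_lt G.source.2
    obtain ⟨n', rfl⟩ := Nat.exists_eq_succ_of_ne_zero hn.ne'
    have h2 := h.card_le.trans h1
    rw [Nat.succ_eq_add_one, Nat.add_sub_cancel] at h2
    nlinarith

theorem History.lambdaStar_eq_top {k : ℕ} {T : ℕ → Finset (Fin m)} {r : ℕ → ℝ}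
    (h : G.History k T r par t) (hno : ∀ e, ¬ G.Gains t e) : G.lambdaStar = ⊤ := by
  obtain ⟨s, hs⟩ : ∃ s : ℝ, breakpointAt r k ≤ s := by
    cases k with
    | zero => exact ⟨0, bot_le⟩
    | succ k => exact ⟨r k, le_rfl⟩
  exact ParamGraph.lambdaStar_eq_top (s := s) fun x hx => EdgeOK.noNegCycle
    (h.edgeOK.of_le (breakpointAt_ne_top r k) (hs.trans (EReal.coe_le_coe_iff.2 hx))
      fun e he => absurd he (hno e))

theorem History.solved_of_not_gains {k : ℕ} {T : ℕ → Finset (Fin m)} {r : ℕ → ℝ}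
    (h : G.History k T r par t) (hno : ∀ e, ¬ G.Gains t e) {lam : ℕ → EReal}
    (hlam : ∀ i, i ≤ k → lam i = breakpointAt r i) (hlast : lam (k + 1) = ⊤) :
    G.Solved k T lam := by
  have hOK : ∀ x, lam k ≤ x → G.EdgeOK x t := fun x hx => by
    rw [hlam k le_rfl] at hx
    exact h.edgeOK.of_le (breakpointAt_ne_top r k) hx fun e he => absurd he (hno e)
  refine h.solved hlam ?_ ?_ (fun x hx _ => hOK x hx) (Or.inl ⟨hlast, fun r v p hp => ?_⟩)
  · rw [hlast, h.lambdaStar_eq_top hno]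
  · rw [hlast]; exact le_top
  · have h1 := hp.more (t v) (by rw [h.last, h.parentTree.isTreePath_iff])
    have h2 := (hOK ⊤ le_top).noLonger h.parentTree.source_path hp.walk
    rw [noLonger_top] at h2
    omega

theorem History.edgeOK_ratio {k : ℕ} {T : ℕ → Finset (Fin m)} {r : ℕ → ℝ}
    (h : G.History k T r par t) {e : Fin m}
    (hmin : ∀ f, G.Gains t f → G.ratio t e ≤ G.ratio t f) {x : EReal} (hx : breakpointAt r k ≤ x)
    (hx' : x ≤ (G.ratio t e : EReal)) : G.EdgeOK x t :=
  h.edgeOK.of_le (breakpointAt_ne_top r k) hx fun f hf =>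
    hx'.trans (EReal.coe_le_coe_iff.2 (hmin f hf))

theorem History.lambdaStar_eq_ratio {k : ℕ} {T : ℕ → Finset (Fin m)} {r : ℕ → ℝ}
    (h : G.History k T r par t) {e : Fin m} (hg : G.Gains t e)
    (hmin : ∀ f, G.Gains t f → G.ratio t e ≤ G.ratio t f) (hpre : t (G.tgt e) <+: t (G.src e)) :
    G.lambdaStar = (G.ratio t e : EReal) :=
  lambdaStar_eq_coe (EdgeOK.noNegCycle (h.edgeOK_ratio hmin (h.le_ratio hg) le_rfl))
    fun _ hr => h.parentTree.not_noNegCycle hg hpre hr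

theorem History.solved_of_prefix {k : ℕ} {T : ℕ → Finset (Fin m)} {r : ℕ → ℝ}
    (h : G.History k T r par t) {e : Fin m} (hg : G.Gains t e)
    (hmin : ∀ f, G.Gains t f → G.ratio t e ≤ G.ratio t f) (hpre : t (G.tgt e) <+: t (G.src e))
    {lam : ℕ → EReal} (hlam : ∀ i, i ≤ k → lam i = breakpointAt r i)
    (hlast : lam (k + 1) = (G.ratio t e : EReal)) : G.Solved k T lam := by
  have hle : breakpointAt r k ≤ (G.ratio t e : EReal) := h.le_ratio hg
  refine h.solved hlam ?_ ?_ (fun x hx hx' => ?_) (Or.inr ⟨G.ratio t e, G.tgt e,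
    t (G.src e) ++ [e], hlast, ?_, ?_⟩)
  · rw [hlast, h.lambdaStar_eq_ratio hg hmin hpre]
  · rw [hlast, hlam k le_rfl]; exact hle
  · rw [hlam k le_rfl] at hx
    rw [hlast] at hx'
    exact h.edgeOK_ratio hmin hx hx'
  · rw [h.last]
    exact h.parentTree.isPivotPath hg (h.edgeOK_ratio hmin hle le_rfl)
  · rw [h.last]
    exact h.parentTree.not_isTree_pivot hg hpre

/-! ## Keys after a pivot -/

theorem gains_congr {t' : Fin n → List (Fin m)} {f : Fin m} (h1 : t' (G.tgt f) = t (G.tgt f))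
    (h2 : t' (G.src f) = t (G.src f)) :
    (G.Gains t' f ↔ G.Gains t f) ∧ G.ratio t' f = G.ratio t f := by
  rw [Gains, Gains, ratio, ratio, h1, h2]
  exact ⟨Iff.rfl, rfl⟩

theorem Gains.ratio_rehang_le {e f : Fin m} (hg : G.Gains t e) (hf : G.Gains t f)
    (hle : G.ratio t e ≤ G.ratio t f) (htgt : ¬ t (G.tgt e) <+: t (G.tgt f)) :
    G.Gains (rehang Set.univ t (G.tgt e) (t (G.src e) ++ [e])) f ∧
    G.ratio (rehang Set.univ t (G.tgt e) (t (G.src e) ++ [e])) f ≤ G.ratio t f := by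
  have h1 := rehang_univ_of_not (p := t (G.src e) ++ [e]) htgt
  by_cases hsrc : t (G.tgt e) <+: t (G.src f)
  · have hp := pathParam_rehang (G := G) (t := t) (G.tgt e) (G.src f) (le_of_lt hg)
    have hc := pathCost_rehang (G := G) (t := t) (G.tgt e) (G.src f) (t (G.src e) ++ [e])
    rw [if_pos hsrc] at hp hc
    have hg' : G.pathParam (t (G.tgt e)) < G.pathParam (t (G.src e) ++ [e]) := hg
    have hf' : G.pathParam (t (G.tgt f)) < G.pathParam (t (G.src f) ++ [f]) := hf
    have hgain : G.Gains (ParamGraph.rehang Set.univ t (G.tgt e) (t (G.src e) ++ [e])) f := by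
      rw [Gains, h1, pathParam_append, hp]
      rw [pathParam_append] at hf'
      omega
    refine ⟨hgain, ?_⟩
    have hpos := hgain.pos
    have hposf := hf.pos
    have hpose := hg.pos
    have hE : G.pathCost (t (G.src e) ++ [e]) - G.pathCost (t (G.tgt e)) = G.ratio t e *
        ((G.pathParam (t (G.src e) ++ [e]) : ℝ) - G.pathParam (t (G.tgt e))) := by
      rw [ratio, div_mul_cancel₀ _ hpose.ne']
    have hF : G.pathCost (t (G.src f) ++ [f]) - G.pathCost (t (G.tgt f)) = G.ratio t f *
        ((G.pathParam (t (G.src f) ++ [f]) : ℝ) - G.pathParam (t (G.tgt f))) := by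
      rw [ratio, div_mul_cancel₀ _ hposf.ne']
    rw [ratio, div_le_iff₀ hpos, h1, pathCost_append, hc, pathParam_append, hp, hE]
    rw [pathCost_append (t (G.src f)), pathParam_append (t (G.src f))] at hF
    push_cast [Nat.cast_sub hg'.le] at hF ⊢
    nlinarith [mul_le_mul_of_nonneg_right hle hpose.le]
  · have h2 := rehang_univ_of_not (p := t (G.src e) ++ [e]) hsrc
    obtain ⟨h3, h4⟩ := gains_congr (G := G) h1 h2
    exact ⟨h3.2 hf, h4.le⟩

end ParamGraph


variable {n m : ℕ} {G : ParamGraph n m}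

/-! ## The main loop -/

theorem tree_congr {σ τ : Store} (h0 : ∀ v : Fin n, τ.nat .par0 v 0 = σ.nat .par0 v 0) {k : ℕ}
    (h1 : ∀ i, i < k → τ.nat .outVert i 0 = σ.nat .outVert i 0)
    (h2 : ∀ i, i < k → τ.nat .outEdge i 0 = σ.nat .outEdge i 0) {i : ℕ} (hi : i ≤ k) :
    τ.tree G i = σ.tree G i := by
  induction i with
  | zero =>
    simp only [Store.tree, h0]
  | succ i ih =>
    simp only [Store.tree, ih (by omega), h1 i hi, h2 i hi]

theorem tree_succ {σ : Store} {par : Fin n → ℕ} {i : ℕ} {e : Fin m}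
    (h : σ.tree G i = G.parentEdges par) (hv : σ.nat .outVert i 0 = G.tgt e)
    (he : σ.nat .outEdge i 0 = e) :
    σ.tree G (i + 1) = G.parentEdges (Function.update par (G.tgt e) (e + 1)) := by
  ext f
  rw [Store.tree, h, hv, he, Finset.mem_filter, ParamGraph.mem_parentEdges,
    ParamGraph.mem_parentEdges, Function.update_apply]
  simp only [Finset.mem_univ, true_and]
  by_cases hf : G.tgt f = G.tgt e
  · rw [if_pos hf, hf]
    simp only [ne_eq, not_true_eq_false, and_false, or_false]
    omega
  · rw [if_neg hf]
    have h1 : (G.tgt f : ℕ) ≠ G.tgt e := fun h => hf (Fin.ext h)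
    have h2 : (f : ℕ) ≠ e := fun h => hf (by rw [Fin.ext h])
    simp [h1, h2]

/-- What holds between two pivots. -/
structure PivotInv (G : ParamGraph n m) (par : Fin n → ℕ) (t : Fin n → List (Fin m))
    (H : Finset ℕ) (σ : Store) : Prop where
  paths : Paths G t σ
  adj : Adj G m σ
  keys : Keys G t Set.univ Set.univ H σ
  inSub : ∀ w : Fin n, σ.nat .inSub w 0 = 0
  par_eq : ∀ w : Fin n, σ.nat .par w 0 = par w
  history : G.History σ.pivots (σ.tree G) (fun i => σ.real .outLam i 0) par t

/-- The output is correct. -/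
structure Done (G : ParamGraph n m) (σ : Store) : Prop where
  status : σ.nat .status 0 0 = 2 ∨ σ.nat .status 0 0 = 3
  lambdaStar : σ.reportedLambdaStar = G.lambdaStar
  solved : G.Solved σ.pivots (σ.tree G) σ.breakpoint

theorem breakpoint_eq {σ : Store} {i : ℕ} (hi : i ≤ σ.pivots) :
    σ.breakpoint i = ParamGraph.breakpointAt (fun i => σ.real .outLam i 0) i := by
  rw [Store.breakpoint, ParamGraph.breakpointAt, if_pos hi]

theorem breakpoint_last (σ : Store) : σ.breakpoint (σ.pivots + 1) = σ.reportedLambdaStar := by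
  rw [Store.breakpoint, if_neg (Nat.succ_ne_zero _), if_neg (by omega)]

/-- The time that is left for the remaining pivots, up to a constant. -/
def remaining (G : ParamGraph n m) (t : Fin n → List (Fin m)) : ℕ :=
  ∑ w, (n - G.pathParam (t w)) * G.effort w

theorem remaining_rehang {par : Fin n → ℕ} {t : Fin n → List (Fin m)} {e : Fin m}
    (hT : G.ParentTree Set.univ par t) (hg : G.Gains t e)
    (hnot : ¬ t (G.tgt e) <+: t (G.src e)) {L : List (Fin n)} (hnd : L.Nodup)
    (hL : ∀ w, w ∈ L ↔ t (G.tgt e) <+: t w) :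
    remaining G (ParamGraph.rehang Set.univ t (G.tgt e) (t (G.src e) ++ [e])) +
      (L.map G.effort).sum ≤ remaining G t := by
  classical
  have h1 : (L.map G.effort).sum = ∑ w, if w ∈ L then G.effort w else 0 := by
    rw [← List.sum_toFinset _ hnd, ← Finset.sum_filter]
    refine Finset.sum_congr ?_ fun _ _ => rfl
    ext w
    simp
  rw [h1, remaining, remaining, ← Finset.sum_add_distrib]
  refine Finset.sum_le_sum fun w _ => ?_
  have h2 := hg.pathParam_le_rehang w
  have h3 := (hT.rehang hnot).pathParam_lt w
  set a := G.pathParam (ParamGraph.rehang Set.univ t (G.tgt e) (t (G.src e) ++ [e]) w)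
  simp only [hL w]
  split_ifs at h2 ⊢ with h4
  · rw [← Nat.succ_mul]
    exact Nat.mul_le_mul_right _ (by omega)
  · exact Nat.mul_le_mul_right _ (by omega)

theorem keys_rehang {t : Fin n → List (Fin m)} {H : Finset ℕ} {σ τ : Store} {e : Fin m}
    {L : List (Fin n)} (hK : Keys G t Set.univ Set.univ H σ) (hg : G.Gains t e)
    (hmin : ∀ f, G.Gains t f → G.ratio t e ≤ G.ratio t f)
    (hL : ∀ w, w ∈ L ↔ t (G.tgt e) <+: t w) (hH : Heap n H τ)
    (h1 : τ.nat .vEdge = σ.nat .vEdge) (h2 : τ.real .key = σ.real .key) :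
    Keys G (ParamGraph.rehang Set.univ t (G.tgt e) (t (G.src e) ++ [e])) {v | v ∉ L}
      {e | G.tgt e ∉ L ∧ G.src e ∉ L} H τ := by
  refine ⟨hH, fun v hv hvL => ?_, fun f hf hgf => ?_⟩
  · obtain ⟨f, hf1, rfl, hf3, hf4⟩ := hK.edge v hv (Set.mem_univ _)
    have h3 : ¬ t (G.tgt e) <+: t (G.tgt f) := fun h => hvL ((hL _).2 h)
    obtain ⟨h4, h5⟩ := hg.ratio_rehang_le hf3 (hmin f hf3) h3
    rw [h1, h2]
    exact ⟨f, hf1, rfl, h4, h5.trans hf4⟩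
  · have h3 : ¬ t (G.tgt e) <+: t (G.tgt f) := fun h => hf.1 ((hL _).2 h)
    have h4 : ¬ t (G.tgt e) <+: t (G.src f) := fun h => hf.2 ((hL _).2 h)
    obtain ⟨h5, h6⟩ := ParamGraph.gains_congr (G := G)
      (ParamGraph.rehang_univ_of_not (p := t (G.src e) ++ [e]) h3)
      (ParamGraph.rehang_univ_of_not (p := t (G.src e) ++ [e]) h4)
    rw [h6, h2]
    exact hK.le f (Set.mem_univ _) (h5.1 hgf)

theorem Keys.min_edge {t : Fin n → List (Fin m)} {H : Finset ℕ} {σ : Store}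
    (hK : Keys G t Set.univ Set.univ H σ) {r : ℕ} (hr : r ∈ H)
    (hmin : ∀ x ∈ H, σ.real .key r 0 ≤ σ.real .key x 0) :
    ∃ e : Fin m, σ.nat .vEdge r 0 = e ∧ (G.tgt e : ℕ) = r ∧ G.Gains t e ∧
      σ.real .key r 0 = G.ratio t e ∧ ∀ f, G.Gains t f → G.ratio t e ≤ G.ratio t f := by
  have hrn : r < n := hK.heap.isHeap.forest.lt r hr
  obtain ⟨e, h1, h2, h3, h4⟩ := hK.edge ⟨r, hrn⟩ hr (Set.mem_univ _)
  refine ⟨e, h1, congrArg Fin.val h2, h3, ?_, fun f hf => ?_⟩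
  · refine le_antisymm ?_ h4
    have := (hK.le e (Set.mem_univ _) h3).2
    rwa [h2] at this
  · obtain ⟨h5, h6⟩ := hK.le f (Set.mem_univ _) hf
    exact h4.trans ((hmin _ h5).trans h6)

theorem recordPivot_runs (σ : Store) :
    Runs recordPivot σ (fun τ s => τ.nat .numPiv 0 0 = σ.nat .numPiv 0 0 + 1 ∧
      (∀ i, τ.nat .outVert i 0 = if i = σ.nat .numPiv 0 0 then σ.nat .pv 0 0 else σ.nat .outVert i 0) ∧
      (∀ i, τ.nat .outEdge i 0 = if i = σ.nat .numPiv 0 0 then σ.nat .pe 0 0 else σ.nat .outEdge i 0) ∧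
      (∀ i, τ.real .outLam i 0 =
        if i = σ.nat .numPiv 0 0 then σ.real .key (σ.nat .pv 0 0) 0 else σ.real .outLam i 0) ∧
      s ≤ 100) := by
  rw [recordPivot, runs_block_cons, runs_setN, runs_block_cons, runs_setN, runs_block_cons,
    runs_setR, runs_block_single, runs_setN]
  set τ := Store.setNat _ .numPiv _ _ _ with hτ
  refine ⟨?_, fun i => ?_, fun i => ?_, fun i => ?_, ?_⟩
  · simp [hτ]
  · simp [hτ]
  · simp [hτ]
  · simp [hτ]
  · simp only [NExp.time_get, NExp.time_zero, NExp.time_one, NExp.time_add, RExp.time_get]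
    omega

theorem history_congr {par : Fin n → ℕ} {t : Fin n → List (Fin m)} {σ τ : Store}
    (h : G.History σ.pivots (σ.tree G) (fun i => σ.real .outLam i 0) par t)
    (h0 : τ.nat .numPiv = σ.nat .numPiv) (h1 : τ.nat .par0 = σ.nat .par0)
    (h2 : τ.nat .outVert = σ.nat .outVert) (h3 : τ.nat .outEdge = σ.nat .outEdge)
    (h4 : τ.real .outLam = σ.real .outLam) :
    G.History τ.pivots (τ.tree G) (fun i => τ.real .outLam i 0) par t := by
  have h5 : τ.pivots = σ.pivots := by rw [Store.pivots, Store.pivots, h0]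
  rw [h5, h4]
  exact h.congr (fun i hi => tree_congr (fun v => by rw [h1]) (fun j _ => by rw [h2])
    (fun j _ => by rw [h3]) hi) fun _ _ => rfl

theorem le_sum_effort (G : ParamGraph n m) : Nat.log 2 n + 1 ≤ ∑ w, G.effort w := by
  refine le_trans ?_ (Finset.single_le_sum (f := G.effort) (fun w _ => Nat.zero_le _)
    (Finset.mem_univ G.source))
  rw [ParamGraph.effort]
  omega

theorem sum_map_effort_le {L : List (Fin n)} (hnd : L.Nodup) :
    (L.map G.effort).sum ≤ ∑ w, G.effort w := by
  classical
  rw [← List.sum_toFinset _ hnd]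
  exact Finset.sum_le_sum_of_subset (Finset.subset_univ _)

theorem le_sum_map_effort {L : List (Fin n)} {v : Fin n} (hv : v ∈ L) :
    Nat.log 2 n + 1 ≤ (L.map G.effort).sum := by
  refine le_trans ?_ (List.single_le_sum (fun _ _ => Nat.zero_le _) _ (List.mem_map_of_mem hv))
  rw [ParamGraph.effort]
  omega

theorem length_le_sum_map_effort (L : List (Fin n)) : L.length ≤ (L.map G.effort).sum := by
  have := List.card_nsmul_le_sum (L.map G.effort) 1 (by
    intro x hx
    obtain ⟨w, -, rfl⟩ := List.mem_map.1 hx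
    rw [ParamGraph.effort]
    omega)
  simpa using this

/-- A pivot. -/
theorem pivot_runs {par : Fin n → ℕ} {t : Fin n → List (Fin m)} {H : Finset ℕ} {σ : Store}
    {e : Fin m} {L : List (Fin n)} (hP : Paths G t σ) (hA : Adj G m σ)
    (hK : Keys G t Set.univ Set.univ H σ) (hpar : ∀ w : Fin n, σ.nat .par w 0 = par w)
    (hh : G.History σ.pivots (σ.tree G) (fun i => σ.real .outLam i 0) par t)
    (hL : Listed L σ) (hnd : L.Nodup) (hmem : ∀ w, w ∈ L ↔ t (G.tgt e) <+: t w)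
    (hin : ∀ w : Fin n, σ.nat .inSub w 0 = if w ∈ L then 1 else 0)
    (hv : σ.nat .pv 0 0 = G.tgt e) (he : σ.nat .pe 0 0 = e) (hg : G.Gains t e)
    (hkey : σ.real .key (G.tgt e) 0 = G.ratio t e)
    (hmin : ∀ f, G.Gains t f → G.ratio t e ≤ G.ratio t f)
    (hnot : ¬ t (G.tgt e) <+: t (G.src e)) :
    Runs (block [recordPivot, updatePaths, updateKeys]) σ (fun τ s => ∃ par' t' H',
      PivotInv G par' t' H' τ ∧ s + 50000 * remaining G t' + 1000 * pot τ +
        29000 * (L.map G.effort).sum ≤ 50000 * remaining G t + 1000 * pot σ) := by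
  set p := t (G.src e) ++ [e] with hp
  rw [runs_block_cons]
  refine (recordPivot_runs σ).mono_frame ?_
  rintro σ1 s1 ⟨hk1, hov1, hoe1, hol1, hs1⟩ f1
  have hP1 := hP.frame f1 rfl rfl
  obtain ⟨hH1, hpot1⟩ := hK.heap.frame f1 rfl
  have hL1 : Listed L σ1 :=
    ⟨by rw [f1.1 .subN rfl]; exact hL.length_eq, by rw [f1.1 .sub rfl]; exact hL.get_eq⟩
  rw [runs_block_cons]
  refine (updatePaths_runs hP1 hL1 hnd hmem (by rw [f1.1 .inSub rfl]; exact hin)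
    (by rw [f1.1 .pv rfl, hv]) (by rw [f1.1 .pe rfl, he]) hg).mono_frame ?_
  rintro σ2 s2 ⟨hP2, hin2, hpar2, hs2⟩ f2
  obtain ⟨hH2, hpot2⟩ := hH1.frame f2 rfl
  have hL2 : Listed L σ2 :=
    ⟨by rw [f2.1 .subN rfl]; exact hL1.length_eq, by rw [f2.1 .sub rfl]; exact hL1.get_eq⟩
  have hA1 : Adj G m σ1 := hA.frame f1 rfl
  have hA2 : Adj G m σ2 := hA1.frame f2 rfl
  have hK2 := keys_rehang hK hg hmin hmem hH2 (by rw [f2.1 .vEdge rfl, f1.1 .vEdge rfl])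
    (by rw [f2.2 .key rfl, f1.2 .key rfl])
  rw [runs_block_single]
  refine (updateKeys_runs hP2 hA2 hL2 hnd hK2).mono_frame ?_
  rintro σ3 s3 ⟨⟨H3, hK3⟩, hs3⟩ f3
  have hk3 : σ3.pivots = σ.pivots + 1 := by
    rw [Store.pivots, f3.1 .numPiv rfl, f2.1 .numPiv rfl, hk1]
    rfl
  have hov3 : σ3.nat .outVert = σ1.nat .outVert := by rw [f3.1 .outVert rfl, f2.1 .outVert rfl]
  have hoe3 : σ3.nat .outEdge = σ1.nat .outEdge := by rw [f3.1 .outEdge rfl, f2.1 .outEdge rfl]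
  have hol3 : σ3.real .outLam = σ1.real .outLam := by rw [f3.2 .outLam rfl, f2.2 .outLam rfl]
  have hp03 : σ3.nat .par0 = σ.nat .par0 := by
    rw [f3.1 .par0 rfl, f2.1 .par0 rfl, f1.1 .par0 rfl]
  have hh' : G.History σ.pivots (σ3.tree G) (fun i => σ3.real .outLam i 0) par t := by
    refine hh.congr (fun i hi => tree_congr (fun v => by rw [hp03]) (fun j hj => ?_)
      (fun j hj => ?_) hi) fun j hj => ?_
    · rw [hov3, hov1, if_neg (show j ≠ σ.nat .numPiv 0 0 from hj.ne)]
    · rw [hoe3, hoe1, if_neg (show j ≠ σ.nat .numPiv 0 0 from hj.ne)]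
    · rw [hol3, hol1, if_neg (show j ≠ σ.nat .numPiv 0 0 from hj.ne)]
  have hpiv : σ.pivots = σ.nat .numPiv 0 0 := rfl
  have hsucc := hh'.succ hg hmin hnot (by rw [hol3, hol1, if_pos hpiv, hv, hkey])
    (tree_succ hh'.last (by rw [hov3, hov1, if_pos hpiv, hv]) (by rw [hoe3, hoe1, if_pos hpiv, he]))
  have hpar3 : ∀ w : Fin n, σ3.nat .par w 0 = Function.update par (G.tgt e) (e + 1) w := by
    intro w
    rw [f3.1 .par rfl, hpar2, f1.1 .par rfl]
    simp only [Function.update_apply, hpar]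
  refine ⟨_, _, H3, ⟨hP2.frame f3 rfl rfl, hA2.frame f3 rfl, hK3, ?_, hpar3, ?_⟩, ?_⟩
  · rw [f3.1 .inSub rfl]
    exact hin2
  · rw [hk3]
    exact hsucc
  · have h1 := remaining_rehang hh.parentTree hg hnot hnd hmem
    have h2 := length_le_sum_map_effort (G := G) L
    have h3 := le_sum_map_effort (G := G) ((hmem _).2 (List.prefix_refl (t (G.tgt e))))
    rw [hpot2, hpot1] at hs3
    omega

theorem pivotStep_runs {par : Fin n → ℕ} {t : Fin n → List (Fin m)} {H : Finset ℕ} {σ : Store}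
    (h : PivotInv G par t H σ) (hst : σ.nat .status 0 0 = 0) :
    Runs pivotStep σ (fun τ s =>
      (∃ par' t' H', PivotInv G par' t' H' τ ∧ τ.nat .status 0 0 = 0 ∧
        s + 50000 * remaining G t' + 1000 * pot τ + 100 ≤
          50000 * remaining G t + 1000 * pot σ) ∨
      (Done G τ ∧ s ≤ 1000 * pot σ + 20000 * ∑ w, G.effort w + 1000)) := by
  have heff := le_sum_effort G
  rw [pivotStep, runs_block_cons]
  refine (heapFindMin_runs h.keys.heap).mono_frame ?_
  rintro σ1 s1 ⟨hH1, hb1, hs1⟩ f1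
  have hP1 := h.paths.frame f1 rfl rfl
  have hA1 : Adj G m σ1 := h.adj.frame f1 rfl
  have hK1 := h.keys.congr hH1 (f1.1 .vEdge rfl) (f1.2 .key rfl)
  have hh1 := history_congr (τ := σ1) h.history (f1.1 .numPiv rfl) (f1.1 .par0 rfl)
    (f1.1 .outVert rfl) (f1.1 .outEdge rfl) (f1.2 .outLam rfl)
  have hpar1 : ∀ w : Fin n, σ1.nat .par w 0 = par w := by rw [f1.1 .par rfl]; exact h.par_eq
  have hin1 : ∀ w : Fin n, σ1.nat .inSub w 0 = 0 := by rw [f1.1 .inSub rfl]; exact h.inSub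
  rw [runs_block_single, runs_ite]
  simp only [BExp.holds, NExp.eval_get, NExp.eval_zero]
  refine ⟨fun hb => ?_, fun hb => ?_⟩
  · obtain ⟨-, rfl⟩ : σ1.nat .best 0 0 = 0 ∧ H = ∅ := by
      refine hb1.resolve_right ?_
      rintro ⟨r, -, hr, -⟩
      omega
    have hno : ∀ e, ¬ G.Gains t e := fun e he =>
      Finset.notMem_empty _ (hK1.le e (Set.mem_univ _) he).1
    rw [runs_setN]
    set τ := Store.setNat _ .status _ _ _ with hτ
    have hhτ := history_congr (τ := τ) hh1 rfl rfl rfl rfl rfl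
    have hstτ : τ.nat .status 0 0 = 2 := rfl
    have hrep : τ.reportedLambdaStar = ⊤ := by
      rw [Store.reportedLambdaStar, hstτ]
      simp
    refine Or.inr ⟨⟨Or.inl hstτ, by rw [hrep, hhτ.lambdaStar_eq_top hno],
      hhτ.solved_of_not_gains hno (fun i hi => breakpoint_eq hi)
        (by rw [breakpoint_last, hrep])⟩, ?_⟩
    simp only [BExp.time, NExp.time_get, NExp.time_zero, show NExp.time 2 = 1 from rfl]
    omega
  · obtain ⟨r, hrH, hr, hmin⟩ := hb1.resolve_left fun h => hb h.1
    rw [← f1.2 .key rfl] at hmin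
    obtain ⟨e, he1, rfl, hg, hkey, hmine⟩ := hK1.min_edge hrH hmin
    rw [runs_block_cons, runs_setN, runs_block_cons, runs_setN, runs_block_cons]
    set σ3 := Store.setNat _ .pe _ _ _ with hσ3
    have hpv3 : σ3.nat .pv 0 0 = G.tgt e := by simp [hσ3, hr]
    have hpe3 : σ3.nat .pe 0 0 = e := by simp [hσ3, hr, he1]
    have hP3 : Paths G t σ3 :=
      ⟨hP1.input.congr rfl rfl rfl rfl rfl rfl rfl, hP1.cst_eq, hP1.cnt_eq⟩
    have hH3 : Heap n H σ3 := hH1.congr rfl rfl rfl rfl rfl rfl rfl rfl rfl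
    have hpot3 : pot σ3 = pot σ1 := rfl
    refine (searchSubtree_runs hP3.input hA1 hh1.parentTree hpar1 hpv3 hin1).mono_frame ?_
    rintro σ4 s4 ⟨L, hL4, hnd, hmem, hin4, hs4⟩ f4
    have hP4 := hP3.frame f4 rfl rfl
    obtain ⟨hH4, hpot4⟩ := hH3.frame f4 rfl
    have hh4 := history_congr (τ := σ4) (σ := σ1) hh1 (f4.1 .numPiv rfl) (f4.1 .par0 rfl)
      (f4.1 .outVert rfl) (f4.1 .outEdge rfl) (f4.2 .outLam rfl)
    have hpv4 : σ4.nat .pv 0 0 = G.tgt e := by rw [f4.1 .pv rfl, hpv3]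
    have hpe4 : σ4.nat .pe 0 0 = e := by rw [f4.1 .pe rfl, hpe3]
    have hkey4 : σ4.real .key (G.tgt e) 0 = G.ratio t e := by rw [f4.2 .key rfl]; exact hkey
    have hvL : G.tgt e ∈ L := (hmem _).2 List.prefix_rfl
    have hsum1 := sum_map_effort_le (G := G) hnd
    have hsum2 := le_sum_map_effort (G := G) hvL
    rw [runs_block_single, runs_ite]
    simp only [BExp.holds, NExp.eval_get, NExp.eval_zero, NExp.eval_one, hpe4, hP4.input.src_eq,
      hin4, hmem]
    refine ⟨fun hpre => ?_, fun hpre => ?_⟩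
    · have hpre : t (G.tgt e) <+: t (G.src e) := by
        by_contra h1; simp [h1] at hpre
      rw [runs_block_cons, runs_setR, runs_block_single, runs_setN]
      set τ := Store.setNat _ .status _ _ _ with hτ
      have hhτ := history_congr (τ := τ) hh4 rfl rfl rfl rfl rfl
      have hstτ : τ.nat .status 0 0 = 3 := rfl
      have hlam : τ.real .lamStar 0 0 = G.ratio t e := by
        simp [hτ, hpv4, hkey4]
      have hrep : τ.reportedLambdaStar = (G.ratio t e : EReal) := by
        rw [Store.reportedLambdaStar, hstτ, hlam]
        simp
      refine Or.inr ⟨⟨Or.inr hstτ, by rw [hrep, hhτ.lambdaStar_eq_ratio hg hmine hpre],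
        hhτ.solved_of_prefix hg hmine hpre (fun i hi => breakpoint_eq hi)
          (by rw [breakpoint_last, hrep])⟩, ?_⟩
      simp only [BExp.time, NExp.time_get, NExp.time_zero, NExp.time_one, show NExp.time 3 = 1 from rfl,
        NExp.time_sub, RExp.time_get]
      omega
    · have hpre : ¬ t (G.tgt e) <+: t (G.src e) := by
        intro h1; simp [h1] at hpre
      have hA4 : Adj G m σ4 := Adj.frame (σ := σ3) hA1 f4 rfl
      have hK4 : Keys G t Set.univ Set.univ H σ4 :=
        hK1.congr hH4 (f4.1 .vEdge rfl) (f4.2 .key rfl)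
      have hpar4 : ∀ w : Fin n, σ4.nat .par w 0 = par w := by rw [f4.1 .par rfl]; exact hpar1
      refine (pivot_runs hP4 hA4 hK4 hpar4 hh4 hL4 hnd hmem hin4 hpv4 hpe4 hg hkey4 hmine
        hpre).mono_frame ?_
      rintro τ s ⟨par', t', H', hinv, hs⟩ f
      refine Or.inl ⟨par', t', H', hinv, ?_, ?_⟩
      · rw [f.1 .status rfl, f4.1 .status rfl]
        change σ1.nat .status 0 0 = 0
        rw [f1.1 .status rfl, hst]
      · simp only [BExp.time, NExp.time_get, NExp.time_zero, NExp.time_one, NExp.time_sub]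
        omega


variable {n m : ℕ} {G : ParamGraph n m}

/-! ## The algorithm -/

theorem mainLoop_runs {par : Fin n → ℕ} {t : Fin n → List (Fin m)} {H : Finset ℕ} {σ : Store}
    (h : PivotInv G par t H σ) (hst : σ.nat .status 0 0 = 0) :
    Runs (.loop (.eqN NVar.status.val 0) pivotStep) σ (fun τ s => Done G τ ∧
      s ≤ 50000 * remaining G t + 1000 * pot σ + 20000 * ∑ w, G.effort w + 3000) := by
  refine (Runs.loop (fun k σ => (∃ par t H, PivotInv G par t H σ ∧ σ.nat .status 0 0 = 0 ∧
    50000 * remaining G t + 1000 * pot σ + 20000 * ∑ w, G.effort w + 2000 ≤ k) ∨ Done G σ) ?_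
    (k := 50000 * remaining G t + 1000 * pot σ + 20000 * ∑ w, G.effort w + 2000)
    (Or.inl ⟨par, t, H, h, hst, le_rfl⟩)).mono ?_
  · rintro k σ hI hb
    simp only [BExp.holds, NExp.eval_get, NExp.eval_zero] at hb
    obtain ⟨par, t, H, h, hst, hk⟩ := hI.resolve_right fun hd => by
      rcases hd.status with h | h <;> omega
    refine (pivotStep_runs h hst).mono ?_
    rintro τ s (⟨par', t', H', h', hst', hs⟩ | ⟨hd, hs⟩)
    · refine ⟨_, Or.inl ⟨par', t', H', h', hst', le_rfl⟩, ?_⟩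
      simp only [BExp.time, NExp.time_get, NExp.time_zero]
      calc _ = (s + 50000 * remaining G t' + 1000 * pot τ + 100) +
            (20000 * ∑ w, G.effort w + 1906) := by ring
        _ ≤ (50000 * remaining G t + 1000 * pot σ) + (20000 * ∑ w, G.effort w + 2000) := by
          gcongr
          norm_num
        _ ≤ k := by rwa [← Nat.add_assoc]
    · refine ⟨0, Or.inr hd, ?_⟩
      simp only [BExp.time, NExp.time_get, NExp.time_zero]
      generalize ∑ w, G.effort w = u at hk hs
      omega
  · rintro τ s ⟨k', hI, hb, hs⟩
    simp only [BExp.holds, NExp.eval_get, NExp.eval_zero] at hb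
    refine ⟨hI.resolve_left ?_, ?_⟩
    · rintro ⟨-, -, -, -, h, -⟩
      exact hb h
    · simp only [BExp.time, NExp.time_get, NExp.time_zero] at hs
      omega

theorem sum_effort (G : ParamGraph n m) : ∑ w, G.effort w = n * (Nat.log 2 n + 1) + 2 * m := by
  have h : ∀ f : Fin m → Fin n, ∑ w, (Finset.univ.filter fun e => f e = w).card = m := by
    intro f
    rw [← Finset.card_eq_sum_card_fiberwise (fun e _ => Finset.mem_coe.2 (Finset.mem_univ (f e)))]
    simp
  simp only [ParamGraph.effort, Finset.sum_add_distrib, h]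
  simp
  ring

theorem remaining_le (G : ParamGraph n m) (t : Fin n → List (Fin m)) :
    remaining G t ≤ n * ∑ w, G.effort w := by
  rw [remaining, Finset.mul_sum]
  exact Finset.sum_le_sum fun w _ => Nat.mul_le_mul_right _ (Nat.sub_le _ _)

theorem parametricShortestPaths_runs (hG : G.AllReachable) :
    Runs parametricShortestPaths G.load (fun τ s =>
      ((¬ G.NoNegCycle (-G.bigCost) ∧ τ.nat .status 0 0 = 1) ∨ Done G τ) ∧
      s ≤ 400 * (n * m) + 300 * n + 10000 * m + 4000 +
        (50000 * n + 20000) * (n * (Nat.log 2 n + 1) + 2 * m)) := by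
  rw [parametricShortestPaths, runs_block_cons]
  refine (buildLists_runs (input_load G) (fun _ => rfl) fun _ => rfl).mono_frame ?_
  rintro σ1 s1 ⟨hA1, hs1⟩ f1
  have hI1 := (input_load G).frame f1 rfl
  rw [runs_block_cons]
  refine (computeBig_runs hI1).mono_frame ?_
  rintro σ2 s2 ⟨hbig2, hs2⟩ f2
  have hI2 := hI1.frame f2 rfl
  have hA2 := hA1.frame f2 rfl
  rw [runs_block_cons]
  refine (bellmanFord_runs hI2 hbig2 (fun i => by rw [f2.1 .reach rfl, f1.1 .reach rfl]; rfl)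
    (fun i => by rw [f2.2 .cst rfl, f1.2 .cst rfl]; rfl)
    (fun i => by rw [f2.1 .cnt rfl, f1.1 .cnt rfl]; rfl)
    (fun i => by rw [f2.1 .par rfl, f1.1 .par rfl]; rfl)).mono_frame ?_
  rintro σ3 s3 ⟨hR3, hs3⟩ f3
  have hI3 := hI2.frame f3 rfl
  have hA3 := hA2.frame f3 rfl
  have hzero : ∀ A : NVar, buildLists.writesN A = false → computeBig.writesN A = false →
      bellmanFord.writesN A = false → σ3.nat A = G.load.nat A := fun A h1 h2 h3 => by
    rw [f3.1 A h3, f2.1 A h2, f1.1 A h1]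
  have hs3' : n * (400 * m + 200) = 400 * (n * m) + 200 * n := by ring
  have hmul : (50000 * n + 20000) * (n * (Nat.log 2 n + 1) + 2 * m) =
      50000 * (n * (n * (Nat.log 2 n + 1) + 2 * m)) +
        20000 * (n * (Nat.log 2 n + 1) + 2 * m) := by ring
  rw [runs_block_single, runs_ite]
  simp only [BExp.holds, NExp.eval_get, NExp.eval_zero, NExp.eval_one]
  refine ⟨fun hb => ?_, fun hb => ?_⟩
  · rw [runs_setN]
    refine ⟨Or.inl ⟨fun hno => ?_, rfl⟩, ?_⟩
    · have := (hR3.exists_tree hG hno).1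
      omega
    · simp only [BExp.time, NExp.time_get, NExp.time_zero, NExp.time_one]
      omega
  · have hno : G.NoNegCycle (-G.bigCost) := by
      by_contra hno
      exact hb (hR3.chg_eq_one hG hno)
    obtain ⟨-, t, hT, hOK, hlab⟩ := hR3.exists_tree hG hno
    have hP3 : Paths G t σ3 := ⟨hI3, fun v => (hlab v).1, fun v => (hlab v).2⟩
    rw [runs_block_cons]
    refine (initKeys_runs hP3 (fun x => by rw [hzero .deg rfl rfl rfl]; rfl)
      (fun x => by rw [hzero .mark rfl rfl rfl]; rfl)
      (fun x => by rw [hzero .bucket rfl rfl rfl]; rfl)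
      (fun x => by rw [hzero .inHeap rfl rfl rfl]; rfl)).mono_frame ?_
    rintro σ4 s4 ⟨⟨H, hK⟩, hpar0, hs4⟩ f4
    have hpar4 : ∀ w : Fin n, σ4.nat .par w 0 = σ3.nat .par w 0 := fun w => by
      rw [f4.1 .par rfl]
    have hpiv4 : σ4.pivots = 0 := by
      rw [Store.pivots, f4.1 .numPiv rfl, hzero .numPiv rfl rfl rfl]
      rfl
    have hst4 : σ4.nat .status 0 0 = 0 := by
      rw [f4.1 .status rfl, hzero .status rfl rfl rfl]
      rfl
    have hinv : PivotInv G (fun v => σ3.nat .par v 0) t H σ4 := by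
      refine ⟨hP3.frame f4 rfl rfl, hA3.frame f4 rfl, hK, fun w => ?_, hpar4, ?_⟩
      · rw [f4.1 .inSub rfl, hzero .inSub rfl rfl rfl]
        rfl
      · rw [hpiv4]
        refine .zero _ hT ?_ hOK
        ext e
        rw [Store.tree, ParamGraph.mem_parentEdges, Finset.mem_filter, hpar0]
        exact and_iff_right (Finset.mem_univ _)
    rw [runs_block_single]
    refine (mainLoop_runs hinv hst4).mono ?_
    rintro τ s ⟨hd, hs⟩
    refine ⟨Or.inr hd, ?_⟩
    have hrem := remaining_le G t
    rw [sum_effort] at hrem hs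
    simp only [BExp.time, NExp.time_get, NExp.time_zero, NExp.time_one]
    omega

theorem ParamGraph.AllReachable.le_succ (hG : G.AllReachable) : n ≤ m + 1 := by
  classical
  have h : (Finset.univ.erase G.source) ⊆ Finset.univ.image G.tgt := by
    intro v hv
    obtain ⟨p, hp⟩ := hG v
    rcases List.eq_nil_or_concat p with rfl | ⟨q, e, rfl⟩
    · exact absurd hp.symm (Finset.ne_of_mem_erase hv)
    · rw [List.concat_eq_append, ParamGraph.isWalk_concat] at hp
      exact Finset.mem_image.2 ⟨e, Finset.mem_univ _, hp.2⟩
  have h1 := (Finset.card_le_card h).trans Finset.card_image_le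
  rw [Finset.card_erase_of_mem (Finset.mem_univ _), Finset.card_univ, Finset.card_univ,
    Fintype.card_fin, Fintype.card_fin] at h1
  omega

theorem natLog_two_le (n : ℕ) : (Nat.log 2 n : ℝ) ≤ 2 * Real.log n := by
  have h1 : (Nat.log 2 n : ℝ) ≤ Real.logb 2 n := Real.natLog_le_logb n 2
  have h2 : (1 / 2 : ℝ) ≤ Real.log 2 := by
    have := Real.log_two_gt_d9
    linarith
  rw [Real.logb, le_div_iff₀ (by linarith)] at h1
  have h3 : (0 : ℝ) ≤ Nat.log 2 n := Nat.cast_nonneg _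
  nlinarith

theorem time_le {s : ℕ} (hn : 0 < n) (hm : 0 < m) (hnm : n ≤ m + 1)
    (hs : s ≤ 400 * (n * m) + 300 * n + 10000 * m + 4000 +
        (50000 * n + 20000) * (n * (Nat.log 2 n + 1) + 2 * m)) :
    (s : ℝ) ≤ 1000000 * ((n : ℝ) * m + (n : ℝ) ^ 2 * Real.log n) := by
  have hlog := natLog_two_le n
  set l := Nat.log 2 n
  have h1 : s ≤ 500000 * (n * m) + 70000 * (n * n * l) := by
    have h2 : n * n ≤ 2 * (n * m) := by
      have := Nat.mul_le_mul_left n (show n ≤ 2 * m by omega)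
      rw [← Nat.mul_assoc, Nat.mul_comm n 2, Nat.mul_assoc] at this
      exact this
    have h3 : n ≤ n * m := Nat.le_mul_of_pos_right n hm
    have h4 : m ≤ n * m := Nat.le_mul_of_pos_left m hn
    have h5 : n * l ≤ n * n * l := Nat.mul_le_mul_right l (Nat.le_mul_of_pos_right n hn)
    have h6 : (50000 * n + 20000) * (n * (l + 1) + 2 * m) = 50000 * (n * n * l) +
        50000 * (n * n) + 100000 * (n * m) + 20000 * (n * l) + 20000 * n + 40000 * m := by ring
    omega
  have h2 : (s : ℝ) ≤ 500000 * (n * m) + 70000 * (n * n * l) := by exact_mod_cast h1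
  have h3 : (n : ℝ) * n * l ≤ n * n * (2 * Real.log n) :=
    mul_le_mul_of_nonneg_left hlog (by positivity)
  have h4 : (0 : ℝ) ≤ n * m := by positivity
  have h5 : (0 : ℝ) ≤ n * n * (2 * Real.log n) := le_trans (by positivity) h3
  nlinarith

end KarpOrlin

theorem mainTheorem1 :
    ∃ C : ℝ, 0 < C ∧ ∀ (n m : ℕ) (G : KarpOrlin.ParamGraph n m), G.AllReachable →
      ∃ (σ : KarpOrlin.Store) (t : ℕ),
        KarpOrlin.Exec KarpOrlin.parametricShortestPaths G.load σ t ∧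
        (0 < m → (t : ℝ) ≤ C * ((n : ℝ) * m + (n : ℝ) ^ 2 * Real.log n)) ∧
        σ.reportedLambdaStar = G.lambdaStar ∧
        σ.numTrees ≤ n ^ 2 ∧
        (G.lambdaStar = ⊥ → σ.numTrees = 0) ∧
        (G.lambdaStar ≠ ⊥ →
          σ.numTrees = σ.pivots + 1 ∧
          G.IsSolution σ.pivots (σ.tree G) σ.breakpoint ∧
          G.IsPivotRun σ.pivots (σ.tree G) σ.breakpoint ∧
          ∀ v : Fin n, G.pathChanges σ.pivots (σ.tree G) v ≤ n - 1) := by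
  refine ⟨1000000, by norm_num, fun n m G hG => ?_⟩
  obtain ⟨σ, t, hexec, h, ht⟩ := KarpOrlin.parametricShortestPaths_runs hG
  have hn : 0 < n := (Nat.zero_le _).trans_lt G.source.2
  refine ⟨σ, t, hexec, fun hm => KarpOrlin.time_le hn hm hG.le_succ ht, ?_⟩
  rcases h with ⟨hno, hst⟩ | ⟨hst, hlam, hsol⟩
  · have hbot : G.lambdaStar = ⊥ := KarpOrlin.ParamGraph.lambdaStar_eq_bot
      (KarpOrlin.ParamGraph.not_noNegCycle_of_bigCost hno)
    have htrees : σ.numTrees = 0 := by rw [KarpOrlin.Store.numTrees, if_pos hst]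
    refine ⟨?_, by rw [htrees]; exact Nat.zero_le _, fun _ => htrees, fun h => absurd hbot h⟩
    rw [KarpOrlin.Store.reportedLambdaStar, if_pos hst, hbot]
  · have hst1 : σ.nat .status 0 0 ≠ 1 := by omega
    have htrees : σ.numTrees = σ.pivots + 1 := by
      rw [KarpOrlin.Store.numTrees, if_neg hst1]
    refine ⟨hlam, by rw [htrees]; exact hsol.card_le, fun hbot => ?_,
      fun _ => ⟨htrees, hsol.isSolution, hsol.isPivotRun, hsol.changes⟩⟩
    rw [← hlam, KarpOrlin.Store.reportedLambdaStar, if_neg hst1] at hbot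
    split_ifs at hbot
    · exact absurd hbot top_ne_bot
    · exact absurd hbot (EReal.coe_ne_bot _)
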